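/- Let $\mu>0$ and $s>1/2$. For $r\in\mathbb R$ let $H^r(\mathbb R)$ denote the $L^2$-based Sobolev space of real-valued tempered distributions. Then the initial value problem for the Kuramoto–Sivashinsky equation $$u_t-\partial_x^2u-\mu(1-\partial_x^2)^{-1/2}u-\tfrac12(\partial_xu)^2=0,\quad x\in\mathbb R,\ t\ge 0,\qquad u(x,0)=\phi(x),\tag{KS}$$ is globally well-posed in $H^s(\mathbb R)$, in the following sense. Put $a=\max\{\frac{1-s}{2},0\}$ and, for $T>0$, let $\mathcal X_T^s$ be the normed space of all $u\in C([0,T];H^s(\mathbb R))$ with $\partial_xu(t)\in L^2(\mathbb R)$ for $0<t\le T$ and $$\|u\|_{\mathcal X_T^s}=\sup_{t\in[0,T]}\Big(\|u(t)\|_{H^s}+t^{a}\|\partial_xu(t)\|_{L^2}\Big)<\infty,$$ where the second term is read as $0$ at $t=0$ (for $s\ge1$ this is $C([0,T];H^s(\mathbb R))$ with an equivalent norm). A curve $u$ with $\partial_x u(t)\in L^2(\mathbb R)$ solves the equation at time $t>0$ if for every Schwartz function $\psi$ the function $\tau\mapsto\langle u(\tau),\psi\rangle$ is differentiable at $t$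 with derivative $\langle \partial_x^2u(t)+\mu(1-\partial_x^2)^{-1/2}u(t)+\frac12(\partial_xu(t))^2,\psi\rangle$. Then: 1. (Existence and persistence) for every $\phi\in H^s(\mathbb R)$ there is $u=u^\phi\in C([0,\infty);H^s(\mathbb R))$ with $u(0)=\phi$ that solves the equation at every $t>0$ and whose restriction to $[0,T]$ belongs to $\mathcal X_T^s$ for every $T>0$; 2. (Uniqueness) for every $T>0$ and $\phi\in H^s(\mathbb R)$, every $v\in\mathcal X_T^s$ with $v(0)=\phi$ that solves the equation at every $t\in(0,T)$ equals $u^\phi$ on $[0,T]$; 3. (Smooth dependence) for every $T>0$ the data-to-solution map $\phi\mapsto u^\phi|_{[0,T]}$ is $C^\infty$ (in the Fréchet sense) from $H^s(\mathbb R)$ to $\mathcal X_T^s$, hence also from $H^s(\mathbb R)$ to $C([0,T];H^s(\mathbb R))$. -/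

import Mathlib

open MeasureTheory Set
open scoped SchwartzMap ContDiff

noncomputable section

namespace KS

/-- Distributions on the line, and square integrable functions on the line.
Everything is complex valued at first; real-valuedness is imposed by `IsReal`. -/
abbrev Distr : Type := 𝓢'(ℝ, ℂ)

abbrev L2 : Type := Lp ℂ 2 (volume : Measure ℝ)

/-- The distributional derivative `∂ₓ`. -/
abbrev dx (f : Distr) : Distr := TemperedDistribution.derivCLM ℂ f

/-- The operator `(1 - ∂ₓ²) ^ (-1/2)`, i.e. the Fourier multiplier `(1 + ξ²) ^ (-1/2)` in the
convention `f̂ ξ = ∫ exp (-i ξ x) f x dx`. Mathlib's Fourier transform is taken at frequency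
`ξ / (2 π)`, so the symbol is evaluated at `2 π ξ`. -/
def invSqrtOneSubLaplacian (f : Distr) : Distr :=
  TemperedDistribution.fourierMultiplierCLM ℂ
    (fun ξ : ℝ => (((1 + (2 * Real.pi * ξ) ^ 2) ^ (-1 / 2 : ℝ) : ℝ) : ℂ)) f

/-- A distribution is real valued if it takes real values on real test functions. -/
def IsReal (f : Distr) : Prop :=
  ∀ ψ : 𝓢(ℝ, ℂ), (∀ x, (ψ x).im = 0) → (f ψ).im = 0

/-- `f` is (represented by) a square integrable function. -/
def MemL2 (f : Distr) : Prop := ∃ g : L2, f = g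

open Classical in
/-- The `L²` norm of a distribution given by a square integrable function (and `0` otherwise). -/
def l2Norm (f : Distr) : ℝ := if h : MemL2 f then ‖h.choose‖ else 0

theorem coe_injective {g g' : L2} (h : (g : Distr) = g') : g = g' := by
  have hk := MeasureTheory.Lp.ker_toTemperedDistributionCLM_eq_bot (E := ℝ) (F := ℂ)
    (μ := volume) (p := 2)
  exact LinearMap.ker_eq_bot.mp hk h

theorem l2Norm_coe (g : L2) : l2Norm (g : Distr) = ‖g‖ := by
  have h : MemL2 (g : Distr) := ⟨g, rfl⟩
  rw [l2Norm, dif_pos h, ← coe_injective h.choose_spec]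

theorem l2Norm_nonneg (f : Distr) : 0 ≤ l2Norm f := by
  unfold l2Norm; split_ifs <;> simp

theorem coe_add (g g' : L2) : ((g + g' : L2) : Distr) = (g : Distr) + (g' : Distr) :=
  map_add (MeasureTheory.Lp.toTemperedDistributionCLM ℂ (volume : Measure ℝ) 2) g g'

theorem coe_smul (c : ℝ) (g : L2) : ((c • g : L2) : Distr) = c • (g : Distr) := by
  have h := map_smul (MeasureTheory.Lp.toTemperedDistributionCLM ℂ (volume : Measure ℝ) 2)
    (c : ℂ) g
  simp only [Complex.coe_smul] at h
  exact h

theorem coe_zero : ((0 : L2) : Distr) = 0 :=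
  map_zero (MeasureTheory.Lp.toTemperedDistributionCLM ℂ (volume : Measure ℝ) 2)

theorem MemL2.add {f f' : Distr} (h : MemL2 f) (h' : MemL2 f') : MemL2 (f + f') := by
  obtain ⟨g, rfl⟩ := h
  obtain ⟨g', rfl⟩ := h'
  exact ⟨g + g', (coe_add g g').symm⟩

theorem MemL2.smul {f : Distr} (c : ℝ) (h : MemL2 f) : MemL2 (c • f) := by
  obtain ⟨g, rfl⟩ := h
  exact ⟨c • g, (coe_smul c g).symm⟩

theorem memL2_zero : MemL2 0 := ⟨0, coe_zero.symm⟩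

theorem l2Norm_add_le {f f' : Distr} (h : MemL2 f) (h' : MemL2 f') :
    l2Norm (f + f') ≤ l2Norm f + l2Norm f' := by
  obtain ⟨g, rfl⟩ := h
  obtain ⟨g', rfl⟩ := h'
  rw [← coe_add, l2Norm_coe, l2Norm_coe, l2Norm_coe]
  exact norm_add_le g g'

theorem l2Norm_smul {f : Distr} (c : ℝ) (h : MemL2 f) : l2Norm (c • f) = |c| * l2Norm f := by
  obtain ⟨g, rfl⟩ := h
  rw [← coe_smul, l2Norm_coe, l2Norm_coe, norm_smul, Real.norm_eq_abs]

theorem l2Norm_zero : l2Norm 0 = 0 := by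
  rw [← coe_zero, l2Norm_coe, norm_zero]

theorem eq_zero_of_l2Norm_eq_zero {f : Distr} (h : MemL2 f) (h0 : l2Norm f = 0) : f = 0 := by
  obtain ⟨g, rfl⟩ := h
  rw [l2Norm_coe, norm_eq_zero] at h0
  rw [h0, coe_zero]

theorem dx_add (f g : Distr) : dx (f + g) = dx f + dx g := map_add _ f g

theorem dx_smul (c : ℝ) (f : Distr) : dx (c • f) = c • dx f := by
  have h := map_smul (TemperedDistribution.derivCLM ℂ) (c : ℂ) f
  simp only [Complex.coe_smul] at h
  exact h

/-! ### The real Sobolev space `H^s(ℝ)` -/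

/-- Mathlib's Bessel potential of order `s`. -/
abbrev bessel (s : ℝ) (f : Distr) : Distr := TemperedDistribution.besselPotential ℝ ℂ s f

theorem bessel_smul (s c : ℝ) (f : Distr) : bessel s (c • f) = c • bessel s f := by
  have h := map_smul (TemperedDistribution.besselPotential ℝ ℂ s) (c : ℂ) f
  simp only [Complex.coe_smul] at h
  exact h

/-- The real vector space of real-valued tempered distributions lying in `H^s(ℝ)`. -/
def sobolevSubmodule (s : ℝ) : Submodule ℝ Distr where
  carrier := {f | TemperedDistribution.MemSobolev s 2 f ∧ IsReal f}
  add_mem' := by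
    rintro f g ⟨hf, hf'⟩ ⟨hg, hg'⟩
    refine ⟨hf.add hg, fun ψ hψ => ?_⟩
    have h1 := hf' ψ hψ
    have h2 := hg' ψ hψ
    simp [h1, h2]
  zero_mem' := ⟨TemperedDistribution.memSobolev_fun_zero ℝ ℂ s 2, fun ψ _ => by simp⟩
  smul_mem' := by
    rintro c f ⟨hf, hf'⟩
    refine ⟨?_, fun ψ hψ => ?_⟩
    · have h := hf.smul (c : ℂ)
      simpa only [Complex.coe_smul] using h
    · have h1 := hf' ψ hψ
      simp [h1]

/-- The Sobolev space `H^s(ℝ)` of real-valued distributions. -/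
def Sob (s : ℝ) : Type := ↥(sobolevSubmodule s)

instance (s : ℝ) : AddCommGroup (Sob s) := inferInstanceAs (AddCommGroup ↥(sobolevSubmodule s))

instance (s : ℝ) : Module ℝ (Sob s) := inferInstanceAs (Module ℝ ↥(sobolevSubmodule s))

/-- The distribution underlying an element of `H^s(ℝ)`. -/
def Sob.val {s : ℝ} (f : Sob s) : Distr := Subtype.val f

theorem Sob.val_add {s : ℝ} (f g : Sob s) : (f + g).val = f.val + g.val := rfl

theorem Sob.val_smul {s : ℝ} (c : ℝ) (f : Sob s) : (c • f).val = c • f.val := rfl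

theorem Sob.val_zero {s : ℝ} : (0 : Sob s).val = 0 := rfl

theorem Sob.ext {s : ℝ} {f g : Sob s} (h : f.val = g.val) : f = g := Subtype.ext h

theorem Sob.memL2 {s : ℝ} (f : Sob s) : MemL2 (bessel s f.val) := f.2.1

/-- The norm of `H^s(ℝ)`: the `L²` norm of the Bessel potential. By Plancherel this is
`‖(1 + ξ²)^(s/2) f̂‖` in `L²`, with `f̂` Mathlib's Fourier transform `∫ exp (-2 π i ξ x) f x dx`;
other conventions for the Fourier transform give equivalent norms. -/
instance (s : ℝ) : Norm (Sob s) := ⟨fun f => l2Norm (bessel s f.val)⟩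

theorem Sob.norm_def {s : ℝ} (f : Sob s) : ‖f‖ = l2Norm (bessel s f.val) := rfl

theorem Sob.core (s : ℝ) : NormedSpace.Core ℝ (Sob s) where
  norm_nonneg f := l2Norm_nonneg _
  norm_smul c f := by
    rw [Sob.norm_def, Sob.norm_def, Sob.val_smul, bessel_smul, l2Norm_smul c f.memL2,
      Real.norm_eq_abs]
  norm_triangle f g := by
    rw [Sob.norm_def, Sob.norm_def, Sob.norm_def, Sob.val_add, bessel, map_add]
    exact l2Norm_add_le f.memL2 g.memL2
  norm_eq_zero_iff f := by
    constructor
    · intro h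
      have h0 : bessel s f.val = 0 := eq_zero_of_l2Norm_eq_zero f.memL2 h
      apply Sob.ext
      have h1 := (TemperedDistribution.besselPotential_neg_apply_eq_iff s 0 f.val).mpr h0
      rw [map_zero] at h1
      rw [← h1, Sob.val_zero]
    · rintro rfl
      rw [Sob.norm_def, Sob.val_zero, bessel, map_zero, l2Norm_zero]

instance (s : ℝ) : NormedAddCommGroup (Sob s) := NormedAddCommGroup.ofCore (Sob.core s)

instance (s : ℝ) : NormedSpace ℝ (Sob s) := NormedSpace.ofCore (Sob.core s)

/-! ### The time-weighted space `X_T^s` -/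

/-- The exponent of the time weight: `(1 - s) / 2` for `s ≤ 1` and `0` for `s ≥ 1`. -/
def weightExp (s : ℝ) : ℝ := max ((1 - s) / 2) 0

/-- The weighted quantity `t ^ ((1 - s) / 2) * ‖∂ₓ f‖` in `L²`, for `t > 0`; it is `0` at `t = 0`. -/
def weighted (s t : ℝ) (f : Distr) : ℝ :=
  if 0 < t then t ^ weightExp s * l2Norm (dx f) else 0

theorem weighted_nonneg (s t : ℝ) (f : Distr) : 0 ≤ weighted s t f := by
  unfold weighted
  split_ifs with h
  · exact mul_nonneg (Real.rpow_nonneg h.le _) (l2Norm_nonneg _)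
  · exact le_rfl

theorem weighted_add_le (s t : ℝ) {f g : Distr} (hf : 0 < t → MemL2 (dx f))
    (hg : 0 < t → MemL2 (dx g)) : weighted s t (f + g) ≤ weighted s t f + weighted s t g := by
  unfold weighted
  split_ifs with h
  · rw [← mul_add, dx_add]
    exact mul_le_mul_of_nonneg_left (l2Norm_add_le (hf h) (hg h)) (Real.rpow_nonneg h.le _)
  · simp

theorem weighted_smul (s t c : ℝ) {f : Distr} (hf : 0 < t → MemL2 (dx f)) :
    weighted s t (c • f) = |c| * weighted s t f := by
  unfold weighted
  split_ifs with h
  · rw [dx_smul, l2Norm_smul c (hf h)]; ring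
  · simp

theorem weighted_zero (s t : ℝ) : weighted s t 0 = 0 := by
  unfold weighted
  rw [dx, map_zero, l2Norm_zero]
  simp

/-- The curves `u ∈ C([0,T]; H^s)` such that `∂ₓ u(t) ∈ L²` for `0 < t ≤ T` and
`t ^ ((1 - s) / 2) * ‖∂ₓ u(t)‖` is bounded on `(0,T]`. -/
def weightedSubmodule (s T : ℝ) : Submodule ℝ C(Icc (0 : ℝ) T, Sob s) where
  carrier := {u | (∀ t : Icc (0 : ℝ) T, 0 < (t : ℝ) → MemL2 (dx (u t).val)) ∧
    BddAbove (range fun t : Icc (0 : ℝ) T => weighted s t (u t).val)}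
  add_mem' := by
    rintro u v ⟨hu, Cu, hCu⟩ ⟨hv, Cv, hCv⟩
    refine ⟨fun t ht => ?_, Cu + Cv, ?_⟩
    · have h := (hu t ht).add (hv t ht)
      rwa [← dx_add] at h
    · rintro _ ⟨t, rfl⟩
      have h1 : weighted s t (u t).val ≤ Cu := hCu ⟨t, rfl⟩
      have h2 : weighted s t (v t).val ≤ Cv := hCv ⟨t, rfl⟩
      exact (weighted_add_le s t (hu t) (hv t)).trans (add_le_add h1 h2)
  zero_mem' := by
    refine ⟨fun t _ => ?_, 0, ?_⟩
    · have h : dx (0 : Distr) = 0 := map_zero _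
      change MemL2 (dx (0 : Distr))
      rw [h]
      exact memL2_zero
    · rintro _ ⟨t, rfl⟩
      exact (weighted_zero s t).le
  smul_mem' := by
    rintro c u ⟨hu, Cu, hCu⟩
    refine ⟨fun t ht => ?_, |c| * Cu, ?_⟩
    · have h := (hu t ht).smul c
      rwa [← dx_smul] at h
    · rintro _ ⟨t, rfl⟩
      have h1 : weighted s t (u t).val ≤ Cu := hCu ⟨t, rfl⟩
      have h2 : weighted s t (c • (u t).val) = |c| * weighted s t (u t).val :=
        weighted_smul s t c (hu t)
      change weighted s t (c • (u t).val) ≤ |c| * Cu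
      rw [h2]
      exact mul_le_mul_of_nonneg_left h1 (abs_nonneg c)

/-- The space `X_T^s`. -/
def XSpace (s T : ℝ) : Type := ↥(weightedSubmodule s T)

instance (s T : ℝ) : AddCommGroup (XSpace s T) :=
  inferInstanceAs (AddCommGroup ↥(weightedSubmodule s T))

instance (s T : ℝ) : Module ℝ (XSpace s T) :=
  inferInstanceAs (Module ℝ ↥(weightedSubmodule s T))

/-- The continuous curve in `H^s` underlying an element of `X_T^s`. -/
def XSpace.curve {s T : ℝ} (u : XSpace s T) : C(Icc (0 : ℝ) T, Sob s) := Subtype.val u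

theorem XSpace.memL2 {s T : ℝ} (u : XSpace s T) (t : Icc (0 : ℝ) T) (ht : 0 < (t : ℝ)) :
    MemL2 (dx (u.curve t).val) := u.2.1 t ht

/-- The norm of `X_T^s`: the supremum over `[0,T]` of `‖u(t)‖_{H^s} + t^((1-s)/2) ‖∂ₓ u(t)‖_{L²}`. -/
instance (s T : ℝ) : Norm (XSpace s T) :=
  ⟨fun u => ⨆ t : Icc (0 : ℝ) T, (‖u.curve t‖ + weighted s t (u.curve t).val)⟩

theorem XSpace.norm_def {s T : ℝ} (u : XSpace s T) :
    ‖u‖ = ⨆ t : Icc (0 : ℝ) T, (‖u.curve t‖ + weighted s t (u.curve t).val) := rfl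

theorem XSpace.bddAbove {s T : ℝ} (u : XSpace s T) :
    BddAbove (range fun t : Icc (0 : ℝ) T => ‖u.curve t‖ + weighted s t (u.curve t).val) := by
  obtain ⟨C, hC⟩ := u.2.2
  refine ⟨‖u.curve‖ + C, ?_⟩
  rintro _ ⟨t, rfl⟩
  exact add_le_add (u.curve.norm_coe_le_norm t) (hC ⟨t, rfl⟩)

theorem XSpace.le_norm {s T : ℝ} (u : XSpace s T) (t : Icc (0 : ℝ) T) :
    ‖u.curve t‖ + weighted s t (u.curve t).val ≤ ‖u‖ := le_ciSup u.bddAbove t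

theorem XSpace.core (s T : ℝ) : NormedSpace.Core ℝ (XSpace s T) where
  norm_nonneg u := Real.iSup_nonneg fun t => add_nonneg (norm_nonneg _) (weighted_nonneg _ _ _)
  norm_smul c u := by
    rw [XSpace.norm_def, XSpace.norm_def, Real.mul_iSup_of_nonneg (norm_nonneg c)]
    congr 1
    funext t
    have h2 : weighted s t (c • (u.curve t).val) = |c| * weighted s t (u.curve t).val :=
      weighted_smul s t c (u.memL2 t)
    change ‖c • u.curve t‖ + weighted s t (c • (u.curve t).val) = _
    rw [norm_smul, h2, Real.norm_eq_abs, mul_add]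
  norm_triangle u v := by
    refine Real.iSup_le (fun t => ?_) (add_nonneg ?_ ?_)
    · have h1 := u.le_norm t
      have h2 := v.le_norm t
      have h3 : weighted s t ((u.curve t).val + (v.curve t).val) ≤ _ :=
        weighted_add_le s t (u.memL2 t) (v.memL2 t)
      have h4 := norm_add_le (u.curve t) (v.curve t)
      change ‖u.curve t + v.curve t‖ + weighted s t ((u.curve t).val + (v.curve t).val) ≤ _
      linarith
    · exact Real.iSup_nonneg fun t => add_nonneg (norm_nonneg _) (weighted_nonneg _ _ _)
    · exact Real.iSup_nonneg fun t => add_nonneg (norm_nonneg _) (weighted_nonneg _ _ _)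
  norm_eq_zero_iff u := by
    constructor
    · intro h
      apply Subtype.ext
      ext1 t
      have h1 := u.le_norm t
      rw [h] at h1
      have h2 := weighted_nonneg s t (u.curve t).val
      have h3 : ‖u.curve t‖ = 0 := le_antisymm (by linarith) (norm_nonneg _)
      exact norm_eq_zero.mp h3
    · rintro rfl
      have h : ∀ t : Icc (0 : ℝ) T,
          ‖(0 : XSpace s T).curve t‖ + weighted s t ((0 : XSpace s T).curve t).val = 0 := by
        intro t
        change ‖(0 : Sob s)‖ + weighted s t (0 : Distr) = 0
        rw [norm_zero, weighted_zero, add_zero]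
      rw [XSpace.norm_def]
      simp only [h, Real.iSup_const_zero]

instance (s T : ℝ) : NormedAddCommGroup (XSpace s T) := NormedAddCommGroup.ofCore (XSpace.core s T)

instance (s T : ℝ) : NormedSpace ℝ (XSpace s T) := NormedSpace.ofCore (XSpace.core s T)

/-! ### The Kuramoto-Sivashinsky equation -/

/-- The distribution-valued curve `u` satisfies
`u_t = ∂ₓ² u + μ (1 - ∂ₓ²)^(-1/2) u + (1/2) (∂ₓ u)²` at time `t`: the distribution `∂ₓ u(t)` is a
square integrable function `w`, so that `w²` is an integrable function, and the equation holds when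
tested against every Schwartz function. -/
def SolvesAt (μ : ℝ) (u : ℝ → Distr) (t : ℝ) : Prop :=
  ∃ w : L2, dx (u t) = w ∧ ∀ ψ : 𝓢(ℝ, ℂ),
    HasDerivAt (fun τ : ℝ => u τ ψ)
      (dx (dx (u t)) ψ + (μ : ℂ) * invSqrtOneSubLaplacian (u t) ψ
        + (1 / 2 : ℂ) * ∫ x : ℝ, ψ x * (w x) ^ 2) t

/-- `u : [0,∞) → H^s` is continuous, starts at `φ`, and solves the equation at all times `t > 0`.
The values of `u` at negative times are irrelevant. -/
def IsGlobalSolution (μ : ℝ) {s : ℝ} (φ : Sob s) (u : ℝ → Sob s) : Prop :=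
  ContinuousOn u (Ici 0) ∧ u 0 = φ ∧ ∀ t, 0 < t → SolvesAt μ (fun τ => (u τ).val) t

/-- `u ∈ X_T^s` starts at `φ` and solves the equation on `(0,T)`. The curve is extended to all real
times by constants, which does not affect time derivatives at interior points. -/
def IsSolutionOn (μ : ℝ) {s T : ℝ} (hT : 0 < T) (φ : Sob s) (u : XSpace s T) : Prop :=
  u.curve ⟨0, left_mem_Icc.mpr hT.le⟩ = φ ∧
    ∀ t ∈ Ioo 0 T, SolvesAt μ (fun τ => (IccExtend hT.le u.curve τ).val) t

end KS

end

/-!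
# Global well-posedness of the Kuramoto-Sivashinsky equation in `H^s(ℝ)`, `s > 1/2`

Everything is done on the Fourier side, where the linear part acts as multiplication by
`p(ξ) = -(2πξ)² + μ (1 + (2πξ)²) ^ (-1/2)` and is the generator of the semigroup `heat`, of growth
`exp (μ t)`. Since the nonlinearity is a function of `∂ₓ u` only, the solution is determined by its
derivative. Put `a = weightExp s` and `σ = max (s - 1) 0`. The unknown is the continuous `L²`-valued
curve `z(t) = t ^ a (1 + ξ²) ^ (σ / 2) 𝓕(∂ₓ u(t))`, and the equation becomes a quadratic Volterra
equation `z = z₀ + Duh β(z, z)`, where `z₀` (`linZ`) depends linearly on the data and `β` is a bounded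
bilinear map from `L²` to bounded continuous functions (`prodBilin`: the Fourier transform of a
product of two `L²` functions is bounded). The kernel `kerW` of the Duhamel operator has the
singularities `(t - τ) ^ (-3/4)` and `τ ^ (-2 a)`, and together with the weight `t ^ a` the operator
gains a positive power of the time exactly because `s > 1/2`. By `DuhamelKernel.exists_weight` its norm
for the weight `exp (-lam t)` tends to zero as `lam` grows; hence linear Volterra equations are uniquely
solvable on any time interval. The curve `u` itself is recovered from `z` by a second Duhamel operator
(`kerU`, `duhPair`).

*Smooth dependence.* The map `z ↦ z - Duh β(z, z)` is smooth and injective, and its derivative is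
invertible at every point because it is a linear Volterra operator. So the inverse function theorem
makes `z`, and with it `u`, a smooth function of the data (`DuhamelKernel.contDiff_of_volterra_eq`,
`contDiff_solX`). No smallness is involved, only the existence of the solution on `[0, T]`.

*Global existence.* The equation with radially truncated nonlinearity has a global solution, and it
remains to bound it independently of the truncation (`DuhamelKernel.exists_volterra_eq`). For short
times this follows from the gain of the Duhamel operator. For later times the identity `∫ w² w' dx = 0`,
with `w = ∂ₓ u`, shows that the nonlinearity does not contribute to the growth of `‖w‖` in `L²`, so that
this norm grows at most like `exp (μ t)`; and once it is controlled, the nonlinearity is linear in the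
norm of `z`. The identity is proved by symmetrization in frequency space (`integral_triple_eq_zero`),
which requires band-limited functions, so the estimate is carried out for Galerkin approximations
(`DuhamelKernel.exists_galerkin`, `norm_galerkin_le`) and passed to the limit. It also requires
real-valued functions; on the Fourier side this means invariance under `conjRefl`, and it is inherited
from the data because solutions are unique.

*The equation.* Tested against a Schwartz function, the restarted Duhamel formula gives a continuous
right derivative in time, and a continuous function with continuous right derivative is differentiable
(`hasDerivAt_of_right_deriv`, `solvesAt_mild`).

*Uniqueness.* A solution in `X_T^s` is only known to satisfy the equation in the sense of
distributions. The difference of two solutions is tested against the backward heat flow of a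
band-limited test function, which cancels the linear part (`hasDerivAt_pairS_heatTest`). Integrating
in time and taking the supremum over the test functions gives the Duhamel estimate `gap_le` for the
derivative of the difference, and its iteration in an exponentially weighted norm shows that the
difference vanishes (`eq_of_isSolutionOn`). By uniqueness, the solutions on the intervals `[0, T]` fit
together to a global one (`globalSol`).
-/

open MeasureTheory Set
open scoped SchwartzMap ContDiff
open scoped ENNReal BoundedContinuousFunction FourierTransform

noncomputable section

namespace KS

open Filter Topology

/-! ### Continuous curves with exponential time weights -/

section Weighted

variable {T : ℝ} {H : Type*} [NormedAddCommGroup H] [NormedSpace ℝ H]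

/-- The curve `t ↦ exp (lam t) z(t)`. -/
def expWeight (lam : ℝ) (z : C(Icc (0 : ℝ) T, H)) : C(Icc (0 : ℝ) T, H) :=
  ⟨fun t => Real.exp (lam * t) • z t, by fun_prop⟩

@[simp] theorem expWeight_apply (lam : ℝ) (z : C(Icc (0 : ℝ) T, H)) (t : Icc (0 : ℝ) T) :
    expWeight lam z t = Real.exp (lam * t) • z t := rfl

theorem expWeight_neg_cancel (lam : ℝ) (z : C(Icc (0 : ℝ) T, H)) :
    expWeight lam (expWeight (-lam) z) = z := by
  ext t
  simp [smul_smul, ← Real.exp_add]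

/-- `‖expWeight (-lam) z‖` is the Bielecki norm of `z`, the supremum of `exp (-lam t) ‖z t‖`. -/
theorem norm_le_expWeight (lam : ℝ) (z : C(Icc (0 : ℝ) T, H)) (t : Icc (0 : ℝ) T) :
    ‖z t‖ ≤ ‖expWeight (-lam) z‖ * Real.exp (lam * t) := by
  have h := (expWeight (-lam) z).norm_coe_le_norm t
  rw [expWeight_apply, norm_smul, Real.norm_eq_abs, Real.abs_exp] at h
  calc ‖z t‖ = Real.exp (-lam * t) * ‖z t‖ * Real.exp (lam * t) := by
        rw [mul_right_comm, ← Real.exp_add]; simp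
    _ ≤ _ := by gcongr

theorem expWeight_norm_le {lam m : ℝ} (hm : 0 ≤ m) {z : C(Icc (0 : ℝ) T, H)}
    (h : ∀ t, ‖z t‖ ≤ m * Real.exp (lam * t)) : ‖expWeight (-lam) z‖ ≤ m := by
  rw [ContinuousMap.norm_le _ hm]
  intro t
  rw [expWeight_apply, norm_smul, Real.norm_eq_abs, Real.abs_exp]
  calc Real.exp (-lam * t) * ‖z t‖ ≤ Real.exp (-lam * t) * (m * Real.exp (lam * t)) := by
        gcongr; exact h t
    _ = m := by rw [mul_left_comm, ← Real.exp_add]; simp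

/-- `Φ` is Lipschitz with constant `κ` for the norm with weight `exp (-lam t)`. -/
def WeightedLipschitz (Φ : C(Icc (0 : ℝ) T, H) → C(Icc (0 : ℝ) T, H)) (lam κ : ℝ) : Prop :=
  ∀ z v m, 0 ≤ m → (∀ t : Icc (0 : ℝ) T, ‖z t - v t‖ ≤ m * Real.exp (lam * t)) →
    ∀ t : Icc (0 : ℝ) T, ‖Φ z t - Φ v t‖ ≤ κ * m * Real.exp (lam * t)

variable {Φ : C(Icc (0 : ℝ) T, H) → C(Icc (0 : ℝ) T, H)} {lam κ : ℝ}

/-- A fixed point of a weighted contraction is close to any approximate fixed point. -/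
theorem WeightedLipschitz.norm_sub_le (h : WeightedLipschitz Φ lam κ) (hκ0 : 0 ≤ κ) (hκ : κ < 1)
    {z v : C(Icc (0 : ℝ) T, H)} (hz : Φ z = z) {δ : ℝ} (hδ : 0 ≤ δ)
    (hv : ∀ t : Icc (0 : ℝ) T, ‖Φ v t - v t‖ ≤ δ * Real.exp (lam * t)) (t : Icc (0 : ℝ) T) :
    ‖z t - v t‖ ≤ δ / (1 - κ) * Real.exp (lam * t) := by
  set m := ‖expWeight (-lam) (z - v)‖ with hm
  have hm0 : 0 ≤ m := norm_nonneg _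
  have h1 : ∀ t : Icc (0 : ℝ) T, ‖z t - v t‖ ≤ m * Real.exp (lam * t) :=
    fun t => norm_le_expWeight lam (z - v) t
  have h2 := h z v m hm0 h1
  rw [hz] at h2
  have h3 : ∀ t : Icc (0 : ℝ) T, ‖z t - v t‖ ≤ (κ * m + δ) * Real.exp (lam * t) := by
    intro t
    calc ‖z t - v t‖ = ‖(z t - Φ v t) + (Φ v t - v t)‖ := by congr 1; abel
      _ ≤ κ * m * Real.exp (lam * t) + δ * Real.exp (lam * t) :=
        (norm_add_le _ _).trans (add_le_add (h2 t) (hv t))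
      _ = _ := by ring
  have h4 : m ≤ κ * m + δ := expWeight_norm_le (by positivity) h3
  have h5 : m ≤ δ / (1 - κ) := by
    rw [le_div_iff₀ (by linarith)]
    linarith
  calc ‖z t - v t‖ ≤ m * Real.exp (lam * t) := h1 t
    _ ≤ _ := by gcongr

theorem WeightedLipschitz.eq_of_fixed (h : WeightedLipschitz Φ lam κ) (hκ0 : 0 ≤ κ) (hκ : κ < 1)
    {z v : C(Icc (0 : ℝ) T, H)} (hz : Φ z = z) (hv : Φ v = v) : z = v := by
  ext t
  have h1 := h.norm_sub_le hκ0 hκ hz le_rfl (v := v) (by simp [hv]) t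
  rw [zero_div, zero_mul] at h1
  exact sub_eq_zero.mp (norm_le_zero_iff.mp h1)

/-- The exponential weight turns `Φ` into a contraction for the supremum norm. -/
theorem WeightedLipschitz.exists_fixed [CompleteSpace H] (h : WeightedLipschitz Φ lam κ)
    (hκ0 : 0 ≤ κ) (hκ : κ < 1) : ∃ z, Φ z = z := by
  let Ψ : C(Icc (0 : ℝ) T, H) → C(Icc (0 : ℝ) T, H) :=
    fun y => expWeight (-lam) (Φ (expWeight lam y))
  have hΨ : ContractingWith ⟨κ, hκ0⟩ Ψ := by
    refine ⟨hκ, LipschitzWith.of_dist_le_mul fun y w => ?_⟩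
    rw [dist_eq_norm]
    have h1 : Ψ y - Ψ w = expWeight (-lam) (Φ (expWeight lam y) - Φ (expWeight lam w)) := by
      ext t; simp [Ψ, smul_sub]
    rw [h1]
    refine expWeight_norm_le (by positivity) (h _ _ _ dist_nonneg fun t => ?_)
    rw [expWeight_apply, expWeight_apply, ← smul_sub, norm_smul, Real.norm_eq_abs, Real.abs_exp,
      mul_comm, ← dist_eq_norm]
    gcongr
    exact ContinuousMap.dist_apply_le_dist t
  refine ⟨expWeight lam hΨ.fixedPoint, ?_⟩
  have h2 : Ψ hΨ.fixedPoint = hΨ.fixedPoint := hΨ.fixedPoint_isFixedPt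
  rw [← expWeight_neg_cancel lam (Φ _)]
  congr 1

end Weighted

/-! ### Duhamel operators with singular kernels -/

theorem intervalIntegrable_beta {b c : ℝ} (hb : b < 1) (hc : c < 1) :
    IntervalIntegrable (fun x : ℝ => x ^ (-c) * (1 - x) ^ (-b)) volume 0 1 := by
  have h := (Complex.betaIntegral_convergent (u := ((1 - c : ℝ) : ℂ)) (v := ((1 - b : ℝ) : ℂ))
    (by simpa using hc) (by simpa using hb)).norm
  rw [intervalIntegrable_iff_integrableOn_Ioo_of_le zero_le_one] at h ⊢
  refine h.congr_fun (fun x hx => ?_) measurableSet_Ioo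
  have h1 : (1 - (x : ℂ)) = ((1 - x : ℝ) : ℂ) := by push_cast; ring
  dsimp only
  rw [norm_mul, h1, Complex.norm_cpow_eq_rpow_re_of_pos hx.1,
    Complex.norm_cpow_eq_rpow_re_of_pos (by linarith [hx.2])]
  simp

/-- The Beta integral `∫₀¹ x ^ (-c) (1 - x) ^ (-b) dx`. -/
def betaConst (b c : ℝ) : ℝ := ∫ x in (0 : ℝ)..1, x ^ (-c) * (1 - x) ^ (-b)

theorem betaConst_nonneg (b c : ℝ) : 0 ≤ betaConst b c :=
  intervalIntegral.integral_nonneg zero_le_one fun x hx =>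
    mul_nonneg (Real.rpow_nonneg hx.1 _) (Real.rpow_nonneg (by linarith [hx.2]) _)

/-- The data of a Duhamel operator
`g ↦ (t ↦ t ^ e ∫₀ᵗ τ ^ (-c) op (t - τ) (g τ) dτ)` on `[0,T]`: a family of operators `op r`, `r > 0`,
with a singularity of order `r ^ (-b)` at `r = 0`, and exponents for which the operator gains a
positive power of the time. -/
structure DuhamelKernel (T : ℝ) (Y H : Type*) [NormedAddCommGroup Y] [NormedSpace ℝ Y]
    [NormedAddCommGroup H] [NormedSpace ℝ H] where
  /-- The operators; their values at `r ≤ 0` play no role. -/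
  op : ℝ → Y →L[ℝ] H
  /-- The constant in the bound of `op`. -/
  bd : ℝ
  /-- The order of the singularity of `op`. -/
  b : ℝ
  /-- The order of the singularity in the time `τ` of the forcing. -/
  c : ℝ
  /-- The exponent of the time weight of the output. -/
  e : ℝ
  T_pos : 0 < T
  bd_nonneg : 0 ≤ bd
  b_nonneg : 0 ≤ b
  b_lt : b < 1
  c_lt : c < 1
  gain_pos : 0 < 1 - b - c + e
  continuousOn_op : ContinuousOn op (Ioi 0)
  norm_op_le : ∀ t ∈ Ioc 0 T, ‖op t‖ ≤ bd * t ^ (-b)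

namespace DuhamelKernel

variable {T : ℝ} {Y H : Type*} [NormedAddCommGroup Y] [NormedSpace ℝ Y]
  [NormedAddCommGroup H] [NormedSpace ℝ H] (K : DuhamelKernel T Y H)

/-- The power of time gained by the Duhamel operator. -/
def gain : ℝ := 1 - K.b - K.c + K.e

/-- The integrand of the Duhamel operator after the substitution `τ = t x`. -/
def integrand (g : C(Icc (0 : ℝ) T, Y)) (t x : ℝ) : H :=
  x ^ (-K.c) • K.op (t * (1 - x)) (g (projIcc 0 T K.T_pos.le (t * x)))

/-- The Duhamel operator at a fixed time, with the integration variable scaled to `[0,1]`. -/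
def duhFun (g : C(Icc (0 : ℝ) T, Y)) (t : ℝ) : H :=
  t ^ (1 - K.c + K.e) • ∫ x in (0 : ℝ)..1, K.integrand g t x

theorem aestronglyMeasurable_integrand (g : C(Icc (0 : ℝ) T, Y)) {t : ℝ} (ht : 0 < t) :
    AEStronglyMeasurable (K.integrand g t) (volume.restrict (Ioo 0 1)) := by
  refine ContinuousOn.aestronglyMeasurable ?_ measurableSet_Ioo
  refine ContinuousOn.smul ?_ (ContinuousOn.clm_apply ?_ ?_)
  · exact fun x hx => (Real.continuousAt_rpow_const _ _ (Or.inl hx.1.ne')).continuousWithinAt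
  · refine K.continuousOn_op.comp (by fun_prop) fun x hx => ?_
    exact mul_pos ht (by linarith [hx.2])
  · exact (g.continuous.comp (continuous_projIcc.comp (by fun_prop))).continuousOn

theorem norm_integrand_le (g : C(Icc (0 : ℝ) T, Y)) {t x : ℝ} (ht : t ∈ Ioc 0 T)
    (hx : x ∈ Ioo (0 : ℝ) 1) {M : ℝ} (hM : ‖g (projIcc 0 T K.T_pos.le (t * x))‖ ≤ M) :
    ‖K.integrand g t x‖ ≤ x ^ (-K.c) * (K.bd * (t * (1 - x)) ^ (-K.b) * M) := by
  have h1 : t * (1 - x) ∈ Ioc 0 T :=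
    ⟨mul_pos ht.1 (by linarith [hx.2]), by nlinarith [ht.1, ht.2, hx.1, hx.2]⟩
  have hb := K.bd_nonneg
  have h2 : 0 ≤ (t * (1 - x)) ^ (-K.b) := Real.rpow_nonneg h1.1.le _
  have h3 : 0 ≤ x ^ (-K.c) := Real.rpow_nonneg hx.1.le _
  rw [integrand, norm_smul, Real.norm_eq_abs, abs_of_nonneg h3]
  gcongr
  exact (ContinuousLinearMap.le_opNorm _ _).trans
    (mul_le_mul (K.norm_op_le _ h1) hM (norm_nonneg _) (by positivity))

theorem intervalIntegrable_integrand (g : C(Icc (0 : ℝ) T, Y)) {t : ℝ} (ht : t ∈ Ioc 0 T) :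
    IntervalIntegrable (K.integrand g t) volume 0 1 := by
  rw [intervalIntegrable_iff_integrableOn_Ioo_of_le zero_le_one]
  have h := (intervalIntegrable_beta K.b_lt K.c_lt).const_mul (K.bd * t ^ (-K.b) * ‖g‖)
  rw [intervalIntegrable_iff_integrableOn_Ioo_of_le zero_le_one] at h
  refine h.mono' (K.aestronglyMeasurable_integrand g ht.1) ?_
  filter_upwards [ae_restrict_mem measurableSet_Ioo] with x hx
  refine (K.norm_integrand_le g ht hx (g.norm_coe_le_norm _)).trans (le_of_eq ?_)
  rw [Real.mul_rpow ht.1.le (by linarith [hx.2])]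
  ring

/-- The basic estimate of the Duhamel operator. The factor `exp (-lam r)` is traded for a small
negative power of `r`, which makes the constant `q` small for large `lam`. Only the values of `g`
before the time `t` matter. -/
theorem norm_duhFun_le (g : C(Icc (0 : ℝ) T, Y)) {t lam ε q m : ℝ} (ht : t ∈ Ioc 0 T)
    (hbε : K.b + ε < 1)
    (hq : ∀ r ∈ Ioc 0 T, Real.exp (-lam * r) ≤ q * r ^ (-ε)) (hm : 0 ≤ m)
    (hg : ∀ τ : Icc (0 : ℝ) T, (τ : ℝ) < t → ‖g τ‖ ≤ m * Real.exp (lam * τ)) :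
    ‖K.duhFun g t‖ ≤
      K.bd * q * betaConst (K.b + ε) K.c * t ^ (K.gain - ε) * m * Real.exp (lam * t) := by
  have hb := K.bd_nonneg
  have hint := (intervalIntegrable_beta hbε K.c_lt).const_mul
    (K.bd * q * t ^ (-(K.b + ε)) * m * Real.exp (lam * t))
  have h1 : ‖∫ x in (0 : ℝ)..1, K.integrand g t x‖ ≤ ∫ x in (0 : ℝ)..1,
      (K.bd * q * t ^ (-(K.b + ε)) * m * Real.exp (lam * t)) *
        (x ^ (-K.c) * (1 - x) ^ (-(K.b + ε))) := by
    refine intervalIntegral.norm_integral_le_of_norm_le zero_le_one ?_ hint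
    have hne : ∀ᵐ x : ℝ, x ≠ 1 := by simp [ae_iff]
    filter_upwards [hne] with x hx1 hx
    have hx' : x ∈ Ioo (0 : ℝ) 1 := ⟨hx.1, lt_of_le_of_ne hx.2 hx1⟩
    have hx2 : 0 < 1 - x := by linarith [hx'.2]
    have hr : t * (1 - x) ∈ Ioc 0 T :=
      ⟨mul_pos ht.1 hx2, by nlinarith [ht.1, ht.2, hx.1, hx.2]⟩
    have htx : t * x ∈ Icc 0 T := ⟨by nlinarith [ht.1, hx.1], by nlinarith [ht.1, ht.2, hx.2]⟩
    have hM := hg (projIcc 0 T K.T_pos.le (t * x)) (by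
      rw [projIcc_of_mem K.T_pos.le htx]; dsimp only; nlinarith [ht.1, hx'.2])
    rw [projIcc_of_mem K.T_pos.le htx] at hM
    refine (K.norm_integrand_le g ht hx' (M := m * Real.exp (lam * (t * x)))
      (by rw [projIcc_of_mem K.T_pos.le htx]; exact hM)).trans ?_
    have h2 : Real.exp (lam * (t * x)) ≤
        Real.exp (lam * t) * (q * (t * (1 - x)) ^ (-ε)) := by
      have : lam * (t * x) = lam * t + -lam * (t * (1 - x)) := by ring
      rw [this, Real.exp_add]
      gcongr
      exact hq _ hr
    have h3 : (t * (1 - x)) ^ (-K.b) * (t * (1 - x)) ^ (-ε) =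
        t ^ (-(K.b + ε)) * (1 - x) ^ (-(K.b + ε)) := by
      rw [← Real.rpow_add hr.1, ← Real.mul_rpow ht.1.le hx2.le]; congr 1; ring
    have h4 : 0 ≤ x ^ (-K.c) := Real.rpow_nonneg hx'.1.le _
    have h5 : 0 ≤ (t * (1 - x)) ^ (-K.b) := Real.rpow_nonneg hr.1.le _
    calc x ^ (-K.c) * (K.bd * (t * (1 - x)) ^ (-K.b) * (m * Real.exp (lam * (t * x))))
        ≤ x ^ (-K.c) * (K.bd * (t * (1 - x)) ^ (-K.b) *
          (m * (Real.exp (lam * t) * (q * (t * (1 - x)) ^ (-ε))))) := by gcongr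
      _ = K.bd * q * m * Real.exp (lam * t) * x ^ (-K.c) *
          ((t * (1 - x)) ^ (-K.b) * (t * (1 - x)) ^ (-ε)) := by ring
      _ = _ := by rw [h3]; ring
  rw [intervalIntegral.integral_const_mul] at h1
  have h6 : 0 ≤ t ^ (1 - K.c + K.e) := Real.rpow_nonneg ht.1.le _
  rw [duhFun, norm_smul, Real.norm_eq_abs, abs_of_nonneg h6]
  calc _ ≤ t ^ (1 - K.c + K.e) * (K.bd * q * t ^ (-(K.b + ε)) * m * Real.exp (lam * t) *
        betaConst (K.b + ε) K.c) := by gcongr; exact h1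
    _ = K.bd * q * betaConst (K.b + ε) K.c * (t ^ (1 - K.c + K.e) * t ^ (-(K.b + ε))) * m *
        Real.exp (lam * t) := by ring
    _ = _ := by
      rw [← Real.rpow_add ht.1]
      congr 4
      rw [gain]; ring

/-- The Duhamel operator gains the power `gain` of the time. -/
theorem norm_duhFun_le_of_lt (g : C(Icc (0 : ℝ) T, Y)) {t m : ℝ} (ht : t ∈ Ioc 0 T) (hm : 0 ≤ m)
    (hg : ∀ τ : Icc (0 : ℝ) T, (τ : ℝ) < t → ‖g τ‖ ≤ m) :
    ‖K.duhFun g t‖ ≤ K.bd * betaConst K.b K.c * t ^ K.gain * m := by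
  have h := K.norm_duhFun_le g (lam := 0) (ε := 0) (q := 1) ht (by simpa using K.b_lt)
    (by simp) hm (by simpa using hg)
  simpa using h

theorem duhFun_zero_time (g : C(Icc (0 : ℝ) T, Y)) : K.duhFun g 0 = 0 := by
  have h : 1 - K.c + K.e ≠ 0 := by have := K.gain_pos; have := K.b_nonneg; linarith
  rw [duhFun, Real.zero_rpow h, zero_smul]

theorem continuous_duhFun (g : C(Icc (0 : ℝ) T, Y)) :
    Continuous fun t : Icc (0 : ℝ) T => K.duhFun g t := by
  rw [continuous_iff_continuousAt]
  intro t₀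
  rcases eq_or_lt_of_le t₀.2.1 with h0 | h0
  · rw [ContinuousAt, ← h0, duhFun_zero_time, tendsto_zero_iff_norm_tendsto_zero]
    have hlim : Tendsto (fun t : Icc (0 : ℝ) T =>
        K.bd * betaConst K.b K.c * (t : ℝ) ^ K.gain * ‖g‖) (𝓝 t₀) (𝓝 0) := by
      have h1 : Tendsto (fun t : Icc (0 : ℝ) T => (t : ℝ) ^ K.gain) (𝓝 t₀) (𝓝 0) := by
        have h2 : ContinuousAt (fun t : Icc (0 : ℝ) T => (t : ℝ) ^ K.gain) t₀ :=
          (Real.continuousAt_rpow_const _ _ (Or.inr K.gain_pos.le)).comp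
            continuous_subtype_val.continuousAt
        have h3 := h2.tendsto
        rwa [← h0, Real.zero_rpow (show K.gain ≠ 0 from K.gain_pos.ne')] at h3
      simpa using (h1.const_mul (K.bd * betaConst K.b K.c)).mul_const ‖g‖
    refine squeeze_zero (fun _ => norm_nonneg _) (fun t => ?_) hlim
    rcases eq_or_lt_of_le t.2.1 with h | h
    · rw [← h, duhFun_zero_time, norm_zero, Real.zero_rpow (show K.gain ≠ 0 from K.gain_pos.ne')]
      simp
    · exact K.norm_duhFun_le_of_lt g ⟨h, t.2.2⟩ (norm_nonneg _) fun τ _ => g.norm_coe_le_norm _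
  · refine ContinuousAt.smul ((Real.continuousAt_rpow_const _ _ (Or.inl h0.ne')).comp
      continuous_subtype_val.continuousAt) ?_
    have hev : ∀ᶠ t : Icc (0 : ℝ) T in 𝓝 t₀, (t₀ : ℝ) / 2 < t :=
      continuous_subtype_val.continuousAt.eventually_const_lt (by linarith)
    refine intervalIntegral.continuousAt_of_dominated_interval
      (bound := fun x => K.bd * ((t₀ : ℝ) / 2) ^ (-K.b) * ‖g‖ * (x ^ (-K.c) * (1 - x) ^ (-K.b)))
      ?_ ?_ ((intervalIntegrable_beta K.b_lt K.c_lt).const_mul _) ?_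
    · filter_upwards [hev] with t ht
      rw [uIoc_of_le zero_le_one, ← restrict_Ioo_eq_restrict_Ioc]
      exact K.aestronglyMeasurable_integrand g (by linarith)
    · filter_upwards [hev] with t ht
      have hne : ∀ᵐ x : ℝ, x ≠ 1 := by simp [ae_iff]
      filter_upwards [hne] with x hx1 hx
      rw [uIoc_of_le zero_le_one] at hx
      have hx' : x ∈ Ioo (0 : ℝ) 1 := ⟨hx.1, lt_of_le_of_ne hx.2 hx1⟩
      have hx2 : 0 < 1 - x := by linarith [hx'.2]
      refine (K.norm_integrand_le g ⟨by linarith, t.2.2⟩ hx' (g.norm_coe_le_norm _)).trans ?_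
      have h4 : 0 ≤ x ^ (-K.c) := Real.rpow_nonneg hx'.1.le _
      have h5 : 0 ≤ (1 - x) ^ (-K.b) := Real.rpow_nonneg hx2.le _
      have hb := K.bd_nonneg
      rw [Real.mul_rpow (by linarith) hx2.le]
      calc x ^ (-K.c) * (K.bd * ((t : ℝ) ^ (-K.b) * (1 - x) ^ (-K.b)) * ‖g‖)
          ≤ x ^ (-K.c) * (K.bd * (((t₀ : ℝ) / 2) ^ (-K.b) * (1 - x) ^ (-K.b)) * ‖g‖) := by
            gcongr x ^ (-K.c) * (K.bd * (?_ * (1 - x) ^ (-K.b)) * ‖g‖)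
            exact Real.rpow_le_rpow_of_nonpos (by linarith) ht.le (by linarith [K.b_nonneg])
        _ = _ := by ring
    · have hne : ∀ᵐ x : ℝ, x ≠ 1 := by simp [ae_iff]
      filter_upwards [hne] with x hx1 hx
      rw [uIoc_of_le zero_le_one] at hx
      have hx2 : 0 < 1 - x := by linarith [lt_of_le_of_ne hx.2 hx1]
      refine ContinuousAt.smul continuousAt_const (ContinuousAt.clm_apply ?_ ?_)
      · have h1 : ContinuousAt K.op ((t₀ : ℝ) * (1 - x)) :=
          K.continuousOn_op.continuousAt (Ioi_mem_nhds (mul_pos h0 hx2))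
        exact h1.comp (f := fun t : Icc (0 : ℝ) T => (t : ℝ) * (1 - x)) (by fun_prop)
      · exact (g.continuous.comp (continuous_projIcc.comp (by fun_prop))).continuousAt

/-- The Duhamel operator as a bounded linear map between spaces of continuous curves. -/
def duh : C(Icc (0 : ℝ) T, Y) →L[ℝ] C(Icc (0 : ℝ) T, H) :=
  LinearMap.mkContinuous
    { toFun := fun g => ⟨fun t => K.duhFun g t, K.continuous_duhFun g⟩
      map_add' := fun g g' => by
        ext t
        rcases eq_or_lt_of_le t.2.1 with h | h
        · simp [← h, duhFun_zero_time]
        · have h1 : (t : ℝ) ∈ Ioc 0 T := ⟨h, t.2.2⟩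
          change K.duhFun (g + g') t = K.duhFun g t + K.duhFun g' t
          rw [duhFun, duhFun, duhFun, ← smul_add, ← intervalIntegral.integral_add
            (K.intervalIntegrable_integrand g h1) (K.intervalIntegrable_integrand g' h1)]
          simp [integrand]
      map_smul' := fun r g => by
        ext t
        change K.duhFun (r • g) t = r • K.duhFun g t
        have h : K.integrand (r • g) t = fun x => r • K.integrand g t x := by
          funext x
          simp [integrand, smul_comm r]
        rw [duhFun, duhFun, h, intervalIntegral.integral_smul, smul_comm] }
    (K.bd * betaConst K.b K.c * T ^ K.gain) fun g => by
      have hb := K.bd_nonneg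
      have hT := K.T_pos
      have hB := betaConst_nonneg K.b K.c
      rw [ContinuousMap.norm_le _ (by positivity)]
      intro t
      change ‖K.duhFun g t‖ ≤ _
      rcases eq_or_lt_of_le t.2.1 with h | h
      · rw [← h, duhFun_zero_time, norm_zero]; positivity
      · refine (K.norm_duhFun_le_of_lt g ⟨h, t.2.2⟩ (norm_nonneg _)
          fun τ _ => g.norm_coe_le_norm _).trans ?_
        gcongr
        · exact K.gain_pos.le
        · exact t.2.2

theorem duh_apply (g : C(Icc (0 : ℝ) T, Y)) (t : Icc (0 : ℝ) T) : K.duh g t = K.duhFun g t := rfl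

/-- For a large weight `lam`, the Duhamel operator is as small as desired on curves bounded by
`m * exp (lam t)`. -/
theorem exists_weight {κ : ℝ} (hκ : 0 < κ) : ∃ lam : ℝ, 0 < lam ∧
    ∀ (g : C(Icc (0 : ℝ) T, Y)) (m : ℝ), 0 ≤ m →
      (∀ τ : Icc (0 : ℝ) T, ‖g τ‖ ≤ m * Real.exp (lam * τ)) →
      ∀ t : Icc (0 : ℝ) T, ‖K.duh g t‖ ≤ κ * m * Real.exp (lam * t) := by
  obtain ⟨ε, hε0, hε1, hε2, hε3⟩ : ∃ ε : ℝ, 0 < ε ∧ K.b + ε < 1 ∧ ε < K.gain ∧ ε ≤ 1 := by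
    have h1 := K.b_lt
    have h2 : 0 < K.gain := K.gain_pos
    refine ⟨min (min ((1 - K.b) / 2) (K.gain / 2)) 1, ?_, ?_, ?_, min_le_right _ _⟩
    · exact lt_min (lt_min (by linarith) (by linarith)) one_pos
    · have := (min_le_left (min ((1 - K.b) / 2) (K.gain / 2)) 1).trans (min_le_left _ _)
      linarith
    · have := (min_le_left (min ((1 - K.b) / 2) (K.gain / 2)) 1).trans (min_le_right _ _)
      linarith
  set A := K.bd * betaConst (K.b + ε) K.c * T ^ (K.gain - ε) with hA
  have hb := K.bd_nonneg
  have hT := K.T_pos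
  have hB := betaConst_nonneg (K.b + ε) K.c
  have hA0 : 0 ≤ A := by positivity
  have hlim : Tendsto (fun lam : ℝ => A * lam ^ (-ε)) atTop (𝓝 0) := by
    simpa using (tendsto_rpow_neg_atTop hε0).const_mul A
  obtain ⟨lam, hlam0, hlam⟩ := ((eventually_gt_atTop (0 : ℝ)).and
    (hlim.eventually_le_const hκ)).exists
  refine ⟨lam, hlam0, fun g m hm hg t => ?_⟩
  rw [duh_apply]
  rcases eq_or_lt_of_le t.2.1 with h | h
  · rw [← h, duhFun_zero_time, norm_zero]; positivity
  · refine (K.norm_duhFun_le g (lam := lam) (ε := ε) (q := lam ^ (-ε)) ⟨h, t.2.2⟩ hε1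
      (fun r hr => ?_) hm fun τ _ => hg τ).trans ?_
    · have hx : 0 < lam * r := mul_pos hlam0 hr.1
      rw [← Real.mul_rpow hlam0.le hr.1.le, neg_mul, Real.exp_neg, Real.rpow_neg hx.le]
      refine inv_anti₀ (by positivity) ?_
      -- `x ^ ε ≤ exp x` for `0 ≤ ε ≤ 1`
      have h1 : (lam * r) ^ ε ≤ (Real.exp (lam * r)) ^ ε :=
        Real.rpow_le_rpow hx.le (by linarith [Real.add_one_le_exp (lam * r)]) hε0.le
      refine h1.trans ?_
      rw [← Real.exp_mul]
      exact Real.exp_le_exp.mpr (mul_le_of_le_one_right hx.le hε3)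
    · have h2 : (t : ℝ) ^ (K.gain - ε) ≤ T ^ (K.gain - ε) :=
        Real.rpow_le_rpow h.le t.2.2 (by linarith)
      calc K.bd * lam ^ (-ε) * betaConst (K.b + ε) K.c * (t : ℝ) ^ (K.gain - ε) * m *
            Real.exp (lam * t)
          ≤ K.bd * lam ^ (-ε) * betaConst (K.b + ε) K.c * T ^ (K.gain - ε) * m *
            Real.exp (lam * t) := by gcongr
        _ = A * lam ^ (-ε) * m * Real.exp (lam * t) := by rw [hA]; ring
        _ ≤ _ := by gcongr

end DuhamelKernel

/-! ### The Duhamel integral and its right derivative -/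

/-- Averages over short intervals of functions that are almost constant. -/
theorem tendsto_average_right {Z : Type*} [NormedAddCommGroup Z] [NormedSpace ℝ Z]
    [CompleteSpace Z] {F : ℝ → ℝ → Z} {L : Z} {t : ℝ}
    (h : ∀ η > 0, ∀ᶠ r in 𝓝[>] (0 : ℝ), IntervalIntegrable (F r) volume t (t + r) ∧
      ∀ τ ∈ Ioo t (t + r), ‖F r τ - L‖ ≤ η) :
    Tendsto (fun r => r⁻¹ • ∫ τ in t..t + r, F r τ) (𝓝[>] 0) (𝓝 L) := by
  rw [Metric.tendsto_nhds]
  intro η hη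
  filter_upwards [h (η / 2) (by linarith), self_mem_nhdsWithin] with r ⟨hi, hr⟩ hr0
  rw [mem_Ioi] at hr0
  have h1 : (∫ τ in t..t + r, F r τ) - r • L = ∫ τ in t..t + r, (F r τ - L) := by
    rw [intervalIntegral.integral_sub hi (by simp)]
    simp
  have h2 : ‖∫ τ in t..t + r, (F r τ - L)‖ ≤ ∫ τ in t..t + r, η / 2 := by
    refine intervalIntegral.norm_integral_le_of_norm_le (by linarith) ?_ (by simp)
    have hne : ∀ᵐ x : ℝ, x ≠ t + r := by simp [ae_iff]
    filter_upwards [hne] with τ hτ1 hτ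
    exact hr τ ⟨hτ.1, lt_of_le_of_ne hτ.2 hτ1⟩
  have h3 : r⁻¹ • (∫ τ in t..t + r, F r τ) - L = r⁻¹ • ∫ τ in t..t + r, (F r τ - L) := by
    rw [← h1, smul_sub, smul_smul, inv_mul_cancel₀ hr0.ne', one_smul]
  rw [dist_eq_norm, h3, norm_smul, Real.norm_eq_abs, abs_of_pos (inv_pos.mpr hr0)]
  simp only [intervalIntegral.integral_const, add_sub_cancel_left, smul_eq_mul] at h2
  calc r⁻¹ * ‖∫ τ in t..t + r, (F r τ - L)‖ ≤ r⁻¹ * (r * (η / 2)) := by gcongr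
    _ = η / 2 := by field_simp
    _ < η := by linarith

namespace DuhamelKernel

variable {T : ℝ} {Y H : Type*} [NormedAddCommGroup Y] [NormedSpace ℝ Y]
  [NormedAddCommGroup H] [NormedSpace ℝ H] (K : DuhamelKernel T Y H)

/-- The integrand of the Duhamel operator at time `t`, as a function of the original variable. -/
def rate (g : C(Icc (0 : ℝ) T, Y)) (t τ : ℝ) : H :=
  τ ^ (-K.c) • K.op (t - τ) (g (projIcc 0 T K.T_pos.le τ))

/-- The Duhamel integral `∫₀ᵗ τ ^ (-c) op (t - τ) (g τ) dτ`. -/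
def conv (g : C(Icc (0 : ℝ) T, Y)) (t : ℝ) : H := ∫ τ in (0 : ℝ)..t, K.rate g t τ

theorem integrand_eq (g : C(Icc (0 : ℝ) T, Y)) {t x : ℝ} (ht : 0 < t) (hx : 0 ≤ x) :
    K.integrand g t x = t ^ K.c • K.rate g t (t * x) := by
  rw [integrand, rate, smul_smul, Real.mul_rpow ht.le hx, ← mul_assoc, ← Real.rpow_add ht]
  simp [mul_sub]

theorem intervalIntegrable_rate (g : C(Icc (0 : ℝ) T, Y)) {t : ℝ} (ht : t ∈ Ioc 0 T) :
    IntervalIntegrable (K.rate g t) volume 0 t := by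
  have h := (K.intervalIntegrable_integrand g ht).smul (t ^ (-K.c))
  have h1 : IntervalIntegrable (fun x => K.rate g t (t * x)) volume 0 1 := by
    refine h.congr fun x hx => ?_
    rw [uIoc_of_le zero_le_one] at hx
    simp only [Pi.smul_apply]
    rw [K.integrand_eq g ht.1 hx.1.le, smul_smul, ← Real.rpow_add ht.1]
    simp
  have h2 := h1.comp_mul_left (c := t⁻¹)
  simpa [← mul_assoc, mul_inv_cancel₀ ht.1.ne'] using h2

theorem duhFun_eq_conv (g : C(Icc (0 : ℝ) T, Y)) {t : ℝ} (ht : t ∈ Ioc 0 T) :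
    K.duhFun g t = t ^ K.e • K.conv g t := by
  have h1 : ∫ x in (0 : ℝ)..1, K.integrand g t x = ∫ x in (0 : ℝ)..1,
      t ^ K.c • K.rate g t (t * x) := by
    refine intervalIntegral.integral_congr fun x hx => ?_
    rw [uIcc_of_le zero_le_one] at hx
    exact K.integrand_eq g ht.1 hx.1
  rw [duhFun, h1, intervalIntegral.integral_smul,
    intervalIntegral.integral_comp_mul_left _ ht.1.ne', conv, smul_smul, smul_smul, mul_zero,
    mul_one, ← Real.rpow_add ht.1, ← Real.rpow_neg_one, ← Real.rpow_add ht.1]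
  congr 2
  ring

section Complete

variable [CompleteSpace H]

/-- Restarting the Duhamel integral at a positive time, when the kernel is propagated by a
semigroup `S`. -/
theorem conv_add {S : ℝ → H →L[ℝ] H} (hS : ∀ t r, 0 < t → 0 ≤ r → K.op (t + r) = (S r).comp (K.op t))
    (g : C(Icc (0 : ℝ) T, Y)) {t r : ℝ} (ht : 0 < t) (hr : 0 ≤ r) (htr : t + r ≤ T) :
    K.conv g (t + r) = S r (K.conv g t) + ∫ τ in t..t + r, K.rate g (t + r) τ := by
  have hi := K.intervalIntegrable_rate g (t := t + r) ⟨by linarith, htr⟩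
  have hi1 : IntervalIntegrable (K.rate g (t + r)) volume 0 t :=
    hi.mono_set (by rw [uIcc_of_le ht.le, uIcc_of_le (by linarith)]; gcongr; linarith)
  have hi2 : IntervalIntegrable (K.rate g (t + r)) volume t (t + r) :=
    hi.mono_set (by rw [uIcc_of_le (by linarith), uIcc_of_le (by linarith)]; gcongr)
  rw [conv, ← intervalIntegral.integral_add_adjacent_intervals hi1 hi2, conv,
    ← ContinuousLinearMap.intervalIntegral_comp_comm _
      (K.intervalIntegrable_rate g ⟨ht, by linarith⟩)]
  congr 1
  refine intervalIntegral.integral_congr_ae ?_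
  have hne : ∀ᵐ x : ℝ, x ≠ t := by simp [ae_iff]
  filter_upwards [hne] with τ hτ1 hτ
  rw [uIoc_of_le ht.le] at hτ
  have h1 : 0 < t - τ := by linarith [lt_of_le_of_ne hτ.2 hτ1]
  have h2 : t + r - τ = (t - τ) + r := by ring
  rw [rate, rate, h2, hS _ _ h1 hr, map_smul]
  rfl

/-- Transfer of linear relations between kernels to the Duhamel integrals. -/
theorem map_conv_eq {Y' H' Z : Type*} [NormedAddCommGroup Y'] [NormedSpace ℝ Y']
    [NormedAddCommGroup H'] [NormedSpace ℝ H'] [CompleteSpace H'] [NormedAddCommGroup Z]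
    [NormedSpace ℝ Z] [CompleteSpace Z] (K' : DuhamelKernel T Y' H') (hc : K.c = K'.c)
    {g : C(Icc (0 : ℝ) T, Y)} {g' : C(Icc (0 : ℝ) T, Y')} {A : H →L[ℝ] Z} {A' : H' →L[ℝ] Z}
    (h : ∀ r, 0 < r → ∀ τ, A (K.op r (g τ)) = A' (K'.op r (g' τ))) {t : ℝ} (ht : t ∈ Ioc 0 T) :
    A (K.conv g t) = A' (K'.conv g' t) := by
  rw [conv, conv, ← ContinuousLinearMap.intervalIntegral_comp_comm _
    (K.intervalIntegrable_rate g ht), ← ContinuousLinearMap.intervalIntegral_comp_comm _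
    (K'.intervalIntegrable_rate g' ht)]
  refine intervalIntegral.integral_congr_ae ?_
  have hne : ∀ᵐ x : ℝ, x ≠ t := by simp [ae_iff]
  filter_upwards [hne] with τ hτ1 hτ
  rw [uIoc_of_le ht.1.le] at hτ
  have h1 : 0 < t - τ := by linarith [lt_of_le_of_ne hτ.2 hτ1]
  rw [rate, rate, map_smul, map_smul, h _ h1, hc]

/-- If `A ∘ op r` extends to a family `Λ r` that is bounded near `r = 0` and strongly continuous
there, then the increments of the Duhamel integral under `A` are differentiable from the right. -/
theorem tendsto_average_rate {Z : Type*} [NormedAddCommGroup Z] [NormedSpace ℝ Z]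
    [CompleteSpace Z] (A : H →L[ℝ] Z) (Λ : ℝ → Y →L[ℝ] Z)
    (hΛ : ∀ r > 0, ∀ y, A (K.op r y) = Λ r y) {M : ℝ} (hM : ∀ᶠ r in 𝓝[>] (0 : ℝ), ‖Λ r‖ ≤ M)
    (hlim : ∀ y, Tendsto (fun r => Λ r y) (𝓝[>] 0) (𝓝 (Λ 0 y)))
    (g : C(Icc (0 : ℝ) T, Y)) {t : ℝ} (ht : t ∈ Ioo 0 T) :
    Tendsto (fun r => r⁻¹ • A (∫ τ in t..t + r, K.rate g (t + r) τ)) (𝓝[>] 0)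
      (𝓝 (t ^ (-K.c) • Λ 0 (g (projIcc 0 T K.T_pos.le t)))) := by
  set G : ℝ → Y := fun τ => τ ^ (-K.c) • g (projIcc 0 T K.T_pos.le τ) with hG
  have hGc : ContinuousAt G t := ((Real.continuousAt_rpow_const _ _ (Or.inl ht.1.ne'))).smul
    (g.continuous.comp continuous_projIcc).continuousAt
  have hrT : ∀ᶠ r in 𝓝[>] (0 : ℝ), t + r ≤ T := by
    filter_upwards [Ioo_mem_nhdsGT (show (0 : ℝ) < T - t by linarith [ht.2])] with r hr
    linarith [hr.2]
  have hint : ∀ r, 0 < r → t + r ≤ T → IntervalIntegrable (K.rate g (t + r)) volume t (t + r) :=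
    fun r hr hrT => (K.intervalIntegrable_rate g (t := t + r) ⟨by linarith [ht.1], hrT⟩).mono_set
      (by rw [uIcc_of_le (by linarith), uIcc_of_le (by linarith [ht.1])]; gcongr; exact ht.1.le)
  have hkey : Tendsto (fun r => r⁻¹ • ∫ τ in t..t + r, A (K.rate g (t + r) τ)) (𝓝[>] 0)
      (𝓝 (Λ 0 (G t))) := by
    refine tendsto_average_right fun η hη => ?_
    have hM0 : 0 ≤ M := by
      obtain ⟨r, hr⟩ := hM.exists
      exact (norm_nonneg _).trans hr
    have e1 : ∀ᶠ τ in 𝓝 t, ‖G τ - G t‖ ≤ η / 2 / (M + 1) := by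
      have := (tendsto_iff_norm_sub_tendsto_zero.mp hGc.tendsto)
      exact this.eventually_le_const (by positivity)
    obtain ⟨d, hd, hd1⟩ := Metric.eventually_nhds_iff.mp e1
    have e2 : ∀ᶠ r in 𝓝[>] (0 : ℝ), ‖Λ r‖ ≤ M ∧ ‖Λ r (G t) - Λ 0 (G t)‖ ≤ η / 2 :=
      hM.and ((tendsto_iff_norm_sub_tendsto_zero.mp (hlim (G t))).eventually_le_const
        (by positivity))
    obtain ⟨d', hd', hd1'⟩ := (mem_nhdsGT_iff_exists_Ioo_subset.mp e2)
    filter_upwards [hrT, Ioo_mem_nhdsGT hd, Ioo_mem_nhdsGT (show (0 : ℝ) < d' from hd')] with r hr hr1 hr2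
    refine ⟨?_, fun τ hτ => ?_⟩
    · have := hint r hr1.1 hr
      exact ⟨A.integrable_comp this.1, A.integrable_comp this.2⟩
    · have h1 : 0 < t + r - τ := by linarith [hτ.2]
      have h2 : A (K.rate g (t + r) τ) = Λ (t + r - τ) (G τ) := by
        rw [rate, map_smul, hΛ _ h1, hG, map_smul]
      obtain ⟨h3, h4⟩ := hd1' (show t + r - τ ∈ Ioo 0 d' from ⟨h1, by linarith [hτ.1, hr2.2]⟩)
      have h5 : ‖G τ - G t‖ ≤ η / 2 / (M + 1) := hd1 (by
        rw [Real.dist_eq, abs_of_pos (by linarith [hτ.1])]; linarith [hτ.2, hr1.2])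
      rw [h2]
      calc ‖Λ (t + r - τ) (G τ) - Λ 0 (G t)‖
          = ‖Λ (t + r - τ) (G τ - G t) + (Λ (t + r - τ) (G t) - Λ 0 (G t))‖ := by
            rw [map_sub]; congr 1; abel
        _ ≤ ‖Λ (t + r - τ)‖ * ‖G τ - G t‖ + η / 2 :=
            (norm_add_le _ _).trans (add_le_add (ContinuousLinearMap.le_opNorm _ _) h4)
        _ ≤ M * (η / 2 / (M + 1)) + η / 2 := by gcongr
        _ ≤ (M + 1) * (η / 2 / (M + 1)) + η / 2 := by gcongr; linarith
        _ = η := by field_simp; norm_num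
  have h0 : Λ 0 (G t) = t ^ (-K.c) • Λ 0 (g (projIcc 0 T K.T_pos.le t)) := by rw [hG, map_smul]
  rw [← h0]
  refine hkey.congr' ?_
  filter_upwards [hrT, self_mem_nhdsWithin] with r hr hr0
  rw [ContinuousLinearMap.intervalIntegral_comp_comm _ (hint r hr0 hr)]

end Complete

end DuhamelKernel

/-! ### Quadratic Volterra equations: uniqueness and smooth dependence -/

section Bilinear

variable {T : ℝ} {Y H : Type*} [NormedAddCommGroup Y] [NormedSpace ℝ Y]
  [NormedAddCommGroup H] [NormedSpace ℝ H]

/-- The pointwise action of a bounded bilinear map on continuous curves. -/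
def curveBilin (β : H →L[ℝ] H →L[ℝ] Y) :
    C(Icc (0 : ℝ) T, H) →L[ℝ] C(Icc (0 : ℝ) T, H) →L[ℝ] C(Icc (0 : ℝ) T, Y) :=
  LinearMap.mkContinuous₂
    (LinearMap.mk₂ ℝ (fun z v => ⟨fun t => β (z t) (v t), by fun_prop⟩)
      (fun z z' v => by ext t; simp) (fun r z v => by ext t; simp)
      (fun z v v' => by ext t; simp) (fun r z v => by ext t; simp))
    ‖β‖ fun z v => by
      rw [ContinuousMap.norm_le _ (by positivity)]
      intro t
      refine (β.le_opNorm₂ (z t) (v t)).trans ?_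
      gcongr
      · exact z.norm_coe_le_norm t
      · exact v.norm_coe_le_norm t

@[simp] theorem curveBilin_apply (β : H →L[ℝ] H →L[ℝ] Y) (z v : C(Icc (0 : ℝ) T, H))
    (t : Icc (0 : ℝ) T) : curveBilin β z v t = β (z t) (v t) := rfl

namespace DuhamelKernel

variable (K : DuhamelKernel T Y H) (β : H →L[ℝ] H →L[ℝ] Y)

/-- The quadratic Volterra map `z ↦ z - Duh β(z, z)`. -/
def volterra (z : C(Icc (0 : ℝ) T, H)) : C(Icc (0 : ℝ) T, H) := z - K.duh (curveBilin β z z)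

/-- Composing a Lipschitz nonlinearity with the Duhamel operator gives a contraction for a large
exponential weight. -/
theorem exists_weightedLipschitz (z₀ : C(Icc (0 : ℝ) T, H))
    (N : C(Icc (0 : ℝ) T, H) → C(Icc (0 : ℝ) T, Y)) {L : ℝ} (hL : 0 ≤ L)
    (hN : ∀ z v t, ‖N z t - N v t‖ ≤ L * ‖z t - v t‖) :
    ∃ lam, WeightedLipschitz (fun z => z₀ + K.duh (N z)) lam (1 / 2) := by
  obtain ⟨lam, -, h⟩ := K.exists_weight (κ := 1 / (2 * (L + 1))) (by positivity)
  refine ⟨lam, fun z v m hm hzv t => ?_⟩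
  have h1 := h (N z - N v) (L * m) (by positivity) (fun τ => by
    refine (hN z v τ).trans ?_
    rw [mul_assoc]
    gcongr
    exact hzv τ) t
  have h2 : (z₀ + K.duh (N z)) t - (z₀ + K.duh (N v)) t = K.duh (N z - N v) t := by
    rw [map_sub]; simp
  rw [h2]
  refine h1.trans ?_
  have h3 : 1 / (2 * (L + 1)) * L ≤ 1 / 2 := by
    rw [div_mul_eq_mul_div, one_mul, div_le_iff₀ (by positivity)]
    linarith
  rw [← mul_assoc]
  gcongr

/-- The difference of two solutions satisfies a linear Volterra equation, whose only solution is zero. -/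
theorem volterra_injective : Function.Injective (K.volterra β) := by
  intro z v hzv
  -- `z - v` is a fixed point of the linear map `h ↦ Duh (β(h, z) + β(v, h))`
  set N : C(Icc (0 : ℝ) T, H) → C(Icc (0 : ℝ) T, Y) :=
    fun h => curveBilin β h z + curveBilin β v h with hN
  obtain ⟨lam, hlam⟩ := K.exists_weightedLipschitz 0 N (L := ‖β‖ * ‖z‖ + ‖β‖ * ‖v‖)
    (by positivity) fun h h' t => by
      have : N h t - N h' t = β (h t - h' t) (z t) + β (v t) (h t - h' t) := by
        simp [hN]; abel
      rw [this]
      calc _ ≤ ‖β‖ * ‖h t - h' t‖ * ‖z t‖ + ‖β‖ * ‖v t‖ * ‖h t - h' t‖ :=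
            (norm_add_le _ _).trans (add_le_add (β.le_opNorm₂ _ _) (β.le_opNorm₂ _ _))
        _ ≤ ‖β‖ * ‖h t - h' t‖ * ‖z‖ + ‖β‖ * ‖v‖ * ‖h t - h' t‖ := by
            gcongr
            · exact z.norm_coe_le_norm t
            · exact v.norm_coe_le_norm t
        _ = _ := by ring
  have h1 : z - v = K.duh (N (z - v)) := by
    have h2 : N (z - v) = curveBilin β z z - curveBilin β v v := by
      ext t; simp [hN]
    rw [h2, map_sub]
    simp only [volterra] at hzv
    have := sub_eq_sub_iff_add_eq_add.mp hzv
    rw [sub_eq_sub_iff_add_eq_add, this, add_comm]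
  have h3 := hlam.eq_of_fixed (by norm_num) (by norm_num) (z := z - v) (v := 0)
    (by rw [zero_add]; exact h1.symm) (by simp [hN])
  exact sub_eq_zero.mp h3

theorem contDiff_volterra : ContDiff ℝ ∞ (K.volterra β) := by
  have h : ContDiff ℝ ∞ fun z : C(Icc (0 : ℝ) T, H) => curveBilin β z z :=
    ((curveBilin (T := T) β).contDiff).clm_apply contDiff_id
  exact contDiff_id.sub (K.duh.contDiff.comp h)

/-- The linearization of `volterra` at `z`. -/
def volterraDeriv (z : C(Icc (0 : ℝ) T, H)) : C(Icc (0 : ℝ) T, H) →L[ℝ] C(Icc (0 : ℝ) T, H) :=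
  ContinuousLinearMap.id ℝ _ - K.duh.comp (curveBilin β z + (curveBilin β).flip z)

theorem hasFDerivAt_volterra (z : C(Icc (0 : ℝ) T, H)) :
    HasFDerivAt (K.volterra β) (K.volterraDeriv β z) z := by
  have h : HasFDerivAt (fun z : C(Icc (0 : ℝ) T, H) => curveBilin β z z)
      (curveBilin β z + (curveBilin β).flip z) z := by
    have h1 := ((curveBilin (T := T) β).hasFDerivAt (x := z)).clm_apply (hasFDerivAt_id z)
    rwa [ContinuousLinearMap.comp_id] at h1
  exact (hasFDerivAt_id z).sub (K.duh.hasFDerivAt.comp z h)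

/-- The linearization is a linear Volterra equation of the second kind; it is solved by a contraction
in the norm with a large exponential weight, without any smallness of `z` or `T`. -/
theorem bijective_volterraDeriv [CompleteSpace H] (z : C(Icc (0 : ℝ) T, H)) :
    Function.Bijective (K.volterraDeriv β z) := by
  set N : C(Icc (0 : ℝ) T, H) → C(Icc (0 : ℝ) T, Y) :=
    fun h => curveBilin β z h + curveBilin β h z with hN
  have hL : ∀ h h' t, ‖N h t - N h' t‖ ≤ (2 * ‖β‖ * ‖z‖) * ‖h t - h' t‖ := fun h h' t => by
    have : N h t - N h' t = β (z t) (h t - h' t) + β (h t - h' t) (z t) := by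
      simp [hN]; abel
    rw [this]
    calc _ ≤ ‖β‖ * ‖z t‖ * ‖h t - h' t‖ + ‖β‖ * ‖h t - h' t‖ * ‖z t‖ :=
          (norm_add_le _ _).trans (add_le_add (β.le_opNorm₂ _ _) (β.le_opNorm₂ _ _))
      _ ≤ ‖β‖ * ‖z‖ * ‖h t - h' t‖ + ‖β‖ * ‖h t - h' t‖ * ‖z‖ := by
          gcongr <;> exact z.norm_coe_le_norm t
      _ = _ := by ring
  have hD : ∀ h, K.volterraDeriv β z h = h - K.duh (N h) := fun h => rfl
  constructor
  · rw [injective_iff_map_eq_zero]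
    intro h hh
    obtain ⟨lam, hlam⟩ := K.exists_weightedLipschitz 0 N (by positivity) hL
    rw [hD, sub_eq_zero] at hh
    exact hlam.eq_of_fixed (by norm_num) (by norm_num) (by rw [zero_add]; exact hh.symm)
      (by simp [hN])
  · intro y
    obtain ⟨lam, hlam⟩ := K.exists_weightedLipschitz y N (by positivity) hL
    obtain ⟨h, hh⟩ := hlam.exists_fixed (by norm_num) (by norm_num)
    refine ⟨h, ?_⟩
    rw [hD, sub_eq_iff_eq_add]
    exact hh.symm

/-- Solutions of `z = L p + Duh β(z, z)` depend smoothly on `p`: the map `volterra` is injective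
with invertible derivative, so `z` is locally given by the inverse function theorem. -/
theorem contDiff_of_volterra_eq [CompleteSpace H] {P : Type*} [NormedAddCommGroup P]
    [NormedSpace ℝ P] (L : P →L[ℝ] C(Icc (0 : ℝ) T, H)) {z : P → C(Icc (0 : ℝ) T, H)}
    (hz : ∀ p, K.volterra β (z p) = L p) : ContDiff ℝ ∞ z := by
  rw [contDiff_iff_contDiffAt]
  intro p
  let A : C(Icc (0 : ℝ) T, H) ≃L[ℝ] C(Icc (0 : ℝ) T, H) :=
    ContinuousLinearEquiv.ofBijective (K.volterraDeriv β (z p))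
      (LinearMap.ker_eq_bot.mpr (K.bijective_volterraDeriv β (z p)).1)
      (LinearMap.range_eq_top.mpr (K.bijective_volterraDeriv β (z p)).2)
  have hA : HasFDerivAt (K.volterra β) (A : C(Icc (0 : ℝ) T, H) →L[ℝ] C(Icc (0 : ℝ) T, H)) (z p) :=
    K.hasFDerivAt_volterra β (z p)
  have hcd := (K.contDiff_volterra β).contDiffAt (x := z p)
  have hinv := hcd.to_localInverse hA (by simp)
  rw [hz p] at hinv
  have h1 : ContDiffAt ℝ ∞ (fun q => hcd.localInverse hA (by simp) (L q)) p :=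
    hinv.comp p L.contDiff.contDiffAt
  refine h1.congr_of_eventuallyEq ?_
  have hstrict := hcd.hasStrictFDerivAt' hA (by simp)
  have h2 := hstrict.eventually_right_inverse
  rw [hz p] at h2
  filter_upwards [L.continuous.continuousAt.eventually h2] with q hq
  refine K.volterra_injective β ?_
  rw [hz q]
  exact hq.symm

end DuhamelKernel

end Bilinear

/-! ### Radial truncation -/

section Retraction

variable {H : Type*} [NormedAddCommGroup H] {R : ℝ}

theorem retr_coeff_mem (hR : 0 < R) (x : H) : R / max R ‖x‖ ∈ Icc (0 : ℝ) 1 :=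
  ⟨div_nonneg hR.le (hR.le.trans (le_max_left _ _)),
    div_le_one_of_le₀ (le_max_left _ _) (hR.le.trans (le_max_left _ _))⟩

variable [NormedSpace ℝ H]

/-- The radial retraction onto the closed ball of radius `R`. -/
def retr (R : ℝ) (x : H) : H := (R / max R ‖x‖) • x

theorem norm_retr_le (hR : 0 < R) (x : H) : ‖retr R x‖ ≤ R := by
  have h : 0 < max R ‖x‖ := lt_max_of_lt_left hR
  rw [retr, norm_smul, Real.norm_eq_abs, abs_of_nonneg (retr_coeff_mem hR x).1, div_mul_eq_mul_div,
    div_le_iff₀ h]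
  gcongr
  exact le_max_right _ _

theorem retr_eq_self (hR : 0 < R) {x : H} (hx : ‖x‖ ≤ R) : retr R x = x := by
  rw [retr, max_eq_left hx, div_self hR.ne', one_smul]

theorem norm_retr_sub_le (hR : 0 < R) (x y : H) : ‖retr R x - retr R y‖ ≤ 2 * ‖x - y‖ := by
  have hx : 0 < max R ‖x‖ := lt_max_of_lt_left hR
  have hy : 0 < max R ‖y‖ := lt_max_of_lt_left hR
  have h1 : retr R x - retr R y =
      (R / max R ‖x‖) • (x - y) + (R / max R ‖x‖ - R / max R ‖y‖) • y := by
    simp only [retr]; module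
  have h2 : |R / max R ‖x‖ - R / max R ‖y‖| * ‖y‖ ≤ ‖x - y‖ := by
    have h3 : |max R ‖y‖ - max R ‖x‖| ≤ ‖x - y‖ := by
      refine (abs_max_sub_max_le_max _ _ _ _).trans ?_
      rw [sub_self, abs_zero]
      refine max_le (norm_nonneg _) ?_
      rw [norm_sub_rev]
      exact abs_norm_sub_norm_le y x
    have h4 : R / max R ‖x‖ - R / max R ‖y‖ =
        (R / max R ‖x‖) * ((max R ‖y‖ - max R ‖x‖) / max R ‖y‖) := by
      field_simp
    rw [h4, abs_mul, abs_of_nonneg (retr_coeff_mem hR x).1, abs_div, abs_of_pos hy]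
    calc R / max R ‖x‖ * (|max R ‖y‖ - max R ‖x‖| / max R ‖y‖) * ‖y‖
        ≤ 1 * (|max R ‖y‖ - max R ‖x‖| / max R ‖y‖) * max R ‖y‖ := by
          gcongr
          · exact (retr_coeff_mem hR x).2
          · exact le_max_right _ _
      _ = |max R ‖y‖ - max R ‖x‖| := by field_simp
      _ ≤ _ := h3
  rw [h1]
  refine (norm_add_le _ _).trans ?_
  rw [norm_smul, norm_smul, Real.norm_eq_abs, Real.norm_eq_abs,
    abs_of_nonneg (retr_coeff_mem hR x).1]
  have h5 : R / max R ‖x‖ * ‖x - y‖ ≤ 1 * ‖x - y‖ := by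
    gcongr; exact (retr_coeff_mem hR x).2
  linarith

theorem continuous_retr (hR : 0 < R) : Continuous (retr R : H → H) := by
  have h : LipschitzWith 2 (retr R : H → H) :=
    LipschitzWith.of_dist_le_mul fun x y => by
      rw [dist_eq_norm, dist_eq_norm]; exact norm_retr_sub_le hR x y
  exact h.continuous

end Retraction

/-! ### Global solutions of quadratic Volterra equations from an energy estimate -/

section Truncated

variable {T : ℝ} {Y H : Type*} [NormedAddCommGroup Y] [NormedSpace ℝ Y]
  [NormedAddCommGroup H] [NormedSpace ℝ H] {R : ℝ}

/-- The pointwise radial truncation of a curve. -/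
def retrCurve (hR : 0 < R) (z : C(Icc (0 : ℝ) T, H)) : C(Icc (0 : ℝ) T, H) :=
  ⟨fun t => retr R (z t), (continuous_retr hR).comp z.continuous⟩

@[simp] theorem retrCurve_apply (hR : 0 < R) (z : C(Icc (0 : ℝ) T, H)) (t : Icc (0 : ℝ) T) :
    retrCurve hR z t = retr R (z t) := rfl

theorem norm_bilin_retr_sub_le (β : H →L[ℝ] H →L[ℝ] Y) (hR : 0 < R) (x y : H) :
    ‖β (retr R x) (retr R x) - β (retr R y) (retr R y)‖ ≤ 4 * R * ‖β‖ * ‖x - y‖ := by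
  have h : β (retr R x) (retr R x) - β (retr R y) (retr R y) =
      β (retr R x - retr R y) (retr R x) + β (retr R y) (retr R x - retr R y) := by
    simp
  rw [h]
  calc _ ≤ ‖β‖ * ‖retr R x - retr R y‖ * ‖retr R x‖ + ‖β‖ * ‖retr R y‖ * ‖retr R x - retr R y‖ :=
        (norm_add_le _ _).trans (add_le_add (β.le_opNorm₂ _ _) (β.le_opNorm₂ _ _))
    _ ≤ ‖β‖ * (2 * ‖x - y‖) * R + ‖β‖ * R * (2 * ‖x - y‖) := by
        gcongr
        · exact norm_retr_sub_le hR x y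
        · exact norm_retr_le hR x
        · exact norm_retr_le hR y
        · exact norm_retr_sub_le hR x y
    _ = _ := by ring

theorem norm_bilin_retr_le (β : H →L[ℝ] H →L[ℝ] Y) (hR : 0 < R) (x : H) :
    ‖β (retr R x) (retr R x)‖ ≤ ‖β x x‖ := by
  obtain ⟨h0, h1⟩ := retr_coeff_mem hR x
  simp only [retr, map_smul, smul_apply, norm_smul, Real.norm_eq_abs,
    abs_of_nonneg h0]
  calc _ ≤ 1 * (1 * ‖β x x‖) := by gcongr
    _ = _ := by ring

/-- Strongly convergent contractions converge uniformly along a continuous curve. -/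
theorem eventually_norm_comp_sub_le {P : ℕ → H →L[ℝ] H} (hP1 : ∀ n x, ‖P n x‖ ≤ ‖x‖)
    (hP : ∀ x, Tendsto (fun n => P n x) atTop (𝓝 x)) (z : C(Icc (0 : ℝ) T, H)) {η : ℝ}
    (hη : 0 < η) : ∀ᶠ n in atTop, ∀ t, ‖P n (z t) - z t‖ ≤ η := by
  obtain ⟨s, -, hs, hcov⟩ := (isCompact_range z.continuous).finite_cover_balls
    (show 0 < η / 3 by linarith)
  have h1 : ∀ᶠ n in atTop, ∀ x ∈ s, ‖P n x - x‖ ≤ η / 3 :=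
    (hs.eventually_all).mpr fun x _ =>
      (tendsto_iff_norm_sub_tendsto_zero.mp (hP x)).eventually_le_const (by linarith)
  filter_upwards [h1] with n hn t
  obtain ⟨x, hx, hxt⟩ := mem_iUnion₂.mp (hcov (mem_range_self t))
  rw [Metric.mem_ball, dist_eq_norm] at hxt
  calc ‖P n (z t) - z t‖ = ‖P n (z t - x) + (P n x - x) - (z t - x)‖ := by
        rw [map_sub]; congr 1; abel
    _ ≤ ‖z t - x‖ + η / 3 + ‖z t - x‖ :=
        (norm_sub_le _ _).trans (add_le_add ((norm_add_le _ _).trans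
          (add_le_add (hP1 _ _) (hn x hx))) le_rfl)
    _ ≤ η := by linarith

namespace DuhamelKernel

variable (K : DuhamelKernel T Y H) (β : H →L[ℝ] H →L[ℝ] Y) (z₀ : C(Icc (0 : ℝ) T, H))

/-- The right-hand side of the Volterra equation with truncated nonlinearity. -/
def truncMap (hR : 0 < R) (z : C(Icc (0 : ℝ) T, H)) : C(Icc (0 : ℝ) T, H) :=
  z₀ + K.duh (curveBilin β (retrCurve hR z) (retrCurve hR z))

theorem exists_weightedLipschitz_truncMap (hR : 0 < R) :
    ∃ lam, WeightedLipschitz (K.truncMap β z₀ hR) lam (1 / 2) :=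
  K.exists_weightedLipschitz z₀ (fun z => curveBilin β (retrCurve hR z) (retrCurve hR z))
    (L := 4 * R * ‖β‖) (by positivity) fun z v t => norm_bilin_retr_sub_le β hR (z t) (v t)

/-- Galerkin approximation of the truncated equation by strongly convergent contractions. -/
theorem exists_galerkin [CompleteSpace H] (hR : 0 < R) {P : ℕ → H →L[ℝ] H}
    (hP1 : ∀ n x, ‖P n x‖ ≤ ‖x‖) (hP : ∀ x, Tendsto (fun n => P n x) atTop (𝓝 x))
    {z : C(Icc (0 : ℝ) T, H)} (hz : K.truncMap β z₀ hR z = z) :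
    ∃ w : ℕ → C(Icc (0 : ℝ) T, H), (∀ n t, w n t = P n (K.truncMap β z₀ hR (w n) t)) ∧
      (∀ n v, (∀ t, v t = P n (K.truncMap β z₀ hR v t)) → v = w n) ∧
      ∀ t, Tendsto (fun n => w n t) atTop (𝓝 (z t)) := by
  obtain ⟨lam, hlam⟩ := K.exists_weightedLipschitz_truncMap β z₀ hR
  let Φ : ℕ → C(Icc (0 : ℝ) T, H) → C(Icc (0 : ℝ) T, H) := fun n v =>
    ⟨fun t => P n (K.truncMap β z₀ hR v t), by fun_prop⟩
  have hΦ : ∀ n, WeightedLipschitz (Φ n) lam (1 / 2) := fun n y v m hm hyv t => by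
    refine le_trans ?_ (hlam y v m hm hyv t)
    change ‖P n _ - P n _‖ ≤ _
    rw [← map_sub]
    exact hP1 n _
  have hex := fun n => (hΦ n).exists_fixed (by norm_num) (by norm_num)
  choose w hw using hex
  refine ⟨w, fun n t => ?_, fun n v hv => ?_, fun t => ?_⟩
  · conv_lhs => rw [← hw n]
    rfl
  · refine (hΦ n).eq_of_fixed (by norm_num) (by norm_num) ?_ (hw n)
    ext t
    exact (hv t).symm
  · rw [Metric.tendsto_nhds]
    intro η hη
    set η' := η / (4 * Real.exp (|lam| * T) * Real.exp (lam * t)) with hη'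
    have hpos : 0 < η' := by positivity
    filter_upwards [eventually_norm_comp_sub_le hP1 hP z hpos] with n hn
    have h := (hΦ n).norm_sub_le (by norm_num) (by norm_num) (hw n) (v := z)
      (δ := η' * Real.exp (|lam| * T)) (by positivity) (fun τ => by
        have h1 : Φ n z τ = P n (z τ) := by
          change P n (K.truncMap β z₀ hR z τ) = _
          rw [hz]
        rw [h1, mul_assoc, ← Real.exp_add]
        refine (hn τ).trans (le_mul_of_one_le_right hpos.le (Real.one_le_exp ?_))
        have h2 : -(|lam| * τ) ≤ lam * τ := by
          nlinarith [neg_abs_le lam, τ.2.1]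
        nlinarith [τ.2.2, abs_nonneg lam]) t
    rw [dist_eq_norm]
    refine h.trans_lt ?_
    have h3 : η' * Real.exp (|lam| * T) / (1 - 1 / 2) * Real.exp (lam * t) = η / 2 := by
      rw [hη']
      have e1 := Real.exp_pos (|lam| * T)
      have e2 := Real.exp_pos (lam * t)
      field_simp
      norm_num
    rw [h3]
    linarith

/-- Global solvability of `z = z₀ + Duh β(z, z)`. The a priori bound of the solution of the
truncated equation has to be independent of the radius `R`; it is obtained in three stages: for
short times from the gain of the Duhamel operator, for the weaker quantity `‖W z‖` at all times from
the hypothesis `henergy`, and then for `‖z‖` at all times, because the nonlinearity is linear in `z`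
once `‖W z‖` is controlled. -/
theorem exists_volterra_eq [CompleteSpace H] (he : 0 ≤ K.e) (W : H →L[ℝ] H)
    (hW : ∀ x, ‖W x‖ ≤ ‖x‖) {Cβ μ : ℝ} (hCβ : 0 ≤ Cβ)
    (hβ : ∀ x, ‖β x x‖ ≤ Cβ * ‖W x‖ * ‖x‖) (hμ : 0 ≤ μ)
    (henergy : ∀ (R : ℝ) (hR : 0 < R) (z : C(Icc (0 : ℝ) T, H)), K.truncMap β z₀ hR z = z →
      ∀ t₀ t : Icc (0 : ℝ) T, 0 < (t₀ : ℝ) → (t₀ : ℝ) ≤ t →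
        ‖W (z t)‖ * (t₀ : ℝ) ^ K.e ≤
          Real.exp (μ * (t - t₀)) * ‖W (z t₀)‖ * (t : ℝ) ^ K.e) :
    ∃ z, K.volterra β z = z₀ := by
  have hT := K.T_pos
  have hgain : 0 < K.gain := K.gain_pos
  set A := ‖z₀‖ + 1 with hA
  have hA0 : 0 < A := by positivity
  obtain ⟨δ, hδ, hδ1⟩ : ∃ δ ∈ Ioc 0 T,
      K.bd * betaConst K.b K.c * δ ^ K.gain * (Cβ * (2 * A) * (2 * A)) < 1 := by
    have h1 : Tendsto (fun t : ℝ => K.bd * betaConst K.b K.c * t ^ K.gain *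
        (Cβ * (2 * A) * (2 * A))) (𝓝[>] 0) (𝓝 0) := by
      have h2 : Tendsto (fun t : ℝ => t ^ K.gain) (𝓝[>] 0) (𝓝 0) := by
        have h3 := (Real.continuousAt_rpow_const 0 K.gain (Or.inr hgain.le)).tendsto
        rw [Real.zero_rpow hgain.ne'] at h3
        exact h3.mono_left nhdsWithin_le_nhds
      simpa using (h2.const_mul (K.bd * betaConst K.b K.c)).mul_const (Cβ * (2 * A) * (2 * A))
    obtain ⟨δ, h2, h3⟩ := ((h1.eventually_lt_const one_pos).and (Ioc_mem_nhdsGT hT)).exists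
    exact ⟨δ, h3, h2⟩
  set M := 2 * A * (1 + Real.exp (μ * T) * T ^ K.e / δ ^ K.e) with hM
  have hδe : 0 < δ ^ K.e := Real.rpow_pos_of_pos hδ.1 _
  have hM0 : 0 ≤ M := by positivity
  obtain ⟨lam, hlam0, hlam⟩ := K.exists_weight (κ := 1 / (2 * (Cβ * M + 1))) (by positivity)
  set R := 2 * ‖z₀‖ * Real.exp (lam * T) + 1 with hRdef
  have hR : 0 < R := by positivity
  obtain ⟨lam', hlam'⟩ := K.exists_weightedLipschitz_truncMap β z₀ hR
  obtain ⟨z, hz⟩ := hlam'.exists_fixed (by norm_num) (by norm_num)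
  refine ⟨z, ?_⟩
  set g := curveBilin β (retrCurve hR z) (retrCurve hR z) with hg
  have hzt : ∀ t, z t = z₀ t + K.duh g t := fun t => by
    conv_lhs => rw [← hz]
    rfl
  have hgle : ∀ t, ‖g t‖ ≤ Cβ * ‖W (z t)‖ * ‖z t‖ := fun t =>
    (norm_bilin_retr_le β hR (z t)).trans (hβ _)
  -- short times: consider the first time at which `‖z‖` reaches `2 * A`
  have hshort : ∀ t : Icc (0 : ℝ) T, (t : ℝ) ≤ δ → ‖z t‖ < 2 * A := by
    by_contra! hcon
    obtain ⟨t₁, ht₁, ht₁'⟩ := hcon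
    have hcl : IsCompact {t : Icc (0 : ℝ) T | (t : ℝ) ≤ δ ∧ 2 * A ≤ ‖z t‖} :=
      ((isClosed_le continuous_subtype_val continuous_const).inter
        (isClosed_le continuous_const z.continuous.norm)).isCompact
    obtain ⟨s, ⟨hs1, hs2⟩, hs3⟩ := hcl.exists_isMinOn ⟨t₁, ht₁, ht₁'⟩
      (continuous_subtype_val (p := fun x => x ∈ Icc (0 : ℝ) T)).continuousOn
    have hbefore : ∀ τ : Icc (0 : ℝ) T, (τ : ℝ) < s → ‖z τ‖ ≤ 2 * A := fun τ hτ => by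
      by_contra! hc
      exact absurd (hs3 (show τ ∈ _ from ⟨by linarith, hc.le⟩)) (by simpa using hτ)
    have hs4 : ‖K.duh g s‖ ≤ 1 := by
      rw [duh_apply]
      rcases eq_or_lt_of_le s.2.1 with h | h
      · rw [← h, duhFun_zero_time, norm_zero]; exact zero_le_one
      · refine (K.norm_duhFun_le_of_lt g ⟨h, s.2.2⟩ (m := Cβ * (2 * A) * (2 * A)) (by positivity)
          fun τ hτ => ?_).trans ?_
        · refine (hgle τ).trans ?_
          gcongr
          · exact (hW _).trans (hbefore τ hτ)
          · exact hbefore τ hτ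
        · refine le_trans ?_ hδ1.le
          have := K.bd_nonneg
          have := betaConst_nonneg K.b K.c
          gcongr
    have hs5 : ‖z s‖ ≤ ‖z₀‖ + 1 := by
      rw [hzt]
      exact (norm_add_le _ _).trans (add_le_add (z₀.norm_coe_le_norm s) hs4)
    linarith
  -- the weak quantity at all times: `henergy` propagates the bound from the time `δ`
  have hlow : ∀ t, ‖W (z t)‖ ≤ M := by
    intro t
    rcases le_or_gt (t : ℝ) δ with h | h
    · refine (hW _).trans ((hshort t h).le.trans ?_)
      rw [hM]
      exact le_mul_of_one_le_right (by positivity) (le_add_of_nonneg_right (by positivity))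
    · have h1 := henergy R hR z hz ⟨δ, hδ.1.le, hδ.2⟩ t hδ.1 h.le
      have h2 : ‖W (z ⟨δ, hδ.1.le, hδ.2⟩)‖ ≤ 2 * A := (hW _).trans (hshort _ le_rfl).le
      have h3 : ‖W (z t)‖ ≤ Real.exp (μ * (t - δ)) * (2 * A) * (t : ℝ) ^ K.e / δ ^ K.e := by
        rw [le_div_iff₀ hδe]
        refine h1.trans ?_
        have : 0 ≤ (t : ℝ) ^ K.e := Real.rpow_nonneg t.2.1 _
        gcongr
      have h4 : Real.exp (μ * (t - δ)) ≤ Real.exp (μ * T) := by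
        gcongr
        linarith [t.2.2, hδ.1]
      have h5 : (t : ℝ) ^ K.e ≤ T ^ K.e := Real.rpow_le_rpow t.2.1 t.2.2 he
      have h6 : 0 ≤ (t : ℝ) ^ K.e := Real.rpow_nonneg t.2.1 _
      calc ‖W (z t)‖ ≤ _ := h3
        _ ≤ Real.exp (μ * T) * (2 * A) * T ^ K.e / δ ^ K.e := by gcongr
        _ = 2 * A * (Real.exp (μ * T) * T ^ K.e / δ ^ K.e) := by ring
        _ ≤ M := by rw [hM]; gcongr; linarith
  -- with `‖W z‖ ≤ M` the nonlinearity is at most linear in `z`, and the weight `lam`, chosen in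
  -- terms of `M` only, absorbs it
  set N := ‖expWeight (-lam) z‖ with hN
  have hN0 : 0 ≤ N := norm_nonneg _
  have hzN : ∀ t : Icc (0 : ℝ) T, ‖z t‖ ≤ N * Real.exp (lam * t) := norm_le_expWeight lam z
  have hdg := hlam g (Cβ * M * N) (by positivity) fun τ => (hgle τ).trans (by
    rw [mul_assoc (Cβ * M)]
    gcongr
    · exact hlow τ
    · exact hzN τ)
  have hN1 : N ≤ ‖z₀‖ + 1 / 2 * N := by
    refine expWeight_norm_le (by positivity) fun t => ?_
    have h1 : 1 ≤ Real.exp (lam * t) := Real.one_le_exp (mul_nonneg hlam0.le t.2.1)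
    rw [hzt]
    refine (norm_add_le _ _).trans ?_
    rw [add_mul]
    refine add_le_add ((z₀.norm_coe_le_norm t).trans
      (le_mul_of_one_le_right (norm_nonneg _) h1)) ((hdg t).trans ?_)
    have h2 : 1 / (2 * (Cβ * M + 1)) * (Cβ * M) ≤ 1 / 2 := by
      rw [div_mul_eq_mul_div, one_mul, div_le_iff₀ (by positivity)]
      linarith
    rw [← mul_assoc (1 / (2 * (Cβ * M + 1)))]
    gcongr
  -- the bound does not involve the truncation, so `R` can be taken above it and the truncation is
  -- inactive along `z`
  have hzR : ∀ t, ‖z t‖ ≤ R := fun t => by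
    have h1 : Real.exp (lam * t) ≤ Real.exp (lam * T) := by
      gcongr
      exact t.2.2
    calc ‖z t‖ ≤ N * Real.exp (lam * t) := hzN t
      _ ≤ 2 * ‖z₀‖ * Real.exp (lam * T) := by gcongr; linarith
      _ ≤ R := by rw [hRdef]; linarith
  have hret : retrCurve hR z = z := by
    ext t
    exact retr_eq_self hR (hzR t)
  rw [truncMap, hret] at hz
  rw [volterra, sub_eq_iff_eq_add]
  exact hz.symm

end DuhamelKernel

end Truncated

/-! ### The energy estimate for mild solutions -/

/-- If a curve `v` evolves by a semigroup of growth `exp (μ t)` and a forcing that is orthogonal to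
`v` at every time, then `‖v‖` grows at most like `exp (μ t)`: the upper right derivative of `‖v‖²` is
at most `2 μ ‖v‖²`. -/
theorem norm_le_exp_mul_of_restart {H : Type*} [NormedAddCommGroup H] [InnerProductSpace ℝ H]
    {S : ℝ → H →L[ℝ] H} {μ a b : ℝ} (hS : ∀ r, 0 ≤ r → ∀ x, ‖S r x‖ ≤ Real.exp (μ * r) * ‖x‖)
    (hS0 : ∀ x, Tendsto (fun r => S r x) (𝓝[>] 0) (𝓝 x)) {v : ℝ → H}
    (hv : ContinuousOn v (Icc a b))
    (hJ : ∀ t ∈ Ico a b, ∃ (J : ℝ → H) (h : H), (∀ᶠ r in 𝓝[>] (0 : ℝ), v (t + r) = S r (v t) + J r) ∧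
      Tendsto (fun r => r⁻¹ • J r) (𝓝[>] 0) (𝓝 h) ∧ inner ℝ (v t) h = 0) :
    ∀ t ∈ Icc a b, ‖v t‖ ≤ Real.exp (μ * (t - a)) * ‖v a‖ := by
  have key : ∀ t ∈ Icc a b, ‖v t‖ ^ 2 ≤ gronwallBound (‖v a‖ ^ 2) (2 * μ) 0 (t - a) := by
    refine le_gronwallBound_of_liminf_deriv_right_le (f' := fun t => 2 * μ * ‖v t‖ ^ 2)
      (hv.norm.pow 2) (fun t ht c hc => ?_) le_rfl fun t _ => by simp
    obtain ⟨J, h, h1, h2, h3⟩ := hJ t ht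
    have hexp : Tendsto (fun r : ℝ => r⁻¹ * (Real.exp (2 * μ * r) - 1)) (𝓝[>] 0)
        (𝓝 (2 * μ)) := by
      have hd : HasDerivAt (fun r : ℝ => Real.exp (2 * μ * r)) (2 * μ) 0 := by
        have := ((hasDerivAt_id (0 : ℝ)).const_mul (2 * μ)).exp
        simpa using this
      have := (hasDerivAt_iff_tendsto_slope.mp hd).mono_left
        (nhdsWithin_mono 0 (fun x (hx : x ∈ Ioi 0) => ne_of_gt hx))
      refine this.congr fun r => ?_
      simp [slope_def_field, div_eq_inv_mul]
    have hlim : Tendsto (fun r : ℝ => r⁻¹ * (Real.exp (2 * μ * r) - 1) * ‖v t‖ ^ 2 +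
        (2 * inner ℝ (S r (v t)) (r⁻¹ • J r) + r * ‖r⁻¹ • J r‖ ^ 2)) (𝓝[>] 0)
        (𝓝 (2 * μ * ‖v t‖ ^ 2)) := by
      have e1 := hexp.mul_const (‖v t‖ ^ 2)
      have e2 := ((hS0 (v t)).inner (𝕜 := ℝ) h2).const_mul 2
      have e3 : Tendsto (fun r : ℝ => r * ‖r⁻¹ • J r‖ ^ 2) (𝓝[>] 0) (𝓝 (0 * ‖h‖ ^ 2)) :=
        (tendsto_id.mono_left nhdsWithin_le_nhds).mul (h2.norm.pow 2)
      have := e1.add (e2.add e3)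
      rw [h3] at this
      simpa using this
    have hev : ∀ᶠ r in 𝓝[>] (0 : ℝ), r⁻¹ * (‖v (t + r)‖ ^ 2 - ‖v t‖ ^ 2) < c := by
      filter_upwards [hlim.eventually_lt_const hc, h1, self_mem_nhdsWithin] with r hr hr1 hr0
      rw [mem_Ioi] at hr0
      refine lt_of_le_of_lt ?_ hr
      have hJr : J r = r • (r⁻¹ • J r) := by rw [smul_smul, mul_inv_cancel₀ hr0.ne', one_smul]
      set y := r⁻¹ • J r with hy
      have h4 : ‖S r (v t)‖ ^ 2 ≤ Real.exp (2 * μ * r) * ‖v t‖ ^ 2 := by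
        have := pow_le_pow_left₀ (norm_nonneg _) (hS r hr0.le (v t)) 2
        rwa [mul_pow, ← Real.exp_nat_mul, Nat.cast_two, ← mul_assoc] at this
      rw [hr1, hJr, norm_add_sq_real, inner_smul_right, norm_smul, Real.norm_eq_abs,
        abs_of_pos hr0]
      calc r⁻¹ * (‖S r (v t)‖ ^ 2 + 2 * (r * inner ℝ (S r (v t)) y) + (r * ‖y‖) ^ 2 - ‖v t‖ ^ 2)
          ≤ r⁻¹ * (Real.exp (2 * μ * r) * ‖v t‖ ^ 2 + 2 * (r * inner ℝ (S r (v t)) y) +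
            (r * ‖y‖) ^ 2 - ‖v t‖ ^ 2) := by gcongr
        _ = _ := by
          linear_combination (2 * inner ℝ (S r (v t)) y + r * ‖y‖ ^ 2) * inv_mul_cancel₀ hr0.ne'
    have hshift : Tendsto (fun x : ℝ => x - t) (𝓝[>] t) (𝓝[>] 0) := by
      refine tendsto_nhdsWithin_iff.mpr ⟨?_, ?_⟩
      · have : Tendsto (fun x : ℝ => x - t) (𝓝 t) (𝓝 (t - t)) := tendsto_id.sub_const t
        rw [sub_self] at this
        exact this.mono_left nhdsWithin_le_nhds
      · filter_upwards [self_mem_nhdsWithin] with x hx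
        exact sub_pos.mpr (mem_Ioi.mp hx)
    refine (hshift.eventually hev).frequently.mono fun x hx => ?_
    simpa using hx
  intro t ht
  have h := key t ht
  rw [gronwallBound_ε0] at h
  refine le_of_sq_le_sq (a := ‖v t‖) ?_ (by positivity)
  rw [mul_pow, ← Real.exp_nat_mul]
  refine h.trans (le_of_eq ?_)
  rw [mul_comm]
  congr 2
  push_cast; ring

/-! ### Multiplication operators on `L²` -/

theorem l2_norm_sq (f : L2) : ‖f‖ ^ 2 = ∫ ξ, ‖f ξ‖ ^ 2 := by
  rw [← real_inner_self_eq_norm_sq, L2.inner_def]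
  simp

theorem l2_integrable_sq (f : L2) : Integrable fun ξ => ‖f ξ‖ ^ 2 :=
  (memLp_two_iff_integrable_sq_norm (Lp.memLp f).1).mp (Lp.memLp f)

open Classical in
/-- Multiplication by a bounded measurable function on `L²` (and `0` for other functions). -/
def mulOp (m : ℝ → ℂ) : L2 →L[ℝ] L2 :=
  if h : MemLp m ∞ volume then
    (ContinuousLinearMap.mul ℝ ℂ).holderL (volume : Measure ℝ) ∞ 2 2 (h.toLp m)
  else 0

/-- `m` is a measurable function bounded by `C`. -/
structure IsSymbol (m : ℝ → ℂ) (C : ℝ) : Prop where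
  measurable : Measurable m
  norm_le : ∀ ξ, ‖m ξ‖ ≤ C

namespace IsSymbol

variable {m m' : ℝ → ℂ} {C C' : ℝ}

theorem memLp (h : IsSymbol m C) : MemLp m ∞ volume :=
  memLp_top_of_bound h.1.aestronglyMeasurable C (Eventually.of_forall h.2)

theorem nonneg (h : IsSymbol m C) : 0 ≤ C := (norm_nonneg _).trans (h.2 0)

theorem mul (h : IsSymbol m C) (h' : IsSymbol m' C') : IsSymbol (fun ξ => m ξ * m' ξ) (C * C') :=
  ⟨h.1.mul h'.1, fun ξ => by
    rw [norm_mul]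
    exact mul_le_mul (h.2 ξ) (h'.2 ξ) (norm_nonneg _) h.nonneg⟩

theorem coe_mulOp (h : IsSymbol m C) (f : L2) : mulOp m f =ᵐ[volume] fun ξ => m ξ * f ξ := by
  rw [mulOp, dif_pos h.memLp]
  filter_upwards [(ContinuousLinearMap.mul ℝ ℂ).coeFn_holder (r := 2) (h.memLp.toLp m) f,
    h.memLp.coeFn_toLp] with ξ h1 h2
  change ((ContinuousLinearMap.mul ℝ ℂ).holder 2 (h.memLp.toLp m) f : L2) ξ = _
  rw [h1, h2]
  rfl

theorem norm_mulOp_le (h : IsSymbol m C) (f : L2) : ‖mulOp m f‖ ≤ C * ‖f‖ := by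
  refine Lp.norm_le_mul_norm_of_ae_le_mul ?_
  filter_upwards [h.coe_mulOp f] with ξ h1
  rw [h1, norm_mul]
  gcongr
  exact h.2 ξ

theorem mulOp_mulOp (h : IsSymbol m C) (h' : IsSymbol m' C') (f : L2) :
    mulOp m (mulOp m' f) = mulOp (fun ξ => m ξ * m' ξ) f := by
  ext1
  filter_upwards [h.coe_mulOp (mulOp m' f), h'.coe_mulOp f, (h.mul h').coe_mulOp f] with ξ h1 h2 h3
  rw [h1, h2, h3, mul_assoc]

theorem mulOp_comm (h : IsSymbol m C) (h' : IsSymbol m' C') (f : L2) :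
    mulOp m (mulOp m' f) = mulOp m' (mulOp m f) := by
  rw [h.mulOp_mulOp h', h'.mulOp_mulOp h]
  simp_rw [mul_comm]

end IsSymbol

theorem isSymbol_one : IsSymbol (fun _ => 1) 1 := ⟨measurable_const, by simp⟩

theorem mulOp_one (f : L2) : mulOp (fun _ => 1) f = f := by
  ext1
  filter_upwards [isSymbol_one.coe_mulOp f] with ξ h
  rw [h, one_mul]

/-- Bounded pointwise convergence of symbols implies strong convergence of the multiplication
operators. -/
theorem tendsto_mulOp {X : Type*} {l : Filter X} [l.IsCountablyGenerated] {m : X → ℝ → ℂ}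
    {m₀ : ℝ → ℂ} {C : ℝ} (hm : ∀ᶠ x in l, IsSymbol (m x) C) (hm₀ : IsSymbol m₀ C)
    (hlim : ∀ᵐ ξ, Tendsto (fun x => m x ξ) l (𝓝 (m₀ ξ))) (f : L2) :
    Tendsto (fun x => mulOp (m x) f) l (𝓝 (mulOp m₀ f)) := by
  rw [tendsto_iff_norm_sub_tendsto_zero]
  have hsq : Tendsto (fun x => ∫ ξ, ‖m x ξ * f ξ - m₀ ξ * f ξ‖ ^ 2) l (𝓝 (∫ _ : ℝ, (0 : ℝ))) := by
    have hf := (Lp.aestronglyMeasurable f)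
    refine tendsto_integral_filter_of_dominated_convergence (fun ξ => (2 * C) ^ 2 * ‖f ξ‖ ^ 2) ?_ ?_
      ((l2_integrable_sq f).const_mul _) ?_
    · filter_upwards [hm] with x hx
      exact (((hx.1.aestronglyMeasurable.mul hf).sub
        (hm₀.1.aestronglyMeasurable.mul hf)).norm.pow 2)
    · filter_upwards [hm] with x hx
      refine Eventually.of_forall fun ξ => ?_
      rw [Real.norm_eq_abs, abs_of_nonneg (by positivity), ← mul_pow, ← sub_mul, norm_mul]
      gcongr
      refine (norm_sub_le _ _).trans ?_
      linarith [hx.2 ξ, hm₀.2 ξ]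
    · filter_upwards [hlim] with ξ hξ
      have h1 : Tendsto (fun x => m x ξ * f ξ - m₀ ξ * f ξ) l (𝓝 0) := by
        simpa using (hξ.mul_const (f ξ)).sub_const (m₀ ξ * f ξ)
      simpa using h1.norm.pow 2
  rw [integral_zero] at hsq
  have h2 := hsq.sqrt
  rw [Real.sqrt_zero] at h2
  refine h2.congr' ?_
  filter_upwards [hm] with x hx
  rw [← Real.sqrt_sq (norm_nonneg (mulOp (m x) f - mulOp m₀ f)), l2_norm_sq]
  congr 1
  refine integral_congr_ae ?_
  filter_upwards [Lp.coeFn_sub (mulOp (m x) f) (mulOp m₀ f), hx.coe_mulOp f, hm₀.coe_mulOp f]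
    with ξ h3 h4 h5
  rw [h3, Pi.sub_apply, h4, h5]

/-- The space of bounded continuous functions of the frequency. -/
abbrev BCF : Type := ℝ →ᵇ ℂ

theorem isSymbol_bcf (y : BCF) : IsSymbol y ‖y‖ :=
  ⟨y.continuous.measurable, y.norm_coe_le_norm⟩

/-- Multiplication of square integrable functions by bounded continuous functions. -/
def bcfMul : BCF →L[ℝ] L2 →L[ℝ] L2 :=
  LinearMap.mkContinuous₂
    (LinearMap.mk₂ ℝ (fun y f => mulOp y f)
      (fun y y' f => by
        ext1
        filter_upwards [(isSymbol_bcf (y + y')).coe_mulOp f, (isSymbol_bcf y).coe_mulOp f,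
          (isSymbol_bcf y').coe_mulOp f, Lp.coeFn_add (mulOp y f) (mulOp y' f)] with ξ h1 h2 h3 h4
        rw [h1, h4, Pi.add_apply, h2, h3, BoundedContinuousFunction.add_apply, add_mul])
      (fun r y f => by
        ext1
        filter_upwards [(isSymbol_bcf (r • y)).coe_mulOp f, (isSymbol_bcf y).coe_mulOp f,
          Lp.coeFn_smul r (mulOp y f)] with ξ h1 h2 h3
        rw [h1, h3, Pi.smul_apply, h2, BoundedContinuousFunction.smul_apply, smul_mul_assoc])
      (fun y f f' => map_add _ _ _) (fun r y f => map_smul _ _ _))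
    1 fun y f => by
      rw [one_mul]
      exact (isSymbol_bcf y).norm_mulOp_le f

theorem bcfMul_apply (y : BCF) (f : L2) : bcfMul y f = mulOp y f := rfl

theorem norm_bcfMul_flip_le (f : L2) : ‖bcfMul.flip f‖ ≤ ‖f‖ :=
  ContinuousLinearMap.opNorm_le_bound _ (norm_nonneg _) fun y => by
    rw [mul_comm]
    exact (isSymbol_bcf y).norm_mulOp_le f

open Classical in
/-- The class in `L²` of a square integrable function (and `0` for other functions). -/
def toL2 (m : ℝ → ℂ) : L2 := if h : MemLp m 2 volume then h.toLp m else 0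

theorem coe_toL2 {m : ℝ → ℂ} (h : MemLp m 2 volume) : toL2 m =ᵐ[volume] m := by
  rw [toL2, dif_pos h]
  exact h.coeFn_toLp

/-! ### Conjugation followed by reflection -/

/-- The map `f ↦ conj (f (-ξ))`, which corresponds to complex conjugation under the Fourier
transform. -/
def conjRefl : L2 →L[ℝ] L2 :=
  ((Complex.conjCLE : ℂ →L[ℝ] ℂ).compLpL 2 volume).comp
    (Lp.compMeasurePreservingₗᵢ ℝ (fun ξ : ℝ => -ξ)
      (Measure.measurePreserving_neg volume)).toContinuousLinearMap

theorem ae_neg {P : ℝ → Prop} (h : ∀ᵐ ξ : ℝ, P ξ) : ∀ᵐ ξ : ℝ, P (-ξ) :=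
  (Measure.measurePreserving_neg (volume : Measure ℝ)).quasiMeasurePreserving.ae h

theorem coe_conjRefl (f : L2) : conjRefl f =ᵐ[volume] fun ξ => (starRingEnd ℂ) (f (-ξ)) := by
  filter_upwards [(Complex.conjCLE : ℂ →L[ℝ] ℂ).coeFn_compLpL (p := 2)
    (Lp.compMeasurePreserving (fun ξ : ℝ => -ξ) (Measure.measurePreserving_neg volume) f),
    Lp.coeFn_compMeasurePreserving f (Measure.measurePreserving_neg volume)] with ξ h1 h2
  change ((Complex.conjCLE : ℂ →L[ℝ] ℂ).compLpL 2 volume _ : L2) ξ = _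
  refine h1.trans ?_
  rw [h2]
  rfl

theorem conjRefl_conjRefl (f : L2) : conjRefl (conjRefl f) = f := by
  ext1
  filter_upwards [coe_conjRefl (conjRefl f), ae_neg (coe_conjRefl f)] with ξ h1 h2
  rw [h1, h2, neg_neg, Complex.conj_conj]

theorem norm_conjRefl (f : L2) : ‖conjRefl f‖ = ‖f‖ := by
  have h : ∀ g : L2, ‖conjRefl g‖ ≤ ‖g‖ := fun g => by
    have h1 : ‖conjRefl g‖ ≤ 1 * ‖Lp.compMeasurePreserving (fun ξ : ℝ => -ξ)
        (Measure.measurePreserving_neg volume) g‖ := by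
      refine Lp.norm_le_mul_norm_of_ae_le_mul ?_
      filter_upwards [coe_conjRefl g,
        Lp.coeFn_compMeasurePreserving g (Measure.measurePreserving_neg volume)] with ξ h1 h2
      rw [h1, h2]
      simp
    rwa [one_mul, Lp.norm_compMeasurePreserving] at h1
  refine le_antisymm (h f) ?_
  conv_lhs => rw [← conjRefl_conjRefl f]
  exact h _

theorem conjRefl_mulOp {m m' : ℝ → ℂ} {C C' : ℝ} (h : IsSymbol m C) (h' : IsSymbol m' C')
    (hmm : ∀ ξ, m' ξ = (starRingEnd ℂ) (m (-ξ))) (f : L2) :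
    conjRefl (mulOp m f) = mulOp m' (conjRefl f) := by
  ext1
  filter_upwards [coe_conjRefl (mulOp m f), ae_neg (h.coe_mulOp f), h'.coe_mulOp (conjRefl f),
    coe_conjRefl f] with ξ h1 h2 h3 h4
  rw [h1, h2, h3, h4, hmm, map_mul]

/-- The map `y ↦ conj (y (-ξ))` on bounded continuous functions. -/
def bcfConjRefl (y : BCF) : BCF :=
  BoundedContinuousFunction.ofNormedAddCommGroup (fun ξ => (starRingEnd ℂ) (y (-ξ)))
    (Complex.continuous_conj.comp (y.continuous.comp continuous_neg)) ‖y‖ fun ξ => by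
      rw [RCLike.norm_conj]
      exact y.norm_coe_le_norm _

@[simp] theorem bcfConjRefl_apply (y : BCF) (ξ : ℝ) :
    bcfConjRefl y ξ = (starRingEnd ℂ) (y (-ξ)) := rfl

/-! ### Fourier symbols -/

/-- The symbol `(1 + ξ²) ^ (r / 2)` of the Bessel potential. -/
def japan (r ξ : ℝ) : ℝ := (1 + ξ ^ 2) ^ (r / 2)

theorem one_le_one_add_sq (ξ : ℝ) : 1 ≤ 1 + ξ ^ 2 := le_add_of_nonneg_right (sq_nonneg ξ)

theorem japan_pos (r ξ : ℝ) : 0 < japan r ξ := Real.rpow_pos_of_pos (by positivity) _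

theorem continuous_japan (r : ℝ) : Continuous (japan r) := by
  refine Continuous.rpow_const (by fun_prop) fun ξ => Or.inl ?_
  positivity

@[fun_prop] theorem measurable_japan (r : ℝ) : Measurable (japan r) := (continuous_japan r).measurable

theorem japan_add (r r' ξ : ℝ) : japan (r + r') ξ = japan r ξ * japan r' ξ := by
  rw [japan, japan, japan, ← Real.rpow_add (by positivity), add_div]

theorem japan_zero (ξ : ℝ) : japan 0 ξ = 1 := by simp [japan]

theorem japan_neg_mul (r ξ : ℝ) : japan (-r) ξ * japan r ξ = 1 := by
  rw [← japan_add, neg_add_cancel, japan_zero]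

theorem japan_even (r ξ : ℝ) : japan r (-ξ) = japan r ξ := by simp [japan]

theorem japan_le_one {r : ℝ} (hr : r ≤ 0) (ξ : ℝ) : japan r ξ ≤ 1 :=
  Real.rpow_le_one_of_one_le_of_nonpos (one_le_one_add_sq ξ) (by linarith)

theorem japan_mono {r r' : ℝ} (h : r ≤ r') (ξ : ℝ) : japan r ξ ≤ japan r' ξ :=
  Real.rpow_le_rpow_of_exponent_le (one_le_one_add_sq ξ) (by linarith)

theorem abs_rpow_le_japan {r : ℝ} (hr : 0 ≤ r) (ξ : ℝ) : |ξ| ^ r ≤ japan r ξ := by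
  have h : |ξ| ^ r = (ξ ^ 2) ^ (r / 2) := by
    rw [← sq_abs, ← Real.rpow_natCast, ← Real.rpow_mul (abs_nonneg ξ)]
    congr 1
    push_cast; ring
  rw [h, japan]
  exact Real.rpow_le_rpow (sq_nonneg ξ) (by linarith) (by linarith)

theorem abs_le_japan_one (ξ : ℝ) : |ξ| ≤ japan 1 ξ := by
  simpa using abs_rpow_le_japan zero_le_one ξ

theorem isSymbol_japan {r : ℝ} (hr : r ≤ 0) : IsSymbol (fun ξ => (japan r ξ : ℂ)) 1 :=
  ⟨by fun_prop, fun ξ => by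
    rw [Complex.norm_real, Real.norm_eq_abs, abs_of_pos (japan_pos r ξ)]
    exact japan_le_one hr ξ⟩

/-- The symbol `2 π i ξ` of the derivative. -/
def dSymb (ξ : ℝ) : ℂ := 2 * Real.pi * Complex.I * ξ

@[fun_prop] theorem continuous_dSymb : Continuous dSymb := by unfold dSymb; fun_prop

@[fun_prop] theorem measurable_dSymb : Measurable dSymb := continuous_dSymb.measurable

theorem norm_dSymb (ξ : ℝ) : ‖dSymb ξ‖ = 2 * Real.pi * |ξ| := by
  simp [dSymb, abs_of_pos Real.pi_pos]

theorem dSymb_conj (ξ : ℝ) : dSymb ξ = (starRingEnd ℂ) (dSymb (-ξ)) := by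
  simp [dSymb, Complex.conj_ofNat]

theorem isSymbol_dSymb_japan {r : ℝ} (hr : r ≤ -1) :
    IsSymbol (fun ξ => dSymb ξ * japan r ξ) (2 * Real.pi) :=
  ⟨by fun_prop, fun ξ => by
    rw [norm_mul, norm_dSymb, Complex.norm_real, Real.norm_eq_abs, abs_of_pos (japan_pos r ξ),
      mul_assoc]
    refine mul_le_of_le_one_right (by positivity) ?_
    calc |ξ| * japan r ξ ≤ japan 1 ξ * japan (-1) ξ := by
          gcongr
          · exact (japan_pos _ _).le
          · exact (japan_pos _ _).le
          · exact abs_le_japan_one ξ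
          · exact japan_mono hr ξ
      _ = 1 := by rw [mul_comm, japan_neg_mul]⟩

/-- The symbol `-(2πξ)² + μ (1 + (2πξ)²) ^ (-1/2)` of the linear part of the equation. -/
def linSymb (μ ξ : ℝ) : ℝ :=
  -(2 * Real.pi * ξ) ^ 2 + μ * (1 + (2 * Real.pi * ξ) ^ 2) ^ (-1 / 2 : ℝ)

theorem continuous_linSymb (μ : ℝ) : Continuous (linSymb μ) := by
  unfold linSymb
  refine Continuous.add (by fun_prop) (continuous_const.mul
    (Continuous.rpow_const (by fun_prop) fun ξ => Or.inl (by positivity)))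

@[fun_prop] theorem measurable_linSymb (μ : ℝ) : Measurable (linSymb μ) :=
  (continuous_linSymb μ).measurable

theorem linSymb_even (μ ξ : ℝ) : linSymb μ (-ξ) = linSymb μ ξ := by simp [linSymb]

section Heat

variable {μ : ℝ}

theorem linSymb_le (hμ : 0 < μ) (ξ : ℝ) : linSymb μ ξ ≤ -(2 * Real.pi * ξ) ^ 2 + μ := by
  unfold linSymb
  gcongr
  refine mul_le_of_le_one_right hμ.le (Real.rpow_le_one_of_one_le_of_nonpos ?_ (by norm_num))
  exact one_le_one_add_sq _

/-- The symbol of the semigroup generated by the linear part of the equation. -/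
def heatSymb (μ t ξ : ℝ) : ℂ := (Real.exp (t * linSymb μ ξ) : ℝ)

@[fun_prop] theorem measurable_heatSymb (μ t : ℝ) : Measurable (heatSymb μ t) := by
  unfold heatSymb; fun_prop

theorem norm_heatSymb (μ t ξ : ℝ) : ‖heatSymb μ t ξ‖ = Real.exp (t * linSymb μ ξ) := by
  rw [heatSymb, Complex.norm_real, Real.norm_eq_abs, Real.abs_exp]

theorem heatSymb_add (μ t r ξ : ℝ) : heatSymb μ (t + r) ξ = heatSymb μ r ξ * heatSymb μ t ξ := by
  rw [heatSymb, heatSymb, heatSymb, ← Complex.ofReal_mul, ← Real.exp_add]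
  congr 2; ring

theorem heatSymb_conj (μ t ξ : ℝ) : heatSymb μ t ξ = (starRingEnd ℂ) (heatSymb μ t (-ξ)) := by
  rw [heatSymb, heatSymb, linSymb_even, Complex.conj_ofReal]

theorem isSymbol_heatSymb (hμ : 0 < μ) {t : ℝ} (ht : 0 ≤ t) :
    IsSymbol (heatSymb μ t) (Real.exp (μ * t)) :=
  ⟨by fun_prop, fun ξ => by
    rw [norm_heatSymb, mul_comm μ]
    gcongr
    exact (linSymb_le hμ ξ).trans (by nlinarith [sq_nonneg (2 * Real.pi * ξ)])⟩

theorem continuous_heatSymb (μ ξ : ℝ) : Continuous fun t => heatSymb μ t ξ := by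
  unfold heatSymb; fun_prop

/-- The semigroup generated by the linear part of the equation, on the Fourier side. -/
def heat (μ t : ℝ) : L2 →L[ℝ] L2 := mulOp (heatSymb μ t)

theorem heat_zero (μ : ℝ) (f : L2) : heat μ 0 f = f := by
  have h : heatSymb μ 0 = fun _ => 1 := by ext ξ; simp [heatSymb]
  rw [heat, h, mulOp_one]

theorem norm_heat_le (hμ : 0 < μ) {t : ℝ} (ht : 0 ≤ t) (f : L2) :
    ‖heat μ t f‖ ≤ Real.exp (μ * t) * ‖f‖ := (isSymbol_heatSymb hμ ht).norm_mulOp_le f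

theorem heat_add (hμ : 0 < μ) {t r : ℝ} (ht : 0 ≤ t) (hr : 0 ≤ r) (f : L2) :
    heat μ (t + r) f = heat μ r (heat μ t f) := by
  rw [heat, heat, heat, (isSymbol_heatSymb hμ hr).mulOp_mulOp (isSymbol_heatSymb hμ ht)]
  congr 2
  ext ξ
  exact heatSymb_add μ t r ξ

theorem continuousOn_heat (hμ : 0 < μ) (f : L2) : ContinuousOn (fun t => heat μ t f) (Ici 0) := by
  intro t₀ ht₀
  rw [mem_Ici] at ht₀
  refine tendsto_mulOp (C := Real.exp (μ * (t₀ + 1))) ?_ ?_ ?_ f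
  · have h : ∀ᶠ t in 𝓝[Ici 0] t₀, t < t₀ + 1 :=
      nhdsWithin_le_nhds (Iio_mem_nhds (by linarith))
    filter_upwards [h, self_mem_nhdsWithin] with t h1 h2
    exact ⟨by fun_prop, fun ξ => ((isSymbol_heatSymb hμ h2).2 ξ).trans (by gcongr)⟩
  · exact ⟨by fun_prop, fun ξ => ((isSymbol_heatSymb hμ ht₀).2 ξ).trans (by gcongr; linarith)⟩
  · exact Eventually.of_forall fun ξ => (continuous_heatSymb μ ξ).continuousAt.continuousWithinAt

/-! ### Smoothing estimates -/

theorem integral_abs_rpow_mul_exp {q t : ℝ} (hq : 0 ≤ q) (ht : 0 < t) :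
    ∫ ξ : ℝ, |ξ| ^ q * Real.exp (-t * ξ ^ 2) =
      t ^ (-(q + 1) / 2) * Real.Gamma ((q + 1) / 2) := by
  have h := integral_comp_abs (f := fun x : ℝ => x ^ q * Real.exp (-t * x ^ 2))
  simp only [sq_abs] at h
  have h2 := integral_rpow_mul_exp_neg_mul_rpow (p := 2) (q := q) two_pos (by linarith) ht
  simp only [Real.rpow_ofNat] at h2
  rw [h, h2]
  ring

theorem integrable_abs_rpow_mul_exp {q t : ℝ} (hq : 0 ≤ q) (ht : 0 < t) :
    Integrable fun ξ : ℝ => |ξ| ^ q * Real.exp (-t * ξ ^ 2) := by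
  refine Integrable.of_integral_ne_zero ?_
  rw [integral_abs_rpow_mul_exp hq ht]
  have h := Real.Gamma_pos_of_pos (s := (q + 1) / 2) (by linarith)
  positivity

end Heat

section Smoothing

variable {μ T ρ : ℝ}

theorem japan_sq_le (hρ0 : 0 ≤ ρ) (hρ1 : ρ ≤ 1) (ξ : ℝ) :
    japan ρ ξ ^ 2 ≤ 1 + |ξ| ^ (2 * ρ) := by
  have h1 : japan ρ ξ ^ 2 = (1 + ξ ^ 2) ^ ρ := by
    rw [japan, ← Real.rpow_natCast, ← Real.rpow_mul (by positivity)]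
    congr 1
    push_cast; ring
  have h2 : |ξ| ^ (2 * ρ) = (ξ ^ 2) ^ ρ := by
    rw [Real.rpow_mul (abs_nonneg ξ), Real.rpow_two, sq_abs]
  rw [h1, h2]
  simpa using Real.rpow_add_le_add_rpow zero_le_one (sq_nonneg ξ) hρ0 hρ1

/-- The function `(1 + ξ²) ^ (ρ / 2) exp (t p(ξ))`, where `p` is the symbol of the linear part. It is
square integrable for `t > 0`. -/
def kvec (μ ρ t : ℝ) : L2 := toL2 fun ξ => japan ρ ξ * heatSymb μ t ξ

theorem norm_sq_kernel_le (hμ : 0 < μ) (hρ0 : 0 ≤ ρ) (hρ1 : ρ ≤ 1) {t : ℝ} (ht : t ∈ Ioc 0 T)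
    (ξ : ℝ) : ‖(japan ρ ξ : ℂ) * heatSymb μ t ξ‖ ^ 2 ≤
      Real.exp (2 * μ * T) * (|ξ| ^ (0 : ℝ) * Real.exp (-t * ξ ^ 2) +
        |ξ| ^ (2 * ρ) * Real.exp (-t * ξ ^ 2)) := by
  rw [norm_mul, mul_pow, norm_heatSymb, Complex.norm_real, Real.norm_eq_abs, sq_abs,
    Real.rpow_zero, ← add_mul, ← Real.exp_nat_mul]
  have h1 : ((2 : ℕ) : ℝ) * (t * linSymb μ ξ) ≤ 2 * μ * T + -t * ξ ^ 2 := by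
    have h2 := mul_le_mul_of_nonneg_left (linSymb_le hμ ξ) ht.1.le
    have h3 : ξ ^ 2 ≤ (2 * Real.pi * ξ) ^ 2 := by
      rw [mul_pow]
      refine le_mul_of_one_le_left (sq_nonneg ξ) ?_
      nlinarith [Real.pi_gt_three]
    have h4 := mul_le_mul_of_nonneg_left h3 ht.1.le
    have h5 := mul_le_mul_of_nonneg_left ht.2 hμ.le
    have h6 := mul_nonneg ht.1.le (sq_nonneg ξ)
    push_cast
    nlinarith
  calc japan ρ ξ ^ 2 * Real.exp (((2 : ℕ) : ℝ) * (t * linSymb μ ξ))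
      ≤ (1 + |ξ| ^ (2 * ρ)) * Real.exp (2 * μ * T + -t * ξ ^ 2) := by
        gcongr
        exact japan_sq_le hρ0 hρ1 ξ
    _ = _ := by rw [Real.exp_add]; ring

theorem integrable_kernel_bound (hρ0 : 0 ≤ ρ) {t : ℝ} (ht : 0 < t) :
    Integrable fun ξ : ℝ => Real.exp (2 * μ * T) * (|ξ| ^ (0 : ℝ) * Real.exp (-t * ξ ^ 2) +
        |ξ| ^ (2 * ρ) * Real.exp (-t * ξ ^ 2)) :=
  ((integrable_abs_rpow_mul_exp le_rfl ht).add
    (integrable_abs_rpow_mul_exp (by linarith) ht)).const_mul _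

theorem memLp_kernel (hμ : 0 < μ) (hρ0 : 0 ≤ ρ) (hρ1 : ρ ≤ 1) {t : ℝ} (ht : 0 < t) :
    MemLp (fun ξ => (japan ρ ξ : ℂ) * heatSymb μ t ξ) 2 volume := by
  have hm : Measurable fun ξ => (japan ρ ξ : ℂ) * heatSymb μ t ξ := by fun_prop
  rw [memLp_two_iff_integrable_sq_norm hm.aestronglyMeasurable]
  refine (integrable_kernel_bound (μ := μ) (T := t) hρ0 ht).mono'
    (hm.norm.pow_const 2).aestronglyMeasurable (Eventually.of_forall fun ξ => ?_)
  rw [Real.norm_eq_abs, abs_of_nonneg (by positivity)]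
  exact norm_sq_kernel_le hμ hρ0 hρ1 ⟨ht, le_rfl⟩ ξ

theorem coe_kvec (hμ : 0 < μ) (hρ0 : 0 ≤ ρ) (hρ1 : ρ ≤ 1) {t : ℝ} (ht : 0 < t) :
    kvec μ ρ t =ᵐ[volume] fun ξ => (japan ρ ξ : ℂ) * heatSymb μ t ξ :=
  coe_toL2 (memLp_kernel hμ hρ0 hρ1 ht)

/-- The constant in the bound of `kvec`. -/
def kvecConst (μ T ρ : ℝ) : ℝ :=
  Real.exp (μ * T) * √(T ^ ρ * Real.Gamma (1 / 2) + Real.Gamma (ρ + 1 / 2))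

/-- A bounded function times `(1 + ξ²) ^ (ρ / 2) exp (t p(ξ))` lies in `L²`, at the cost of
`t ^ (-(ρ / 2 + 1 / 4))`: the power `1 / 4` is the price of integrability over the line. -/
theorem norm_kvec_le (hμ : 0 < μ) (hρ0 : 0 ≤ ρ) (hρ1 : ρ ≤ 1) {t : ℝ} (ht : t ∈ Ioc 0 T) :
    ‖kvec μ ρ t‖ ≤ kvecConst μ T ρ * t ^ (-(ρ / 2 + 1 / 4)) := by
  have hT : 0 < T := ht.1.trans_le ht.2
  have hG1 := Real.Gamma_pos_of_pos (s := 1 / 2) (by norm_num)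
  have hG2 := Real.Gamma_pos_of_pos (s := ρ + 1 / 2) (by linarith)
  have ht' : 0 < t ^ (-(ρ / 2 + 1 / 4)) := Real.rpow_pos_of_pos ht.1 _
  have hTρ := Real.rpow_pos_of_pos hT ρ
  refine le_of_sq_le_sq ?_ (by unfold kvecConst; positivity)
  have h1 : ‖kvec μ ρ t‖ ^ 2 ≤ Real.exp (2 * μ * T) *
      (t ^ (-(1 / 2) : ℝ) * Real.Gamma (1 / 2) +
        t ^ (-(ρ + 1 / 2)) * Real.Gamma (ρ + 1 / 2)) := by
    rw [l2_norm_sq]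
    have h2 : ∫ ξ, ‖kvec μ ρ t ξ‖ ^ 2 ≤ ∫ ξ : ℝ, Real.exp (2 * μ * T) *
        (|ξ| ^ (0 : ℝ) * Real.exp (-t * ξ ^ 2) + |ξ| ^ (2 * ρ) * Real.exp (-t * ξ ^ 2)) := by
      refine integral_mono_ae (l2_integrable_sq _) (integrable_kernel_bound hρ0 ht.1) ?_
      filter_upwards [coe_kvec hμ hρ0 hρ1 ht.1] with ξ h
      rw [h]
      exact norm_sq_kernel_le hμ hρ0 hρ1 ht ξ
    refine h2.trans (le_of_eq ?_)
    rw [integral_const_mul, integral_add (integrable_abs_rpow_mul_exp le_rfl ht.1)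
      (integrable_abs_rpow_mul_exp (by linarith) ht.1),
      integral_abs_rpow_mul_exp le_rfl ht.1, integral_abs_rpow_mul_exp (by linarith) ht.1]
    congr 3 <;> congr 1 <;> ring
  refine h1.trans ?_
  have h3 : t ^ (-(1 / 2) : ℝ) ≤ T ^ ρ * t ^ (-(ρ + 1 / 2)) := by
    have h4 : t ^ (-(1 / 2) : ℝ) = t ^ ρ * t ^ (-(ρ + 1 / 2)) := by
      rw [← Real.rpow_add ht.1]; congr 1; ring
    rw [h4]
    have := Real.rpow_pos_of_pos ht.1 (-(ρ + 1 / 2))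
    gcongr
    exacts [ht.1.le, ht.2]
  have h5 : (t ^ (-(ρ / 2 + 1 / 4))) ^ 2 = t ^ (-(ρ + 1 / 2)) := by
    rw [← Real.rpow_natCast, ← Real.rpow_mul ht.1.le]
    congr 1
    push_cast; ring
  have h6 : Real.exp (2 * μ * T) = Real.exp (μ * T) ^ 2 := by
    rw [← Real.exp_nat_mul]; congr 1; push_cast; ring
  rw [mul_pow, h5, kvecConst, mul_pow, Real.sq_sqrt (by positivity), h6, mul_assoc]
  gcongr
  calc _ ≤ T ^ ρ * t ^ (-(ρ + 1 / 2)) * Real.Gamma (1 / 2) +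
        t ^ (-(ρ + 1 / 2)) * Real.Gamma (ρ + 1 / 2) := by gcongr
    _ = _ := by ring

theorem heat_kvec (hμ : 0 < μ) (hρ0 : 0 ≤ ρ) (hρ1 : ρ ≤ 1) {t r : ℝ} (ht : 0 < t) (hr : 0 ≤ r) :
    kvec μ ρ (t + r) = heat μ r (kvec μ ρ t) := by
  ext1
  filter_upwards [coe_kvec hμ hρ0 hρ1 ht, coe_kvec hμ hρ0 hρ1 (t := t + r) (by linarith),
    (isSymbol_heatSymb hμ hr).coe_mulOp (kvec μ ρ t)] with ξ h1 h2 h3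
  rw [h2, heat, h3, h1, heatSymb_add]
  ring

/-- For `t` near `t₀`, the semigroup carries `kvec` from the time `t₀ / 2` to the time `t`, so its strong
continuity suffices. -/
theorem continuousOn_kvec (hμ : 0 < μ) (hρ0 : 0 ≤ ρ) (hρ1 : ρ ≤ 1) :
    ContinuousOn (kvec μ ρ) (Ioi 0) := by
  intro t₀ ht₀
  rw [mem_Ioi] at ht₀
  have h1 : ContinuousAt (fun t => heat μ (t - t₀ / 2) (kvec μ ρ (t₀ / 2))) t₀ := by
    have h2 := (continuousOn_heat hμ (kvec μ ρ (t₀ / 2))).continuousAt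
      (Ici_mem_nhds (show 0 < t₀ - t₀ / 2 by linarith))
    exact ContinuousAt.comp (f := fun t => t - t₀ / 2) h2 (by fun_prop)
  refine (h1.congr ?_).continuousWithinAt
  filter_upwards [Ioi_mem_nhds (show t₀ / 2 < t₀ by linarith)] with t ht
  rw [← heat_kvec hμ hρ0 hρ1 (by linarith) (by linarith [mem_Ioi.mp ht])]
  congr 1; ring

theorem kvecConst_nonneg (μ T ρ : ℝ) : 0 ≤ kvecConst μ T ρ := by unfold kvecConst; positivity

/-- The Duhamel kernel whose operator at time `t` is multiplication by
`m(ξ) (1 + ξ²) ^ (ρ / 2) exp (t p(ξ))`, as an operator from bounded functions to `L²`. -/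
def smoothKernel (hμ : 0 < μ) (hT : 0 < T) {m : ℝ → ℂ} {C : ℝ} (hm : IsSymbol m C) {ρ c e : ℝ}
    (hρ0 : 0 ≤ ρ) (hρ1 : ρ ≤ 1) (hc : c < 1) (hgain : 0 < 1 - (ρ / 2 + 1 / 4) - c + e) :
    DuhamelKernel T BCF L2 where
  op t := bcfMul.flip (mulOp m (kvec μ ρ t))
  bd := C * kvecConst μ T ρ
  b := ρ / 2 + 1 / 4
  c := c
  e := e
  T_pos := hT
  bd_nonneg := mul_nonneg hm.nonneg (kvecConst_nonneg μ T ρ)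
  b_nonneg := by linarith
  b_lt := by linarith
  c_lt := hc
  gain_pos := hgain
  continuousOn_op := bcfMul.flip.continuous.comp_continuousOn
    ((mulOp m).continuous.comp_continuousOn (continuousOn_kvec hμ hρ0 hρ1))
  norm_op_le t ht := by
    refine (norm_bcfMul_flip_le _).trans ((hm.norm_mulOp_le _).trans ?_)
    rw [mul_assoc]
    exact mul_le_mul_of_nonneg_left (norm_kvec_le hμ hρ0 hρ1 ht) hm.nonneg

section

variable (hμ : 0 < μ) (hT : 0 < T) {m : ℝ → ℂ} {C : ℝ} (hm : IsSymbol m C) {c e : ℝ}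
    (hρ0 : 0 ≤ ρ) (hρ1 : ρ ≤ 1) (hc : c < 1) (hgain : 0 < 1 - (ρ / 2 + 1 / 4) - c + e)

theorem coe_smoothKernel_op {t : ℝ} (ht : 0 < t) (y : BCF) :
    (smoothKernel hμ hT hm hρ0 hρ1 hc hgain).op t y =ᵐ[volume]
      fun ξ => y ξ * (m ξ * (japan ρ ξ * heatSymb μ t ξ)) := by
  filter_upwards [(isSymbol_bcf y).coe_mulOp (mulOp m (kvec μ ρ t)),
    hm.coe_mulOp (kvec μ ρ t), coe_kvec hμ hρ0 hρ1 ht] with ξ h1 h2 h3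
  change mulOp y (mulOp m (kvec μ ρ t)) ξ = _
  rw [h1, h2, h3]

theorem smoothKernel_op_add (t r : ℝ) (ht : 0 < t) (hr : 0 ≤ r) :
    (smoothKernel hμ hT hm hρ0 hρ1 hc hgain).op (t + r) =
      (heat μ r).comp ((smoothKernel hμ hT hm hρ0 hρ1 hc hgain).op t) := by
  ext1 y
  change mulOp y (mulOp m (kvec μ ρ (t + r))) = heat μ r (mulOp y (mulOp m (kvec μ ρ t)))
  rw [heat_kvec hμ hρ0 hρ1 ht hr, heat, (isSymbol_heatSymb hμ hr).mulOp_comm (isSymbol_bcf y),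
    (isSymbol_heatSymb hμ hr).mulOp_comm hm]

end

end Smoothing

/-! ### The product of square integrable functions on the Fourier side -/

theorem integrable_mul_l2 (f g : L2) : Integrable fun ξ => f ξ * g ξ :=
  (Lp.memLp f).integrable_mul (Lp.memLp g)

theorem integral_norm_mul_le (f g : L2) : ∫ ξ, ‖f ξ‖ * ‖g ξ‖ ≤ ‖f‖ * ‖g‖ := by
  have h := integral_mul_norm_le_Lp_mul_Lq (μ := volume) (p := 2) (q := 2) (f := f) (g := g)
    Real.HolderConjugate.two_two (by simpa using Lp.memLp f) (by simpa using Lp.memLp g)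
  simp only [Real.rpow_two] at h
  rwa [← l2_norm_sq, ← l2_norm_sq, ← Real.sqrt_eq_rpow, ← Real.sqrt_eq_rpow,
    Real.sqrt_sq (norm_nonneg _), Real.sqrt_sq (norm_nonneg _)] at h

/-- The isometry `f ↦ f (ξ - ·)` of `L²`. -/
def reflTrans (ξ : ℝ) : L2 →L[ℝ] L2 :=
  (Lp.compMeasurePreservingₗᵢ ℝ (fun η : ℝ => ξ - η)
    (Measure.measurePreserving_sub_left volume ξ)).toContinuousLinearMap

theorem coe_reflTrans (ξ : ℝ) (f : L2) : reflTrans ξ f =ᵐ[volume] fun η => f (ξ - η) :=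
  Lp.coeFn_compMeasurePreserving f (Measure.measurePreserving_sub_left volume ξ)

theorem norm_reflTrans (ξ : ℝ) (f : L2) : ‖reflTrans ξ f‖ = ‖f‖ :=
  Lp.norm_compMeasurePreserving f (Measure.measurePreserving_sub_left volume ξ)

theorem ae_sub_left (ξ : ℝ) {P : ℝ → Prop} (h : ∀ᵐ η : ℝ, P η) : ∀ᵐ η : ℝ, P (ξ - η) :=
  (Measure.measurePreserving_sub_left (volume : Measure ℝ) ξ).quasiMeasurePreserving.ae h

theorem integrable_conv (f g : L2) (ξ : ℝ) : Integrable fun η => f (ξ - η) * g η := by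
  refine (integrable_mul_l2 (reflTrans ξ f) g).congr ?_
  filter_upwards [coe_reflTrans ξ f] with η h
  rw [h]

theorem integral_norm_conv_le (f g : L2) (ξ : ℝ) : ∫ η, ‖f (ξ - η)‖ * ‖g η‖ ≤ ‖f‖ * ‖g‖ := by
  rw [← norm_reflTrans ξ f]
  refine le_trans (le_of_eq (integral_congr_ae ?_)) (integral_norm_mul_le (reflTrans ξ f) g)
  filter_upwards [coe_reflTrans ξ f] with η h
  rw [h]

/-- The Fourier transform of the square integrable functions, as a real continuous linear map. -/
def fourierL2 : L2 →L[ℝ] L2 := (FourierTransform.fourierCLM ℂ L2).restrictScalars ℝ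

/-- The inverse Fourier transform of the square integrable functions. -/
def fourierInvL2 : L2 →L[ℝ] L2 := (FourierTransform.fourierInvCLM ℂ L2).restrictScalars ℝ

theorem fourierInvL2_apply (f : L2) : fourierInvL2 f = 𝓕⁻ f := rfl

/-- The product of two square integrable functions, as an integrable function. -/
def mulL1 : L2 →L[ℝ] L2 →L[ℝ] Lp ℂ 1 (volume : Measure ℝ) :=
  (ContinuousLinearMap.mul ℝ ℂ).holderL volume 2 2 1

theorem coe_mulL1 (f g : L2) : mulL1 f g =ᵐ[volume] fun x => f x * g x :=
  (ContinuousLinearMap.mul ℝ ℂ).coeFn_holder (r := 1) f g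

/-- The convolution of two square integrable functions, defined as the Fourier transform of the
product of their inverse Fourier transforms; see `convL2_apply`. -/
def convL2 : L2 →L[ℝ] L2 →L[ℝ] BCF :=
  (((Real.Lp.fourierTransformCLM ℝ ℂ).restrictScalars ℝ).postcomp L2).comp
    (mulL1.bilinearComp fourierInvL2 fourierInvL2).flip |>.flip

theorem convL2_eq (f g : L2) :
    convL2 f g = Real.Lp.fourierTransform (mulL1 (𝓕⁻ f) (𝓕⁻ g)) := rfl

/-- The convolution theorem, extended from Schwartz functions by density. -/
theorem convL2_apply (f g : L2) (ξ : ℝ) : convL2 f g ξ = ∫ η, f (ξ - η) * g η := by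
  have hR : ∀ f g : L2, ∫ η, f (ξ - η) * g η =
      (ContinuousLinearMap.mul ℝ ℂ).lpPairing volume 2 2 (reflTrans ξ f) g := fun f g => by
    rw [ContinuousLinearMap.lpPairing_eq_integral]
    refine integral_congr_ae ?_
    filter_upwards [coe_reflTrans ξ f] with η h
    rw [h]; rfl
  rw [hR]
  refine DenseRange.induction_on₂ (p := fun f g => convL2 f g ξ =
    (ContinuousLinearMap.mul ℝ ℂ).lpPairing volume 2 2 (reflTrans ξ f) g)
    (SchwartzMap.denseRange_toLpCLM (p := 2) (F := ℂ) (μ := (volume : Measure ℝ))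
      ENNReal.ofNat_ne_top) ?_ ?_ f g
  · refine isClosed_eq ?_ ?_
    · have h : Continuous fun y : BCF => y ξ := by fun_prop
      exact h.comp (by fun_prop)
    · fun_prop
  · intro φ ψ
    rw [← hR, SchwartzMap.toLpCLM_apply, SchwartzMap.toLpCLM_apply, convL2_eq]
    rw [SchwartzMap.toLp_fourierInv_eq, SchwartzMap.toLp_fourierInv_eq]
    rw [Real.Lp.fourierTransform_apply]
    have h1 : mulL1 ((𝓕⁻ φ).toLp 2) ((𝓕⁻ ψ).toLp 2) =ᵐ[volume] fun x => 𝓕⁻ φ x * 𝓕⁻ ψ x := by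
      filter_upwards [coe_mulL1 ((𝓕⁻ φ).toLp 2) ((𝓕⁻ ψ).toLp 2), (𝓕⁻ φ).coeFn_toLp 2 volume,
        (𝓕⁻ ψ).coeFn_toLp 2 volume] with x h2 h3 h4
      rw [h2, h3, h4]
    rw [Real.fourier_congr_ae h1]
    have h2 : (fun x => 𝓕⁻ φ x * 𝓕⁻ ψ x) =
        𝓕⁻ (SchwartzMap.convolution (ContinuousLinearMap.mul ℂ ℂ) ψ φ) := by
      ext x
      have h3 : ∀ f : 𝓢(ℝ, ℂ), 𝓕⁻ f x = 𝓕 f (-x) := fun f => by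
        rw [SchwartzMap.fourierInv_coe, SchwartzMap.fourier_coe, Real.fourierInv_eq_fourier_neg]
      rw [h3, h3, h3, SchwartzMap.fourier_convolution, SchwartzMap.pairing_apply_apply, mul_comm]
      rfl
    rw [h2, ← SchwartzMap.fourier_coe, FourierTransform.fourier_fourierInv_eq,
      SchwartzMap.convolution_apply, convolution_def]
    refine integral_congr_ae ?_
    filter_upwards [ae_sub_left ξ (φ.coeFn_toLp 2 volume), ψ.coeFn_toLp 2 volume] with η h3 h4
    change _ = (φ.toLp 2 : L2) (ξ - η) * (ψ.toLp 2 : L2) η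
    rw [h3, h4, mul_comm]
    rfl

theorem norm_convL2_apply_le (f g : L2) (ξ : ℝ) : ‖convL2 f g ξ‖ ≤ ∫ η, ‖f (ξ - η)‖ * ‖g η‖ := by
  rw [convL2_apply]
  refine (norm_integral_le_integral_norm _).trans (le_of_eq ?_)
  simp_rw [norm_mul]

theorem conj_convL2 (f g : L2) (ξ : ℝ) :
    (starRingEnd ℂ) (convL2 f g (-ξ)) = convL2 (conjRefl f) (conjRefl g) ξ := by
  rw [convL2_apply, convL2_apply, ← integral_conj, ← integral_neg_eq_self]
  refine integral_congr_ae ?_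
  filter_upwards [ae_sub_left ξ (coe_conjRefl f), coe_conjRefl g] with η h1 h2
  rw [h1, h2, map_mul]
  congr 3
  ring

/-- Testing the product of square integrable functions against a Schwartz function. -/
theorem integral_mul_convL2 (χ : 𝓢(ℝ, ℂ)) (f g : L2) :
    ∫ ξ, χ ξ * convL2 f g ξ = ∫ x, 𝓕 χ x * ((𝓕⁻ f : L2) x * (𝓕⁻ g : L2) x) := by
  have h := VectorFourier.integral_fourierIntegral_smul_eq_flip (L := innerₗ ℝ)
    (μ := (volume : Measure ℝ)) (ν := (volume : Measure ℝ)) (f := χ)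
    (g := (mulL1 (𝓕⁻ f) (𝓕⁻ g) : ℝ → ℂ)) Real.continuous_fourierChar
    continuous_inner χ.integrable (L1.integrable_coeFn _)
  have h1 : ∫ x, 𝓕 χ x * ((𝓕⁻ f : L2) x * (𝓕⁻ g : L2) x) =
      ∫ x, 𝓕 χ x * mulL1 (𝓕⁻ f) (𝓕⁻ g) x := by
    refine integral_congr_ae ?_
    filter_upwards [coe_mulL1 (𝓕⁻ f) (𝓕⁻ g)] with x h2
    rw [h2]
  rw [h1, convL2_eq]
  refine Eq.trans ?_ h.symm
  simp only [flip_innerₗ]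
  rfl

/-! ### The quadratic nonlinearity -/

theorem japan_le_add {σ : ℝ} (hσ : 0 ≤ σ) (ξ η : ℝ) :
    japan σ ξ ≤ 2 ^ σ * (japan σ (ξ - η) + japan σ η) := by
  have h1 : 1 + ξ ^ 2 ≤ 4 * max (1 + (ξ - η) ^ 2) (1 + η ^ 2) := by
    have h2 := le_max_left (1 + (ξ - η) ^ 2) (1 + η ^ 2)
    have h3 := le_max_right (1 + (ξ - η) ^ 2) (1 + η ^ 2)
    nlinarith [sq_nonneg (ξ - 2 * η)]
  have h4 : (4 : ℝ) ^ (σ / 2) = 2 ^ σ := by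
    rw [show (4 : ℝ) = 2 ^ (2 : ℝ) by norm_num, ← Real.rpow_mul (by norm_num)]
    congr 1; ring
  have h5 : 0 ≤ max (1 + (ξ - η) ^ 2) (1 + η ^ 2) := le_max_of_le_left (by positivity)
  refine (Real.rpow_le_rpow (by positivity) h1 (by linarith : 0 ≤ σ / 2)).trans ?_
  rw [Real.mul_rpow (by norm_num) h5, h4]
  gcongr
  rcases max_choice (1 + (ξ - η) ^ 2) (1 + η ^ 2) with h | h <;> rw [h]
  · exact le_add_of_nonneg_right (japan_pos σ η).le
  · exact le_add_of_nonneg_left (japan_pos σ (ξ - η)).le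

/-- Multiplication by `(1 + ξ²) ^ (-σ / 2)`. -/
def besselOp (σ : ℝ) : L2 →L[ℝ] L2 := mulOp fun ξ => japan (-σ) ξ

section Nonlinearity

variable {σ : ℝ}

theorem coe_besselOp (hσ : 0 ≤ σ) (z : L2) :
    besselOp σ z =ᵐ[volume] fun ξ => japan (-σ) ξ * z ξ :=
  (isSymbol_japan (by linarith)).coe_mulOp z

theorem norm_besselOp_le (hσ : 0 ≤ σ) (z : L2) : ‖besselOp σ z‖ ≤ ‖z‖ := by
  refine ((isSymbol_japan (r := -σ) (by linarith)).norm_mulOp_le z).trans ?_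
  rw [one_mul]

/-- The product estimate: the weight `(1 + ξ²) ^ (σ / 2)` is distributed over the two factors. The bound
is linear in the strong norm of `z`, which is what makes the solutions global. -/
theorem norm_japan_mul_convL2_le (hσ : 0 ≤ σ) (z z' : L2) (ξ : ℝ) :
    ‖(japan σ ξ : ℂ) * convL2 (besselOp σ z) (besselOp σ z') ξ‖ ≤
      2 ^ σ * (‖z‖ * ‖besselOp σ z'‖ + ‖besselOp σ z‖ * ‖z'‖) := by
  rw [norm_mul, Complex.norm_real, Real.norm_eq_abs, abs_of_pos (japan_pos σ ξ)]
  set f := besselOp σ z with hf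
  set g := besselOp σ z' with hg
  have hz : ∀ (z : L2), ∀ᵐ η, japan σ η * ‖besselOp σ z η‖ = ‖z η‖ := fun z => by
    filter_upwards [coe_besselOp hσ z] with η h
    rw [h, norm_mul, Complex.norm_real, Real.norm_eq_abs, abs_of_pos (japan_pos _ _), ← mul_assoc,
      mul_comm (japan σ η), japan_neg_mul, one_mul]
  have hi : ∀ f g : L2, Integrable fun η => ‖f (ξ - η)‖ * ‖g η‖ := fun f g => by
    simpa only [norm_mul] using (integrable_conv f g ξ).norm
  calc japan σ ξ * ‖convL2 f g ξ‖
      ≤ japan σ ξ * ∫ η, ‖f (ξ - η)‖ * ‖g η‖ := by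
        have := (japan_pos σ ξ).le
        gcongr
        exact norm_convL2_apply_le f g ξ
    _ = ∫ η, japan σ ξ * (‖f (ξ - η)‖ * ‖g η‖) := by rw [integral_const_mul]
    _ ≤ ∫ η, 2 ^ σ * (‖z (ξ - η)‖ * ‖g η‖ + ‖f (ξ - η)‖ * ‖z' η‖) := by
        refine integral_mono_ae ((hi f g).const_mul _) (((hi z g).add (hi f z')).const_mul _) ?_
        filter_upwards [ae_sub_left ξ (hz z), hz z'] with η h1 h2
        rw [← h1, ← h2]
        have h3 := japan_le_add hσ ξ η
        calc _ ≤ 2 ^ σ * (japan σ (ξ - η) + japan σ η) * (‖f (ξ - η)‖ * ‖g η‖) := by gcongr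
          _ = _ := by ring
    _ = 2 ^ σ * ((∫ η, ‖z (ξ - η)‖ * ‖g η‖) + ∫ η, ‖f (ξ - η)‖ * ‖z' η‖) := by
        rw [integral_const_mul, integral_add (hi z g) (hi f z')]
    _ ≤ _ := by
        gcongr
        · exact integral_norm_conv_le z g ξ
        · exact integral_norm_conv_le f z' ξ

/-- The value of the bilinear form `prodBilin`. -/
def prodFun (hσ : 0 ≤ σ) (z z' : L2) : BCF :=
  BoundedContinuousFunction.ofNormedAddCommGroup
    (fun ξ => (japan σ ξ : ℂ) * convL2 (besselOp σ z) (besselOp σ z') ξ)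
    ((Complex.continuous_ofReal.comp (continuous_japan σ)).mul
      (convL2 (besselOp σ z) (besselOp σ z')).continuous)
    (2 ^ σ * (‖z‖ * ‖besselOp σ z'‖ + ‖besselOp σ z‖ * ‖z'‖))
    (norm_japan_mul_convL2_le hσ z z')

theorem prodFun_apply (hσ : 0 ≤ σ) (z z' : L2) (ξ : ℝ) :
    prodFun hσ z z' ξ = (japan σ ξ : ℂ) * convL2 (besselOp σ z) (besselOp σ z') ξ := rfl

theorem norm_prodFun_le (hσ : 0 ≤ σ) (z z' : L2) :
    ‖prodFun hσ z z'‖ ≤ 2 ^ σ * (‖z‖ * ‖besselOp σ z'‖ + ‖besselOp σ z‖ * ‖z'‖) :=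
  BoundedContinuousFunction.norm_ofNormedAddCommGroup_le _ (by positivity)
    (norm_japan_mul_convL2_le hσ z z')

/-- The bilinear form of the nonlinearity: `z` and `z'` stand for `(1 + ξ²) ^ (σ / 2) ŵ` and
`(1 + ξ²) ^ (σ / 2) ŵ'`, and the value is `(1 + ξ²) ^ (σ / 2)` times the Fourier transform of the
product `w w'`. -/
def prodBilin (hσ : 0 ≤ σ) : L2 →L[ℝ] L2 →L[ℝ] BCF :=
  LinearMap.mkContinuous₂
    (LinearMap.mk₂ ℝ (prodFun hσ)
      (fun z₁ z₂ z' => by ext ξ; simp [prodFun_apply, mul_add])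
      (fun r z z' => by ext ξ; simp [prodFun_apply]; ring)
      (fun z z₁ z₂ => by ext ξ; simp [prodFun_apply, mul_add])
      (fun r z z' => by ext ξ; simp [prodFun_apply]; ring))
    (2 ^ σ * 2) fun z z' => by
      refine (norm_prodFun_le hσ z z').trans ?_
      have h1 := norm_besselOp_le hσ z
      have h2 := norm_besselOp_le hσ z'
      calc _ ≤ 2 ^ σ * (‖z‖ * ‖z'‖ + ‖z‖ * ‖z'‖) := by gcongr
        _ = _ := by ring

theorem prodBilin_apply (hσ : 0 ≤ σ) (z z' : L2) (ξ : ℝ) :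
    prodBilin hσ z z' ξ = (japan σ ξ : ℂ) * convL2 (besselOp σ z) (besselOp σ z') ξ := rfl

theorem norm_prodBilin_self_le (hσ : 0 ≤ σ) (z : L2) :
    ‖prodBilin hσ z z‖ ≤ 2 ^ σ * 2 * ‖besselOp σ z‖ * ‖z‖ :=
  (norm_prodFun_le hσ z z).trans (le_of_eq (by ring))

theorem conjRefl_besselOp (hσ : 0 ≤ σ) (z : L2) :
    conjRefl (besselOp σ z) = besselOp σ (conjRefl z) :=
  conjRefl_mulOp (isSymbol_japan (by linarith)) (isSymbol_japan (by linarith))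
    (fun ξ => by rw [japan_even, Complex.conj_ofReal]) z

theorem bcfConjRefl_prodBilin (hσ : 0 ≤ σ) (z z' : L2) :
    bcfConjRefl (prodBilin hσ z z') = prodBilin hσ (conjRefl z) (conjRefl z') := by
  ext ξ
  rw [bcfConjRefl_apply, prodBilin_apply, prodBilin_apply, map_mul, conj_convL2, japan_even,
    Complex.conj_ofReal, conjRefl_besselOp hσ, conjRefl_besselOp hσ]

end Nonlinearity

/-! ### Conservation of the energy by the nonlinearity -/

/-- The frequency cutoff is needed here: it absorbs the weight `ξ`. -/
theorem integrable_triple {f : L2} {n : ℝ} (hf : ∀ᵐ ξ, n < |ξ| → f ξ = 0) :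
    Integrable (fun p : ℝ × ℝ => (p.1 : ℂ) * f p.1 * (f (-p.1 - p.2) * f p.2))
      (volume.prod volume) := by
  have hm := (Lp.stronglyMeasurable f).measurable
  have hmeas : Measurable fun p : ℝ × ℝ => (p.1 : ℂ) * f p.1 * (f (-p.1 - p.2) * f p.2) := by
    fun_prop
  rw [integrable_prod_iff hmeas.aestronglyMeasurable]
  refine ⟨Eventually.of_forall fun a => (integrable_conv f f (-a)).const_mul (a * f a), ?_⟩
  have hint : Integrable f := by
    have h1 : IntegrableOn f (Icc (-n) n) :=
      ((Lp.memLp f).restrict (Icc (-n) n)).integrable (by norm_num)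
    refine (integrable_indicator_iff measurableSet_Icc).mpr h1 |>.congr ?_
    filter_upwards [hf] with ξ h
    by_cases hξ : ξ ∈ Icc (-n) n
    · rw [indicator_of_mem hξ]
    · rw [indicator_of_notMem hξ, h]
      rw [mem_Icc, ← abs_le] at hξ
      linarith
  refine (hint.norm.const_mul (n * (‖f‖ * ‖f‖))).mono'
    (hmeas.norm.stronglyMeasurable.integral_prod_right').aestronglyMeasurable ?_
  filter_upwards [hf] with a ha
  rw [Real.norm_eq_abs, abs_of_nonneg (integral_nonneg fun c => norm_nonneg _)]
  simp only [norm_mul, Complex.norm_real, Real.norm_eq_abs]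
  rw [integral_const_mul]
  have h2 := integral_norm_conv_le f f (-a)
  by_cases han : n < |a|
  · simp [ha han]
  · push Not at han
    have hn : 0 ≤ n := (abs_nonneg a).trans han
    calc _ ≤ n * ‖f a‖ * (‖f‖ * ‖f‖) := by gcongr
      _ = _ := by ring

/-- The symmetrization argument behind `∫ w² w' dx = 0`: on the plane `a + b + c = 0` the weights `a`,
`b` and `c` give the same integral, and their sum is zero. -/
theorem integral_triple_eq_zero {f : L2} {n : ℝ} (hf : ∀ᵐ ξ, n < |ξ| → f ξ = 0) :
    ∫ a : ℝ, (a : ℂ) * f a * convL2 f f (-a) = 0 := by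
  have hI := integrable_triple hf
  set F : ℝ → ℝ → ℂ := fun a c => (a : ℂ) * f a * (f (-a - c) * f c) with hF
  have h1 : ∀ a : ℝ, (a : ℂ) * f a * convL2 f f (-a) = ∫ c, F a c := fun a => by
    rw [convL2_apply, ← integral_const_mul]
  have hswap : ∫ a, ∫ c, F a c = ∫ a, ∫ c, F c a := integral_integral_swap hI
  -- the substitution `c ↦ -a - c` in the inner integral
  have h2 : ∀ᵐ a : ℝ, 2 * ∫ c, F c a = -∫ c, F a c := by
    filter_upwards [hI.prod_right_ae, hI.swap.prod_right_ae] with a ha1 ha2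
    have ha1' : Integrable (F a) := ha1
    have ha2' : Integrable fun c => F c a := ha2
    have h3 := integral_sub_left_eq_self (fun c => F c a) volume (-a)
    have h4 : (fun c => F (-a - c) a) = fun c => -F a c - F c a := by
      ext c
      simp only [hF]
      rw [show -(-a - c) - a = c by ring, show -c - a = -a - c by ring]
      push_cast
      ring
    have h5 : ∫ c, (-F a c - F c a) = -(∫ c, F a c) - ∫ c, F c a := by
      rw [← integral_neg]
      exact integral_sub ha1'.neg ha2'
    rw [h4, h5] at h3
    linear_combination -h3
  have h5 : 2 * ∫ a, ∫ c, F c a = -∫ a, ∫ c, F a c := by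
    rw [← integral_const_mul, ← integral_neg]
    exact integral_congr_ae h2
  rw [integral_congr_ae (Eventually.of_forall h1)]
  rw [← hswap] at h5
  linear_combination (1 / 3 : ℂ) * h5

/-- The nonlinearity is orthogonal to a real valued, band limited function. -/
theorem inner_eq_zero_of_eq_conv {f h : L2} {n r : ℝ} (hf : ∀ᵐ ξ, n < |ξ| → f ξ = 0)
    (hreal : conjRefl f = f) (hh : ∀ᵐ ξ, |ξ| ≤ n → h ξ = r * (dSymb ξ * convL2 f f ξ)) :
    inner ℝ f h = 0 := by
  have h1 : ∀ᵐ ξ : ℝ, inner ℝ (f ξ) (h ξ) = Complex.reCLM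
      (-(r * (2 * Real.pi * Complex.I)) * (((-ξ : ℝ) : ℂ) * f (-ξ) * convL2 f f (- -ξ))) := by
    have h2 := coe_conjRefl f
    rw [hreal] at h2
    filter_upwards [h2, hf, hh] with ξ h3 h4 h5
    have h6 : f (-ξ) = (starRingEnd ℂ) (f ξ) := by rw [h3, Complex.conj_conj]
    rw [Complex.inner, h6, Complex.reCLM_apply]
    by_cases hξ : n < |ξ|
    · simp [h4 hξ]
    · push Not at hξ
      rw [h5 hξ, dSymb, neg_neg]
      congr 1
      push_cast
      ring
  have hI : Integrable fun a : ℝ => (a : ℂ) * f a * convL2 f f (-a) := by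
    refine (integrable_triple hf).integral_prod_left.congr (Eventually.of_forall fun a => ?_)
    dsimp only
    rw [convL2_apply, ← integral_const_mul]
  rw [L2.inner_def, integral_congr_ae h1, Complex.reCLM.integral_comp_comm, integral_const_mul,
    integral_neg_eq_self (fun a : ℝ => (a : ℂ) * f a * convL2 f f (-a)), integral_triple_eq_zero hf,
    mul_zero, map_zero]
  exact (hI.comp_neg).const_mul _

/-! ### Sobolev spaces on the Fourier side -/

theorem fourierInv_apply_neg (ψ : 𝓢(ℝ, ℂ)) (ξ : ℝ) : 𝓕⁻ ψ ξ = 𝓕 ψ (-ξ) := by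
  rw [SchwartzMap.fourierInv_coe, SchwartzMap.fourier_coe, Real.fourierInv_eq_fourier_neg]

theorem hasTemperateGrowth_japan (r : ℝ) :
    (fun ξ : ℝ => (japan r ξ : ℂ)).HasTemperateGrowth := by
  have h : (fun ξ : ℝ => (japan r ξ : ℂ)) =
      fun ξ : ℝ => (((1 + ‖ξ‖ ^ 2) ^ (r / 2) : ℝ) : ℂ) := by
    ext ξ
    rw [japan, Real.norm_eq_abs, sq_abs]
  rw [h]
  fun_prop

theorem bessel_apply (r : ℝ) (f : Distr) (ψ : 𝓢(ℝ, ℂ)) : bessel r f ψ =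
    f (𝓕 (SchwartzMap.smulLeftCLM ℂ (fun ξ : ℝ => (japan r ξ : ℂ)) (𝓕⁻ ψ))) := by
  have h : (fun ξ : ℝ => (japan r ξ : ℂ)) =
      fun ξ : ℝ => (((1 + ‖ξ‖ ^ 2) ^ (r / 2) : ℝ) : ℂ) := by
    ext ξ
    rw [japan, Real.norm_eq_abs, sq_abs]
  rw [h]
  rfl

/-- The distribution whose Fourier transform is `(1 + ξ²) ^ (-s / 2) G`. -/
def synth (s : ℝ) (G : L2) : Distr := bessel (-s) ((𝓕⁻ G : L2) : Distr)

theorem synth_apply (s : ℝ) (G : L2) (ψ : 𝓢(ℝ, ℂ)) :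
    synth s G ψ = ∫ ξ, 𝓕⁻ ψ ξ * (japan (-s) ξ * G ξ) := by
  rw [synth, bessel_apply, ← Lp.fourierInv_toTemperedDistribution_eq,
    TemperedDistribution.fourierInv_apply, FourierTransform.fourierInv_fourier_eq,
    Lp.toTemperedDistribution_apply]
  refine integral_congr_ae (Eventually.of_forall fun ξ => ?_)
  dsimp only
  rw [SchwartzMap.smulLeftCLM_apply_apply (hasTemperateGrowth_japan _), smul_eq_mul, smul_eq_mul]
  ring

theorem multiplier_synth_apply {m : ℝ → ℂ} (hm : m.HasTemperateGrowth) (s : ℝ) (G : L2)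
    (ψ : 𝓢(ℝ, ℂ)) : TemperedDistribution.fourierMultiplierCLM ℂ m (synth s G) ψ =
      ∫ ξ, m ξ * 𝓕⁻ ψ ξ * (japan (-s) ξ * G ξ) := by
  rw [TemperedDistribution.fourierMultiplierCLM_apply_apply, synth_apply,
    FourierTransform.fourierInv_fourier_eq]
  simp_rw [SchwartzMap.smulLeftCLM_apply_apply hm, smul_eq_mul]

theorem bessel_synth_apply (r s : ℝ) (G : L2) (ψ : 𝓢(ℝ, ℂ)) : bessel r (synth s G) ψ =
      ∫ ξ, japan r ξ * 𝓕⁻ ψ ξ * (japan (-s) ξ * G ξ) := by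
  rw [bessel_apply, synth_apply, FourierTransform.fourierInv_fourier_eq]
  simp_rw [SchwartzMap.smulLeftCLM_apply_apply (hasTemperateGrowth_japan r), smul_eq_mul]

theorem bessel_synth (s : ℝ) (G : L2) : bessel s (synth s G) = ((𝓕⁻ G : L2) : Distr) := by
  rw [synth]
  simp

theorem fourier_fourierInv_l2 (G : L2) : 𝓕 (𝓕⁻ G : L2) = G :=
  FourierTransform.fourier_fourierInv_eq G

theorem synth_injective (s : ℝ) : Function.Injective (synth s) := fun G G' h => by
  have h1 : (𝓕⁻ G : L2) = 𝓕⁻ G' := coe_injective (by rw [← bessel_synth s, h, bessel_synth])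
  rw [← fourier_fourierInv_l2 G, h1, fourier_fourierInv_l2]

theorem fourierInv_neg_deriv (ψ : 𝓢(ℝ, ℂ)) (ξ : ℝ) :
    𝓕⁻ (-SchwartzMap.derivCLM ℂ ℂ ψ) ξ = dSymb ξ * 𝓕⁻ ψ ξ := by
  have h1 := congrFun (Real.fourier_deriv ψ.integrable ψ.differentiable
    (SchwartzMap.derivCLM ℂ ℂ ψ).integrable) (-ξ)
  have h2 : 𝓕 (SchwartzMap.derivCLM ℂ ℂ ψ) (-ξ) = 𝓕 (deriv ψ) (-ξ) := by
    rw [SchwartzMap.fourier_coe]; rfl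
  have h3 : 𝓕⁻ (-SchwartzMap.derivCLM ℂ ℂ ψ) = -𝓕⁻ (SchwartzMap.derivCLM ℂ ℂ ψ) :=
    FourierTransform.fourierInv_neg _
  rw [h3, neg_apply, fourierInv_apply_neg, fourierInv_apply_neg, h2, h1,
    SchwartzMap.fourier_coe, dSymb, smul_eq_mul]
  push_cast
  ring

theorem dx_synth_apply (s : ℝ) (G : L2) (ψ : 𝓢(ℝ, ℂ)) :
    dx (synth s G) ψ = ∫ ξ, dSymb ξ * 𝓕⁻ ψ ξ * (japan (-s) ξ * G ξ) := by
  rw [dx, TemperedDistribution.derivCLM_apply_apply, synth_apply]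
  simp_rw [fourierInv_neg_deriv]

theorem dx_dx_synth_apply (s : ℝ) (G : L2) (ψ : 𝓢(ℝ, ℂ)) :
    dx (dx (synth s G)) ψ =
      ∫ ξ, -((2 * Real.pi * ξ) ^ 2 : ℝ) * 𝓕⁻ ψ ξ * (japan (-s) ξ * G ξ) := by
  rw [dx, TemperedDistribution.derivCLM_apply_apply, dx_synth_apply]
  refine integral_congr_ae (Eventually.of_forall fun ξ => ?_)
  dsimp only
  rw [fourierInv_neg_deriv, dSymb]
  push_cast
  linear_combination (4 * Real.pi ^ 2 * ξ ^ 2 * 𝓕⁻ ψ ξ * (japan (-s) ξ * G ξ)) * Complex.I_sq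

theorem invSqrtOneSubLaplacian_synth_apply (s : ℝ) (G : L2) (ψ : 𝓢(ℝ, ℂ)) :
    invSqrtOneSubLaplacian (synth s G) ψ =
      ∫ ξ, ((1 + (2 * Real.pi * ξ) ^ 2) ^ (-1 / 2 : ℝ) : ℝ) * 𝓕⁻ ψ ξ * (japan (-s) ξ * G ξ) := by
  refine multiplier_synth_apply ?_ s G ψ
  have h1 : (fun ξ : ℝ => (((1 + (2 * Real.pi * ξ) ^ 2) ^ (-1 / 2 : ℝ) : ℝ) : ℂ)) =
      (fun ξ : ℝ => (((1 + ‖ξ‖ ^ 2) ^ (-1 / 2 : ℝ) : ℝ) : ℂ)) ∘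
        ((2 * Real.pi) • ContinuousLinearMap.id ℝ ℝ) := by
    ext ξ
    simp [mul_pow]
  rw [h1]
  exact Function.HasTemperateGrowth.comp (by fun_prop) (ContinuousLinearMap.hasTemperateGrowth _)

/-- The distributional derivative is a square integrable function `w` if and only if the expected
identity holds for the Fourier transforms. -/
theorem dx_synth_eq_iff {s : ℝ} (hs : 0 ≤ s) (G w : L2) :
    dx (synth s G) = (w : Distr) ↔
      ∀ᵐ ξ, dSymb ξ * (japan (-s) ξ * G ξ) = (𝓕 w : L2) ξ := by
  have hw : (w : Distr) = synth 0 (𝓕 w) := by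
    rw [synth, FourierTransform.fourierInv_fourier_eq, neg_zero, bessel,
      TemperedDistribution.besselPotential_zero]
    rfl
  constructor
  · intro h
    -- one more Bessel potential makes both symbols bounded, so that `synth` is injective on them
    have h1 : mulOp (fun ξ => dSymb ξ * japan (-s - 1) ξ) G =
        mulOp (fun ξ => japan (-1) ξ) (𝓕 w : L2) := by
      refine synth_injective 0 ?_
      ext ψ
      have h2 := congrArg (fun D : Distr => bessel (-1) D ψ) h
      rw [hw, bessel_synth_apply, bessel_apply, dx_synth_apply,
        FourierTransform.fourierInv_fourier_eq] at h2
      rw [synth_apply, synth_apply]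
      refine Eq.trans (integral_congr_ae ?_) (h2.trans (integral_congr_ae ?_))
      · filter_upwards [(isSymbol_dSymb_japan (show -s - 1 ≤ -1 by linarith)).coe_mulOp G]
          with ξ h3
        rw [h3, SchwartzMap.smulLeftCLM_apply_apply (hasTemperateGrowth_japan _), smul_eq_mul,
          sub_eq_add_neg, japan_add, neg_zero, japan_zero]
        push_cast
        ring
      · filter_upwards [(isSymbol_japan (show (-1 : ℝ) ≤ 0 by norm_num)).coe_mulOp (𝓕 w : L2)]
          with ξ h3
        rw [h3, neg_zero, japan_zero]
        push_cast
        ring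
    filter_upwards [(isSymbol_dSymb_japan (show -s - 1 ≤ -1 by linarith)).coe_mulOp G,
      (isSymbol_japan (show (-1 : ℝ) ≤ 0 by norm_num)).coe_mulOp (𝓕 w : L2)] with ξ h2 h3
    rw [h1, h3, sub_eq_add_neg, japan_add] at h2
    have h4 : (japan (-1) ξ : ℂ) ≠ 0 := Complex.ofReal_ne_zero.mpr (japan_pos _ _).ne'
    refine mul_left_cancel₀ h4 ?_
    rw [h2]
    push_cast
    ring
  · intro h
    ext ψ
    rw [hw, dx_synth_apply, synth_apply]
    refine integral_congr_ae ?_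
    filter_upwards [h] with ξ h1
    rw [← h1, neg_zero, japan_zero]
    push_cast
    ring

theorem synth_add (s : ℝ) (G G' : L2) : synth s (G + G') = synth s G + synth s G' := by
  rw [synth, FourierTransform.fourierInv_add, coe_add, bessel, map_add]; rfl

theorem synth_smul (s c : ℝ) (G : L2) : synth s (c • G) = c • synth s G := by
  rw [synth, ← fourierInvL2_apply, map_smul, coe_smul, bessel_smul]; rfl

/-! ### Real-valued distributions -/

/-- The complex conjugate of a Schwartz function. -/
def conjSchwartz (ψ : 𝓢(ℝ, ℂ)) : 𝓢(ℝ, ℂ) :=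
  SchwartzMap.postcompCLM (𝕜 := ℝ) (Complex.conjCLE : ℂ →L[ℝ] ℂ) ψ

theorem conjSchwartz_apply (ψ : 𝓢(ℝ, ℂ)) (x : ℝ) :
    conjSchwartz ψ x = (starRingEnd ℂ) (ψ x) := rfl

theorem fourierInv_conjSchwartz (ψ : 𝓢(ℝ, ℂ)) (ξ : ℝ) :
    𝓕⁻ (conjSchwartz ψ) ξ = (starRingEnd ℂ) (𝓕⁻ ψ (-ξ)) := by
  rw [SchwartzMap.fourierInv_coe, SchwartzMap.fourierInv_coe, Real.fourierInv_eq',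
    Real.fourierInv_eq', ← integral_conj]
  refine integral_congr_ae (Eventually.of_forall fun x => ?_)
  dsimp only
  rw [conjSchwartz_apply, smul_eq_mul, smul_eq_mul, map_mul, ← Complex.exp_conj]
  congr 2
  simp [Complex.conj_ofNat]

theorem synth_conjRefl_apply (s : ℝ) (G : L2) (ψ : 𝓢(ℝ, ℂ)) :
    synth s (conjRefl G) ψ = (starRingEnd ℂ) (synth s G (conjSchwartz ψ)) := by
  rw [synth_apply, synth_apply, ← integral_conj, ← integral_neg_eq_self]
  refine integral_congr_ae ?_
  filter_upwards [ae_neg (coe_conjRefl G)] with ξ h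
  rw [h, fourierInv_conjSchwartz, map_mul, map_mul, Complex.conj_conj, Complex.conj_ofReal,
    japan_even, neg_neg]

/-- A distribution is real valued if and only if its Fourier transform is hermitian. -/
theorem isReal_synth_iff (s : ℝ) (G : L2) : IsReal (synth s G) ↔ conjRefl G = G := by
  constructor
  · intro h
    have hreal : ∀ ψ : 𝓢(ℝ, ℂ), (∀ x, (ψ x).im = 0) → synth s (conjRefl G) ψ = synth s G ψ := by
      intro ψ hψ
      have h1 : conjSchwartz ψ = ψ := by
        ext x
        rw [conjSchwartz_apply, Complex.conj_eq_iff_im, hψ x]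
      rw [synth_conjRefl_apply, h1, Complex.conj_eq_iff_im, h ψ hψ]
    refine synth_injective s ?_
    ext ψ
    -- decompose the test function into its real and imaginary parts
    have h2 : ψ = (1 / 2 : ℂ) • (ψ + conjSchwartz ψ) +
        Complex.I • ((-Complex.I / 2) • (ψ - conjSchwartz ψ)) := by
      ext x
      simp only [add_apply, smul_apply, sub_apply, smul_eq_mul]
      linear_combination (1 / 2 * (ψ x - conjSchwartz ψ x)) * Complex.I_sq
    rw [h2, map_add, map_add, map_smul _ Complex.I, map_smul _ Complex.I,
      hreal ((-Complex.I / 2) • (ψ - conjSchwartz ψ)),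
      hreal ((1 / 2 : ℂ) • (ψ + conjSchwartz ψ))]
    · intro x
      simp [conjSchwartz_apply]
    · intro x
      simp [conjSchwartz_apply]
  · intro h ψ hψ
    have h1 : conjSchwartz ψ = ψ := by
      ext x
      rw [conjSchwartz_apply, Complex.conj_eq_iff_im, hψ x]
    have h2 := synth_conjRefl_apply s G ψ
    rw [h, h1] at h2
    exact Complex.conj_eq_iff_im.mp h2.symm

/-- The projection onto the Fourier transforms of real valued functions. -/
def realProj : L2 →L[ℝ] L2 := (1 / 2 : ℝ) • (ContinuousLinearMap.id ℝ L2 + conjRefl)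

theorem realProj_apply (G : L2) : realProj G = (1 / 2 : ℝ) • (G + conjRefl G) := rfl

theorem conjRefl_realProj (G : L2) : conjRefl (realProj G) = realProj G := by
  rw [realProj_apply, map_smul, map_add, conjRefl_conjRefl, add_comm]

theorem realProj_eq_self {G : L2} (h : conjRefl G = G) : realProj G = G := by
  rw [realProj_apply, h, ← two_smul ℝ G, smul_smul]
  norm_num

theorem norm_realProj_le (G : L2) : ‖realProj G‖ ≤ ‖G‖ := by
  rw [realProj_apply, norm_smul]
  have h := norm_add_le G (conjRefl G)
  rw [norm_conjRefl] at h
  norm_num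
  linarith

namespace Sob

variable {s : ℝ}

theorem exists_hat (f : Sob s) : ∃ G : L2, synth s G = f.val := by
  obtain ⟨g, hg⟩ := f.memL2
  refine ⟨𝓕 g, ?_⟩
  rw [synth, FourierTransform.fourierInv_fourier_eq, ← hg]
  simp

/-- The function `(1 + ξ²) ^ (s / 2) f̂`. -/
def hat (f : Sob s) : L2 := f.exists_hat.choose

theorem synth_hat (f : Sob s) : synth s f.hat = f.val := f.exists_hat.choose_spec

theorem norm_hat (f : Sob s) : ‖f.hat‖ = ‖f‖ := by
  rw [Sob.norm_def, ← f.synth_hat, bessel_synth, l2Norm_coe]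
  conv_lhs => rw [← fourier_fourierInv_l2 f.hat, Lp.norm_fourier_eq]

theorem conjRefl_hat (f : Sob s) : conjRefl f.hat = f.hat := by
  rw [← isReal_synth_iff s, synth_hat]
  exact f.2.2

/-- The map `f ↦ (1 + ξ²) ^ (s / 2) f̂` as an isometry. -/
def hatL (s : ℝ) : Sob s →L[ℝ] L2 :=
  LinearMap.mkContinuous
    { toFun := hat
      map_add' := fun f g => synth_injective s (by
        rw [synth_add, synth_hat, synth_hat, synth_hat, Sob.val_add])
      map_smul' := fun c f => synth_injective s (by
        rw [RingHom.id_apply, synth_smul, synth_hat, synth_hat, Sob.val_smul]) }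
    1 fun f => by
      rw [one_mul]
      exact f.norm_hat.le

/-- The element of `H^s` with given Fourier transform `(1 + ξ²) ^ (-s / 2) G` (made real valued). -/
def ofHat (s : ℝ) (G : L2) : Sob s :=
  ⟨synth s (realProj G), ⟨_, bessel_synth s _⟩,
    (isReal_synth_iff s _).mpr (conjRefl_realProj G)⟩

theorem val_ofHat (s : ℝ) (G : L2) : (ofHat s G).val = synth s (realProj G) := rfl

theorem hat_ofHat (s : ℝ) (G : L2) : (ofHat s G).hat = realProj G :=
  synth_injective s (by rw [synth_hat, val_ofHat])

theorem ofHat_hat (f : Sob s) : ofHat s f.hat = f :=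
  Sob.ext (by rw [val_ofHat, realProj_eq_self f.conjRefl_hat, synth_hat])

theorem norm_ofHat_le (G : L2) : ‖ofHat s G‖ ≤ ‖G‖ := by
  rw [← norm_hat, hat_ofHat]
  exact norm_realProj_le G

/-- The map `ofHat` as a continuous linear map. -/
def ofHatL (s : ℝ) : L2 →L[ℝ] Sob s :=
  LinearMap.mkContinuous
    { toFun := ofHat s
      map_add' := fun G G' => Sob.ext (by
        rw [val_ofHat, Sob.val_add, val_ofHat, val_ofHat, map_add, synth_add])
      map_smul' := fun c G => Sob.ext (by
        rw [RingHom.id_apply, val_ofHat, Sob.val_smul, val_ofHat, map_smul, synth_smul]) }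
    1 fun G => by
      rw [one_mul]
      exact norm_ofHat_le G

end Sob

/-! ### Exponents and kernels -/

/-- The part `min s 1` of the regularity index. -/
def ord (s : ℝ) : ℝ := min s 1

/-- The excess `max (s - 1) 0` of the regularity index over `1`. -/
def exc (s : ℝ) : ℝ := s - ord s

theorem ord_le_one (s : ℝ) : ord s ≤ 1 := min_le_right _ _

theorem half_lt_ord {s : ℝ} (hs : 1 / 2 < s) : 1 / 2 < ord s := lt_min hs (by norm_num)

theorem exc_nonneg (s : ℝ) : 0 ≤ exc s := sub_nonneg.mpr (min_le_left _ _)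

theorem exc_add_ord (s : ℝ) : exc s + ord s = s := sub_add_cancel _ _

theorem weightExp_eq (s : ℝ) : weightExp s = (1 - ord s) / 2 := by
  unfold weightExp ord
  rcases le_total s 1 with h | h
  · rw [min_eq_left h, max_eq_left (by linarith)]
  · rw [min_eq_right h, max_eq_right (by linarith)]; norm_num

theorem weightExp_nonneg (s : ℝ) : 0 ≤ weightExp s := le_max_right _ _

theorem isSymbol_half : IsSymbol (fun _ => (1 / 2 : ℂ)) (1 / 2) := ⟨measurable_const, by simp⟩

theorem isSymbol_half_dSymb :
    IsSymbol (fun ξ => (1 / 2 : ℂ) * (dSymb ξ * japan (-1) ξ)) (1 / 2 * (2 * Real.pi)) :=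
  isSymbol_half.mul (isSymbol_dSymb_japan le_rfl)

section Kernels

variable {μ s T : ℝ} (hμ : 0 < μ) (hs : 1 / 2 < s) (hT : 0 < T)

/-- The Duhamel operator for `(1 + ξ²) ^ (s / 2) û`. -/
def kerU : DuhamelKernel T BCF L2 :=
  smoothKernel (ρ := ord s) (c := 1 - ord s) (e := 0) hμ hT isSymbol_half
    (by linarith [half_lt_ord hs]) (ord_le_one s) (by linarith [half_lt_ord hs])
    (by linarith [half_lt_ord hs])

/-- The Duhamel operator for `t ^ a (1 + ξ²) ^ (σ / 2)` times the Fourier transform of `∂ₓ u`, where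
`a = weightExp s` and `σ = exc s`. The singularities are `(t - τ) ^ (-3/4)` and `τ ^ (-2 a)`, and the
gain `1 - 3/4 - 2 a + a` is positive exactly because `s > 1/2`. -/
def kerW : DuhamelKernel T BCF L2 :=
  smoothKernel (ρ := 1) (c := 1 - ord s) (e := weightExp s) hμ hT isSymbol_half_dSymb
    zero_le_one le_rfl (by linarith [half_lt_ord hs])
    (by rw [weightExp_eq]; linarith [half_lt_ord hs])

theorem kerU_c : (kerU hμ hs hT).c = 1 - ord s := rfl

theorem kerU_e : (kerU hμ hs hT).e = 0 := rfl

theorem kerW_c : (kerW hμ hs hT).c = 1 - ord s := rfl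

theorem kerW_e : (kerW hμ hs hT).e = weightExp s := rfl

theorem coe_kerU_op {t : ℝ} (ht : 0 < t) (y : BCF) : (kerU hμ hs hT).op t y =ᵐ[volume]
    fun ξ => y ξ * ((1 / 2 : ℂ) * (japan (ord s) ξ * heatSymb μ t ξ)) :=
  coe_smoothKernel_op _ _ _ _ _ _ _ ht y

theorem coe_kerW_op {t : ℝ} (ht : 0 < t) (y : BCF) : (kerW hμ hs hT).op t y =ᵐ[volume]
    fun ξ => y ξ * ((1 / 2 : ℂ) * (dSymb ξ * heatSymb μ t ξ)) := by
  filter_upwards [coe_smoothKernel_op (ρ := 1) (c := 1 - ord s) (e := weightExp s) hμ hT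
    isSymbol_half_dSymb zero_le_one le_rfl (by linarith [half_lt_ord hs])
    (by rw [weightExp_eq]; linarith [half_lt_ord hs]) ht y] with ξ h
  refine h.trans ?_
  have h1 := congrArg (fun x : ℝ => (x : ℂ)) (japan_neg_mul 1 ξ)
  push_cast at h1
  linear_combination (y ξ * (1 / 2) * dSymb ξ * heatSymb μ t ξ) * h1

theorem kerU_op_add (t r : ℝ) (ht : 0 < t) (hr : 0 ≤ r) :
    (kerU hμ hs hT).op (t + r) = (heat μ r).comp ((kerU hμ hs hT).op t) :=
  smoothKernel_op_add _ _ _ _ _ _ _ t r ht hr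

theorem kerW_op_add (t r : ℝ) (ht : 0 < t) (hr : 0 ≤ r) :
    (kerW hμ hs hT).op (t + r) = (heat μ r).comp ((kerW hμ hs hT).op t) :=
  smoothKernel_op_add _ _ _ _ _ _ _ t r ht hr

theorem conjRefl_kerW_op {t : ℝ} (ht : 0 < t) (y : BCF) :
    conjRefl ((kerW hμ hs hT).op t y) = (kerW hμ hs hT).op t (bcfConjRefl y) := by
  ext1
  filter_upwards [coe_conjRefl ((kerW hμ hs hT).op t y), ae_neg (coe_kerW_op hμ hs hT ht y),
    coe_kerW_op hμ hs hT ht (bcfConjRefl y)] with ξ h1 h2 h3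
  rw [h1, h2, h3, bcfConjRefl_apply, map_mul, map_mul, map_mul, ← heatSymb_conj, ← dSymb_conj]
  simp [Complex.conj_ofNat]

theorem conjRefl_kerU_op {t : ℝ} (ht : 0 < t) (y : BCF) :
    conjRefl ((kerU hμ hs hT).op t y) = (kerU hμ hs hT).op t (bcfConjRefl y) := by
  ext1
  filter_upwards [coe_conjRefl ((kerU hμ hs hT).op t y), ae_neg (coe_kerU_op hμ hs hT ht y),
    coe_kerU_op hμ hs hT ht (bcfConjRefl y)] with ξ h1 h2 h3
  rw [h1, h2, h3, bcfConjRefl_apply, map_mul, map_mul, map_mul, ← heatSymb_conj, japan_even,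
    Complex.conj_ofReal]
  simp [Complex.conj_ofNat]

/-- A continuous curve of symbols, acting on `L²`. -/
def symbCurve {m : Icc (0 : ℝ) T → ℝ → ℂ} {C : ℝ} (hC : 0 ≤ C) (hm : ∀ t, IsSymbol (m t) C)
    (hc : ∀ ξ, Continuous fun t => m t ξ) : L2 →L[ℝ] C(Icc (0 : ℝ) T, L2) :=
  LinearMap.mkContinuous
    { toFun := fun G => ⟨fun t => mulOp (m t) G, continuous_iff_continuousAt.mpr fun t =>
        tendsto_mulOp (Eventually.of_forall hm) (hm t)
          (Eventually.of_forall fun ξ => (hc ξ).continuousAt) G⟩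
      map_add' := fun G G' => by ext1 t; exact map_add (mulOp (m t)) G G'
      map_smul' := fun r G => by ext1 t; exact map_smul (mulOp (m t)) r G }
    C fun G => (ContinuousMap.norm_le _ (mul_nonneg hC (norm_nonneg G))).mpr fun t =>
      (hm t).norm_mulOp_le G

theorem isSymbol_heatSymb_Icc (hμ : 0 < μ) (t : Icc (0 : ℝ) T) :
    IsSymbol (heatSymb μ t) (Real.exp (μ * T)) :=
  ⟨by fun_prop, fun ξ => ((isSymbol_heatSymb hμ t.2.1).2 ξ).trans (by gcongr; exact t.2.2)⟩

/-- The free evolution of `(1 + ξ²) ^ (s / 2) û`. -/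
def linG (hμ : 0 < μ) (T : ℝ) : L2 →L[ℝ] C(Icc (0 : ℝ) T, L2) :=
  symbCurve (m := fun t => heatSymb μ t) (Real.exp_pos _).le (isSymbol_heatSymb_Icc hμ)
    fun ξ => (continuous_heatSymb μ ξ).comp continuous_subtype_val

theorem linG_apply (G : L2) (t : Icc (0 : ℝ) T) : linG hμ T G t = heat μ t G := rfl

/-- The symbol of the weighted derivative of the free evolution. -/
def derivSymb (μ s t ξ : ℝ) : ℂ :=
  ((t ^ weightExp s : ℝ) : ℂ) * (dSymb ξ * japan (-ord s) ξ) * heatSymb μ t ξ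

theorem rpow_le_exp {x a : ℝ} (hx : 0 ≤ x) (ha0 : 0 ≤ a) (ha1 : a ≤ 1) : x ^ a ≤ Real.exp x := by
  rcases le_total x 1 with h | h
  · exact (Real.rpow_le_one hx h ha0).trans (Real.one_le_exp hx)
  · calc x ^ a ≤ x ^ (1 : ℝ) := Real.rpow_le_rpow_of_exponent_le h ha1
      _ ≤ Real.exp x := by rw [Real.rpow_one]; linarith [Real.add_one_le_exp x]

/-- The weight `t ^ a` absorbs the missing derivatives: `|ξ| (1 + ξ²) ^ (-min s 1 / 2) ≤ |ξ| ^ (2 a)`, and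
`(t ξ²) ^ a ≤ exp (t ξ²)`. -/
theorem isSymbol_derivSymb (hμ : 0 < μ) (hs : 1 / 2 < s) (t : Icc (0 : ℝ) T) :
    IsSymbol (derivSymb μ s t) (2 * Real.pi * Real.exp (μ * T)) := by
  have ht := t.2.1
  have ho := half_lt_ord hs
  refine ⟨by unfold derivSymb; fun_prop, fun ξ => ?_⟩
  have h1 : |ξ| * japan (-ord s) ξ ≤ (ξ ^ 2) ^ weightExp s := by
    rcases eq_or_ne ξ 0 with rfl | h0
    · rw [abs_zero, zero_mul]; positivity
    · have h2 : |ξ| = (ξ ^ 2) ^ weightExp s * |ξ| ^ ord s := by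
        rw [← sq_abs, ← Real.rpow_natCast, ← Real.rpow_mul (abs_nonneg ξ),
          ← Real.rpow_add (abs_pos.mpr h0), weightExp_eq]
        conv_lhs => rw [← Real.rpow_one |ξ|]
        congr 1
        push_cast; ring
      have h3 := abs_rpow_le_japan (by linarith : 0 ≤ ord s) ξ
      have h4 := (japan_pos (-ord s) ξ).le
      calc |ξ| * japan (-ord s) ξ = (ξ ^ 2) ^ weightExp s * (japan (-ord s) ξ * |ξ| ^ ord s) := by
            conv_lhs => rw [h2]
            ring
        _ ≤ (ξ ^ 2) ^ weightExp s * (japan (-ord s) ξ * japan (ord s) ξ) := by gcongr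
        _ = _ := by rw [japan_neg_mul, mul_one]
  have h5 : ((t : ℝ) * ξ ^ 2) ^ weightExp s ≤ Real.exp (t * ξ ^ 2) :=
    rpow_le_exp (mul_nonneg ht (sq_nonneg ξ)) (weightExp_nonneg s) (by rw [weightExp_eq]; linarith)
  have h6 : Real.exp (t * ξ ^ 2) * Real.exp (t * linSymb μ ξ) ≤ Real.exp (μ * T) := by
    rw [← Real.exp_add]
    gcongr
    have h7 := mul_le_mul_of_nonneg_left (linSymb_le hμ ξ) ht
    have h8 : ξ ^ 2 ≤ (2 * Real.pi * ξ) ^ 2 := by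
      rw [mul_pow]
      refine le_mul_of_one_le_left (sq_nonneg ξ) ?_
      nlinarith [Real.pi_gt_three]
    have h9 := mul_le_mul_of_nonneg_left h8 ht
    have h10 := mul_le_mul_of_nonneg_left t.2.2 hμ.le
    nlinarith
  rw [derivSymb, norm_mul, norm_mul, norm_mul, norm_dSymb, norm_heatSymb, Complex.norm_real,
    Complex.norm_real, Real.norm_eq_abs, Real.norm_eq_abs, abs_of_pos (japan_pos _ ξ),
    abs_of_nonneg (Real.rpow_nonneg ht _)]
  calc (t : ℝ) ^ weightExp s * (2 * Real.pi * |ξ| * japan (-ord s) ξ) * Real.exp (t * linSymb μ ξ)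
      = 2 * Real.pi * ((t : ℝ) ^ weightExp s * (|ξ| * japan (-ord s) ξ) *
          Real.exp (t * linSymb μ ξ)) := by ring
    _ ≤ 2 * Real.pi * ((t : ℝ) ^ weightExp s * (ξ ^ 2) ^ weightExp s *
          Real.exp (t * linSymb μ ξ)) := by gcongr
    _ = 2 * Real.pi * (((t : ℝ) * ξ ^ 2) ^ weightExp s * Real.exp (t * linSymb μ ξ)) := by
        rw [Real.mul_rpow ht (sq_nonneg ξ)]
    _ ≤ 2 * Real.pi * (Real.exp (t * ξ ^ 2) * Real.exp (t * linSymb μ ξ)) := by gcongr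
    _ ≤ _ := by gcongr

theorem continuous_derivSymb (μ s ξ : ℝ) : Continuous fun t => derivSymb μ s t ξ := by
  unfold derivSymb
  refine Continuous.mul (Continuous.mul ?_ continuous_const) (continuous_heatSymb μ ξ)
  exact Complex.continuous_ofReal.comp
    (Real.continuous_rpow_const (weightExp_nonneg s))

/-- The weighted derivative of the free evolution. -/
def linZ (T : ℝ) : L2 →L[ℝ] C(Icc (0 : ℝ) T, L2) :=
  symbCurve (m := fun t => derivSymb μ s t) (by positivity) (isSymbol_derivSymb hμ hs)
    fun ξ => (continuous_derivSymb μ s ξ).comp continuous_subtype_val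

theorem linZ_apply (G : L2) (t : Icc (0 : ℝ) T) : linZ hμ hs T G t = mulOp (derivSymb μ s t) G :=
  rfl

theorem conjRefl_linZ {G : L2} (hG : conjRefl G = G) (t : Icc (0 : ℝ) T) :
    conjRefl (linZ hμ hs T G t) = linZ hμ hs T G t := by
  rw [linZ_apply, conjRefl_mulOp (isSymbol_derivSymb hμ hs t) (isSymbol_derivSymb hμ hs t), hG]
  intro ξ
  rw [derivSymb, derivSymb, map_mul, map_mul, map_mul, ← heatSymb_conj, ← dSymb_conj, japan_even,
    Complex.conj_ofReal, Complex.conj_ofReal]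

theorem conjRefl_linG {G : L2} (hG : conjRefl G = G) (t : Icc (0 : ℝ) T) :
    conjRefl (linG hμ T G t) = linG hμ T G t := by
  rw [linG_apply, heat, conjRefl_mulOp (isSymbol_heatSymb_Icc hμ t) (isSymbol_heatSymb_Icc hμ t)
    (heatSymb_conj μ t), hG]

end Kernels

/-! ### The space `X_T^s` on the Fourier side -/

theorem realProj_mulOp {m : ℝ → ℂ} {C : ℝ} (hm : IsSymbol m C)
    (hmm : ∀ ξ, m ξ = (starRingEnd ℂ) (m (-ξ))) (f : L2) :
    realProj (mulOp m f) = mulOp m (realProj f) := by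
  rw [realProj_apply, realProj_apply, conjRefl_mulOp hm hm hmm, map_smul, map_add]

section XSpaces

variable {s T : ℝ}

/-- The pairs of curves `(G, Z)` such that `t ^ (-a) Z` is `(1 + ξ²) ^ (σ / 2)` times the Fourier
transform of `∂ₓ u`, where `G` is `(1 + ξ²) ^ (s / 2) û`. The relation is multiplied by
`(1 + ξ²) ^ (- (σ + 1) / 2)` to have bounded symbols. -/
def pairSub (s T : ℝ) : Submodule ℝ (C(Icc (0 : ℝ) T, L2) × C(Icc (0 : ℝ) T, L2)) where
  carrier := {p | ∀ t : Icc (0 : ℝ) T, 0 < (t : ℝ) →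
    mulOp (fun ξ => dSymb ξ * japan (-s - 1) ξ) (p.1 t) =
      (t : ℝ) ^ (-weightExp s) • mulOp (fun ξ => japan (-exc s - 1) ξ) (p.2 t)}
  add_mem' := by
    intro p q hp hq t ht
    change mulOp _ (p.1 t + q.1 t) = _ • mulOp _ (p.2 t + q.2 t)
    rw [map_add, map_add, smul_add, hp t ht, hq t ht]
  zero_mem' := by
    intro t _
    change mulOp _ (0 : L2) = _ • mulOp _ (0 : L2)
    rw [map_zero, map_zero, smul_zero]
  smul_mem' := by
    intro c p hp t ht
    change mulOp _ (c • p.1 t) = _ • mulOp _ (c • p.2 t)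
    rw [map_smul, map_smul, hp t ht, smul_comm]

/-- The square integrable function `∂ₓ u(t)`, in terms of its weighted Fourier transform. -/
def derivL2 (s t : ℝ) (z : L2) : L2 := 𝓕⁻ (t ^ (-weightExp s) • besselOp (exc s) z : L2)

theorem norm_derivL2_le {t : ℝ} (ht : 0 < t) (z : L2) :
    ‖derivL2 s t z‖ ≤ t ^ (-weightExp s) * ‖z‖ := by
  have h := Lp.norm_fourier_eq (derivL2 s t z)
  rw [derivL2, fourier_fourierInv_l2] at h
  rw [derivL2, ← h, norm_smul, Real.norm_eq_abs, abs_of_pos (Real.rpow_pos_of_pos ht _)]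
  have := norm_besselOp_le (exc_nonneg s) z
  gcongr

theorem dx_ofHat (hs : 0 ≤ s) {p : C(Icc (0 : ℝ) T, L2) × C(Icc (0 : ℝ) T, L2)}
    (hp : p ∈ pairSub s T) (t : Icc (0 : ℝ) T) (ht : 0 < (t : ℝ)) :
    dx (Sob.ofHat s (p.1 t)).val = (derivL2 s t (realProj (p.2 t)) : L2) := by
  rw [Sob.val_ofHat, dx_synth_eq_iff hs, derivL2, fourier_fourierInv_l2]
  have hσ := exc_nonneg s
  have h1 := congrArg realProj (hp t ht)
  have hsym1 := isSymbol_dSymb_japan (show -s - 1 ≤ -1 by linarith)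
  have hsym2 := isSymbol_japan (show -exc s - 1 ≤ 0 by linarith)
  rw [realProj_mulOp hsym1 (fun ξ => by
      rw [map_mul, ← dSymb_conj, japan_even, Complex.conj_ofReal]), map_smul,
    realProj_mulOp hsym2 (fun ξ => by rw [japan_even, Complex.conj_ofReal])] at h1
  have h2 := hsym1.coe_mulOp (realProj (p.1 t))
  rw [h1] at h2
  filter_upwards [h2, Lp.coeFn_smul ((t : ℝ) ^ (-weightExp s))
    (mulOp (fun ξ => japan (-exc s - 1) ξ) (realProj (p.2 t))), hsym2.coe_mulOp (realProj (p.2 t)),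
    Lp.coeFn_smul ((t : ℝ) ^ (-weightExp s)) (besselOp (exc s) (realProj (p.2 t))),
    coe_besselOp hσ (realProj (p.2 t))] with ξ h3 h4 h5 h6 h7
  rw [h4, Pi.smul_apply, h5, sub_eq_add_neg, sub_eq_add_neg, japan_add, japan_add] at h3
  rw [h6, Pi.smul_apply, h7]
  have h8 : (japan (-1) ξ : ℂ) ≠ 0 := Complex.ofReal_ne_zero.mpr (japan_pos _ _).ne'
  refine mul_left_cancel₀ h8 ?_
  simp only [Complex.real_smul] at h3 ⊢
  push_cast at h3
  linear_combination -h3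

theorem weighted_ofHat_le (hs : 0 ≤ s) {p : C(Icc (0 : ℝ) T, L2) × C(Icc (0 : ℝ) T, L2)}
    (hp : p ∈ pairSub s T) (t : Icc (0 : ℝ) T) :
    weighted s t (Sob.ofHat s (p.1 t)).val ≤ ‖p.2‖ := by
  unfold weighted
  split_ifs with ht
  · rw [dx_ofHat hs hp t ht, l2Norm_coe]
    have h1 := norm_derivL2_le (s := s) ht (realProj (p.2 t))
    have h2 := (norm_realProj_le (p.2 t)).trans (p.2.norm_coe_le_norm t)
    have h3 := Real.rpow_pos_of_pos ht (weightExp s)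
    calc _ ≤ (t : ℝ) ^ weightExp s * ((t : ℝ) ^ (-weightExp s) * ‖realProj (p.2 t)‖) := by gcongr
      _ = ‖realProj (p.2 t)‖ := by
        rw [← mul_assoc, ← Real.rpow_add ht, add_neg_cancel, Real.rpow_zero, one_mul]
      _ ≤ _ := h2
  · exact norm_nonneg _

/-- The element of `X_T^s` given by a pair of curves on the Fourier side. -/
def mkXFun (hs : 0 ≤ s) (p : pairSub s T) : XSpace s T :=
  ⟨((Sob.ofHatL s : L2 →L[ℝ] Sob s) : C(L2, Sob s)).comp p.1.1,
    fun t ht => ⟨_, dx_ofHat hs p.2 t ht⟩, ‖p.1.2‖, by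
      rintro _ ⟨t, rfl⟩
      exact weighted_ofHat_le hs p.2 t⟩

/-- The map `mkXFun` as a continuous linear map. -/
def mkX (hs : 0 ≤ s) : pairSub s T →L[ℝ] XSpace s T :=
  LinearMap.mkContinuous
    { toFun := mkXFun hs
      map_add' := fun p q => Subtype.ext (by
        ext1 t
        exact map_add (Sob.ofHatL s) (p.1.1 t) (q.1.1 t))
      map_smul' := fun c p => Subtype.ext (by
        ext1 t
        exact map_smul (Sob.ofHatL s) c (p.1.1 t)) }
    2 fun p => by
      refine Real.iSup_le (fun t => ?_) (by positivity)
      have h1 : ‖Sob.ofHat s (p.1.1 t)‖ ≤ ‖p‖ :=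
        ((Sob.norm_ofHat_le _).trans (p.1.1.norm_coe_le_norm t)).trans (norm_fst_le p.1)
      have h2 := (weighted_ofHat_le hs p.2 t).trans (norm_snd_le p.1)
      have h3 : ‖p.1‖ = ‖p‖ := rfl
      change ‖Sob.ofHat s (p.1.1 t)‖ + weighted s t (Sob.ofHat s (p.1.1 t)).val ≤ 2 * ‖p‖
      linarith

variable {μ : ℝ} (hμ : 0 < μ) (hs : 1 / 2 < s) (hT : 0 < T)

/-- The second component of the free evolution is the weighted derivative of the first. -/
theorem linPair_mem (G : L2) : (linG hμ T G, linZ hμ hs T G) ∈ pairSub s T := by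
  intro t ht
  have hσ := exc_nonneg s
  have hsym1 := isSymbol_dSymb_japan (show -s - 1 ≤ -1 by linarith)
  have hsym2 := isSymbol_japan (show -exc s - 1 ≤ 0 by linarith)
  ext1
  filter_upwards [hsym1.coe_mulOp (linG hμ T G t),
    (isSymbol_heatSymb_Icc hμ t).coe_mulOp G, Lp.coeFn_smul ((t : ℝ) ^ (-weightExp s))
    (mulOp (fun ξ => japan (-exc s - 1) ξ) (linZ hμ hs T G t)),
    hsym2.coe_mulOp (linZ hμ hs T G t), (isSymbol_derivSymb hμ hs t).coe_mulOp G]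
    with ξ h1 h2 h3 h4 h5
  rw [h1, linG_apply, heat, h2, h3, Pi.smul_apply, h4, linZ_apply, h5, derivSymb,
    Complex.real_smul]
  have h6 : (t : ℝ) ^ (-weightExp s) * (t : ℝ) ^ weightExp s = 1 := by
    rw [← Real.rpow_add ht, neg_add_cancel, Real.rpow_zero]
  have h7 : japan (-s - 1) ξ = japan (-exc s - 1) ξ * japan (-ord s) ξ := by
    rw [← japan_add]
    congr 1
    linarith [exc_add_ord s]
  have h8 := congrArg (fun x : ℝ => (x : ℂ)) h6
  push_cast at h8
  rw [h7]
  push_cast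
  linear_combination (-dSymb ξ * japan (-exc s - 1) ξ * japan (-ord s) ξ * heatSymb μ t ξ * G ξ) * h8

theorem duhU_apply (g : C(Icc (0 : ℝ) T, BCF)) {t : Icc (0 : ℝ) T} (ht : (t : ℝ) ∈ Ioc 0 T) :
    (kerU hμ hs hT).duh g t = (kerU hμ hs hT).conv g t := by
  rw [DuhamelKernel.duh_apply, DuhamelKernel.duhFun_eq_conv _ g ht, kerU_e, Real.rpow_zero,
    one_smul]

theorem duhW_apply (g : C(Icc (0 : ℝ) T, BCF)) {t : Icc (0 : ℝ) T} (ht : (t : ℝ) ∈ Ioc 0 T) :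
    (kerW hμ hs hT).duh g t = (t : ℝ) ^ weightExp s • (kerW hμ hs hT).conv g t := by
  rw [DuhamelKernel.duh_apply, DuhamelKernel.duhFun_eq_conv _ g ht, kerW_e]

/-- The second component of the Duhamel operators is the weighted derivative of the first. -/
theorem duhPair_mem (g : C(Icc (0 : ℝ) T, BCF)) :
    ((kerU hμ hs hT).duh g, (kerW hμ hs hT).duh g) ∈ pairSub s T := by
  intro t ht
  change mulOp _ ((kerU hμ hs hT).duh g t) = _ • mulOp _ ((kerW hμ hs hT).duh g t)
  have hσ := exc_nonneg s
  have hsym1 := isSymbol_dSymb_japan (show -s - 1 ≤ -1 by linarith)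
  have hsym2 := isSymbol_japan (show -exc s - 1 ≤ 0 by linarith)
  have htT : (t : ℝ) ∈ Ioc 0 T := ⟨ht, t.2.2⟩
  rw [duhU_apply hμ hs hT g htT, duhW_apply hμ hs hT g htT, map_smul, smul_smul,
    ← Real.rpow_add ht, neg_add_cancel, Real.rpow_zero, one_smul]
  refine DuhamelKernel.map_conv_eq _ _ ((kerU_c hμ hs hT).trans (kerW_c hμ hs hT).symm) (fun r hr τ => ?_) htT
  ext1
  filter_upwards [hsym1.coe_mulOp ((kerU hμ hs hT).op r (g τ)), coe_kerU_op hμ hs hT hr (g τ),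
    hsym2.coe_mulOp ((kerW hμ hs hT).op r (g τ)), coe_kerW_op hμ hs hT hr (g τ)] with ξ h1 h2 h3 h4
  rw [h1, h2, h3, h4]
  have h7 : japan (-exc s - 1) ξ = japan (-s - 1) ξ * japan (ord s) ξ := by
    rw [← japan_add]
    congr 1
    linarith [exc_add_ord s]
  rw [h7]
  push_cast
  ring

/-- The free evolution, as a map into the pairs of curves. -/
def linPair (T : ℝ) : L2 →L[ℝ] pairSub s T :=
  ((linG hμ T).prod (linZ hμ hs T)).codRestrict _ (linPair_mem hμ hs)

/-- The Duhamel operators, as a map into the pairs of curves. -/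
def duhPair : C(Icc (0 : ℝ) T, BCF) →L[ℝ] pairSub s T :=
  ((kerU hμ hs hT).duh.prod (kerW hμ hs hT).duh).codRestrict _ (duhPair_mem hμ hs hT)

end XSpaces

/-! ### Realness of the solutions -/

section Existence

variable {μ s T : ℝ} (hμ : 0 < μ) (hs : 1 / 2 < s) (hT : 0 < T)

/-- The bilinear form of the nonlinearity in `H^s`. -/
abbrev nlin (s : ℝ) : L2 →L[ℝ] L2 →L[ℝ] BCF := prodBilin (exc_nonneg s)

theorem conjRefl_retr {R : ℝ} (x : L2) : conjRefl (retr R x) = retr R (conjRefl x) := by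
  rw [retr, retr, map_smul, norm_conjRefl]

/-- The pointwise action of `conjRefl` on curves. -/
def conjCurve (z : C(Icc (0 : ℝ) T, L2)) : C(Icc (0 : ℝ) T, L2) :=
  (conjRefl : C(L2, L2)).comp z

theorem conjCurve_apply (z : C(Icc (0 : ℝ) T, L2)) (t : Icc (0 : ℝ) T) :
    conjCurve z t = conjRefl (z t) := rfl

theorem conjRefl_duhW {g g' : C(Icc (0 : ℝ) T, BCF)} (h : ∀ τ, bcfConjRefl (g τ) = g' τ)
    (t : Icc (0 : ℝ) T) :
    conjRefl ((kerW hμ hs hT).duh g t) = (kerW hμ hs hT).duh g' t := by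
  rcases eq_or_lt_of_le t.2.1 with h0 | h0
  · rw [DuhamelKernel.duh_apply, DuhamelKernel.duh_apply, ← h0, DuhamelKernel.duhFun_zero_time,
      DuhamelKernel.duhFun_zero_time, map_zero]
  · have ht : (t : ℝ) ∈ Ioc 0 T := ⟨h0, t.2.2⟩
    rw [duhW_apply hμ hs hT g ht, duhW_apply hμ hs hT g' ht, map_smul]
    congr 1
    refine (kerW hμ hs hT).map_conv_eq (A := conjRefl) (A' := ContinuousLinearMap.id ℝ L2)
      (kerW hμ hs hT) rfl (fun r hr τ => ?_) ht
    rw [conjRefl_kerW_op hμ hs hT hr, h]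
    rfl

theorem conjRefl_duhU {g g' : C(Icc (0 : ℝ) T, BCF)} (h : ∀ τ, bcfConjRefl (g τ) = g' τ)
    (t : Icc (0 : ℝ) T) :
    conjRefl ((kerU hμ hs hT).duh g t) = (kerU hμ hs hT).duh g' t := by
  rcases eq_or_lt_of_le t.2.1 with h0 | h0
  · rw [DuhamelKernel.duh_apply, DuhamelKernel.duh_apply, ← h0, DuhamelKernel.duhFun_zero_time,
      DuhamelKernel.duhFun_zero_time, map_zero]
  · have ht : (t : ℝ) ∈ Ioc 0 T := ⟨h0, t.2.2⟩
    rw [duhU_apply hμ hs hT g ht, duhU_apply hμ hs hT g' ht]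
    refine (kerU hμ hs hT).map_conv_eq (A := conjRefl) (A' := ContinuousLinearMap.id ℝ L2)
      (kerU hμ hs hT) rfl (fun r hr τ => ?_) ht
    rw [conjRefl_kerU_op hμ hs hT hr, h]
    rfl

theorem conjRefl_truncMap {z₀ : C(Icc (0 : ℝ) T, L2)} (hz₀ : ∀ t, conjRefl (z₀ t) = z₀ t)
    {R : ℝ} (hR : 0 < R) (z : C(Icc (0 : ℝ) T, L2)) (t : Icc (0 : ℝ) T) :
    conjRefl ((kerW hμ hs hT).truncMap (nlin s) z₀ hR z t) =
      (kerW hμ hs hT).truncMap (nlin s) z₀ hR (conjCurve z) t := by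
  change conjRefl (z₀ t + (kerW hμ hs hT).duh _ t) = z₀ t + (kerW hμ hs hT).duh _ t
  rw [map_add, hz₀]
  congr 1
  refine conjRefl_duhW hμ hs hT (fun τ => ?_) t
  simp only [curveBilin_apply, retrCurve_apply, bcfConjRefl_prodBilin, conjCurve_apply,
    conjRefl_retr]

/-- By uniqueness, a solution with real data is real. -/
theorem conjRefl_of_volterra {z₀ z : C(Icc (0 : ℝ) T, L2)} (hz₀ : ∀ t, conjRefl (z₀ t) = z₀ t)
    (hz : (kerW hμ hs hT).volterra (nlin s) z = z₀) (t : Icc (0 : ℝ) T) :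
    conjRefl (z t) = z t := by
  have h : conjCurve z = z := by
    refine (kerW hμ hs hT).volterra_injective (nlin s) ?_
    rw [hz]
    ext1 t
    have h1 := congrArg conjRefl (congrArg (fun f : C(Icc (0 : ℝ) T, L2) => f t) hz)
    rw [hz₀] at h1
    rw [← h1]
    change conjRefl (z t) - (kerW hμ hs hT).duh _ t = conjRefl (z t - (kerW hμ hs hT).duh _ t)
    rw [map_sub]
    congr 1
    refine (conjRefl_duhW hμ hs hT (fun τ => ?_) t).symm
    simp only [curveBilin_apply, bcfConjRefl_prodBilin, conjCurve_apply]
  rw [← conjCurve_apply, h]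

/-! ### The energy estimate and global existence -/

/-- The symbol of the frequency cutoff to `[-n, n]`. -/
def cutSymb (n : ℝ) (ξ : ℝ) : ℂ := (Icc (-n) n).indicator (fun _ => 1) ξ

theorem isSymbol_cutSymb (n : ℝ) : IsSymbol (cutSymb n) 1 :=
  ⟨measurable_const.indicator measurableSet_Icc, fun ξ => by
    unfold cutSymb
    by_cases h : ξ ∈ Icc (-n) n <;> simp [h]⟩

theorem cutSymb_of_le {n ξ : ℝ} (h : |ξ| ≤ n) : cutSymb n ξ = 1 :=
  indicator_of_mem (s := Icc (-n) n) (abs_le.mp h) _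

theorem cutSymb_of_lt {n ξ : ℝ} (h : n < |ξ|) : cutSymb n ξ = 0 :=
  indicator_of_notMem (s := Icc (-n) n) (fun h' => absurd (abs_le.mpr h') (not_le.mpr h)) _

theorem cutSymb_conj (n ξ : ℝ) : cutSymb n ξ = (starRingEnd ℂ) (cutSymb n (-ξ)) := by
  rcases le_or_gt |ξ| n with h | h
  · rw [cutSymb_of_le h, cutSymb_of_le (by rwa [abs_neg]), map_one]
  · rw [cutSymb_of_lt h, cutSymb_of_lt (by rwa [abs_neg]), map_zero]

theorem tendsto_cutSymb (f : L2) :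
    Tendsto (fun n : ℕ => mulOp (cutSymb n) f) atTop (𝓝 f) := by
  have h := tendsto_mulOp (l := atTop) (m := fun n : ℕ => cutSymb n) (m₀ := fun _ => 1) (C := 1)
    (Eventually.of_forall fun n => isSymbol_cutSymb n) isSymbol_one (Eventually.of_forall fun ξ => by
      refine tendsto_const_nhds.congr' ?_
      obtain ⟨N, hN⟩ := exists_nat_ge |ξ|
      filter_upwards [eventually_ge_atTop N] with n hn
      rw [cutSymb_of_le (hN.trans (by exact_mod_cast hn))]) f
  rwa [mulOp_one] at h

/-- The symbol of the nonlinear rate of change of the truncated derivative. -/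
def cutDerivSymb (s n ξ : ℝ) : ℂ :=
  cutSymb n ξ * ((1 / 2 : ℂ) * (dSymb ξ * japan (-exc s) ξ))

theorem isSymbol_cutDerivSymb (s : ℝ) {n : ℝ} (hn : 0 ≤ n) :
    IsSymbol (cutDerivSymb s n) (Real.pi * n) := by
  have hσ := exc_nonneg s
  refine ⟨by
    unfold cutDerivSymb
    have := (isSymbol_cutSymb n).1
    fun_prop, fun ξ => ?_⟩
  have hπ := Real.pi_pos
  rcases le_or_gt |ξ| n with h | h
  · rw [cutDerivSymb, cutSymb_of_le h, one_mul, norm_mul, norm_mul, norm_dSymb, Complex.norm_real,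
      Real.norm_eq_abs, abs_of_pos (japan_pos _ _)]
    have h1 := japan_le_one (r := -exc s) (by linarith) ξ
    have h0 := (japan_pos (-exc s) ξ).le
    have h2 : ‖(1 / 2 : ℂ)‖ = 1 / 2 := by simp
    rw [h2]
    calc 1 / 2 * (2 * Real.pi * |ξ| * japan (-exc s) ξ)
        ≤ 1 / 2 * (2 * Real.pi * n * 1) := by gcongr
      _ = _ := by ring
  · rw [cutDerivSymb, cutSymb_of_lt h, zero_mul, norm_zero]
    positivity

/-- The product of the indicator of `[-n, n]` with the symbol of half the derivative. -/
def cutVec (s n : ℝ) : L2 :=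
  mulOp (cutDerivSymb s n) (indicatorConstLp 2 (measurableSet_Icc (a := -n) (b := n))
    measure_Icc_lt_top.ne 1)

theorem coe_cutVec (s : ℝ) {n : ℝ} (hn : 0 ≤ n) : cutVec s n =ᵐ[volume] cutDerivSymb s n := by
  filter_upwards [(isSymbol_cutDerivSymb s hn).coe_mulOp (indicatorConstLp 2
    (measurableSet_Icc (a := -n) (b := n)) measure_Icc_lt_top.ne 1),
    indicatorConstLp_coeFn (p := 2) (hs := measurableSet_Icc (a := -n) (b := n))
      (hμs := measure_Icc_lt_top.ne) (c := (1 : ℂ)) (μ := volume)] with ξ h1 h2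
  rw [cutVec, h1, h2]
  change cutDerivSymb s n ξ * cutSymb n ξ = _
  rcases le_or_gt |ξ| n with h | h
  · rw [cutSymb_of_le h, mul_one]
  · rw [cutSymb_of_lt h, cutDerivSymb, cutSymb_of_lt h, zero_mul, zero_mul]

/-- The truncation `besselOp` of a frequency truncated function. -/
def cutBessel (s n : ℝ) : L2 →L[ℝ] L2 := (besselOp (exc s)).comp (mulOp (cutSymb n))

theorem isSymbol_bessel (s : ℝ) : IsSymbol (fun ξ => (japan (-exc s) ξ : ℂ)) 1 :=
  isSymbol_japan (by linarith [exc_nonneg s])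

theorem cutBessel_apply (s n : ℝ) (f : L2) :
    cutBessel s n f = besselOp (exc s) (mulOp (cutSymb n) f) := rfl

theorem heat_cutBessel (hμ : 0 < μ) (n : ℝ) {r : ℝ} (hr : 0 ≤ r) (f : L2) :
    heat μ r (cutBessel s n f) = cutBessel s n (heat μ r f) := by
  rw [cutBessel_apply, cutBessel_apply, heat, besselOp,
    (isSymbol_heatSymb hμ hr).mulOp_comm (isSymbol_bessel s),
    (isSymbol_heatSymb hμ hr).mulOp_comm (isSymbol_cutSymb n)]

theorem cutBessel_kerW_op {n : ℝ} (hn : 0 ≤ n) {r : ℝ} (hr : 0 < r) (y : BCF) :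
    cutBessel s n ((kerW hμ hs hT).op r y) = heat μ r (bcfMul y (cutVec s n)) := by
  ext1
  filter_upwards [(isSymbol_bessel s).coe_mulOp (mulOp (cutSymb n) ((kerW hμ hs hT).op r y)),
    (isSymbol_cutSymb n).coe_mulOp ((kerW hμ hs hT).op r y), coe_kerW_op hμ hs hT hr y,
    (isSymbol_heatSymb hμ hr.le).coe_mulOp (bcfMul y (cutVec s n)),
    (isSymbol_bcf y).coe_mulOp (cutVec s n), coe_cutVec s hn] with ξ h1 h2 h3 h4 h5 h6
  rw [cutBessel_apply, besselOp, h1, h2, h3, heat, h4, bcfMul_apply, h5, h6, cutDerivSymb]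
  ring

/-- Without the weight, the derivative of the free evolution is propagated by the semigroup. -/
theorem linZ_add (G : L2) {t r : ℝ} (ht : 0 < t) (hr : 0 ≤ r) (htr : t + r ≤ T) :
    (t + r) ^ (-weightExp s) • linZ hμ hs T G ⟨t + r, by linarith, htr⟩ =
      heat μ r (t ^ (-weightExp s) • linZ hμ hs T G ⟨t, ht.le, by linarith⟩) := by
  have h1 : ∀ x : ℝ, 0 < x → ((x ^ (-weightExp s) : ℝ) : ℂ) * ((x ^ weightExp s : ℝ) : ℂ) = 1 := by
    intro x hx
    rw [← Complex.ofReal_mul, ← Real.rpow_add hx, neg_add_cancel, Real.rpow_zero, Complex.ofReal_one]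
  rw [map_smul]
  ext1
  filter_upwards [Lp.coeFn_smul ((t + r) ^ (-weightExp s))
      (linZ hμ hs T G ⟨t + r, by linarith, htr⟩),
    (isSymbol_derivSymb hμ hs (⟨t + r, by linarith, htr⟩ : Icc (0 : ℝ) T)).coe_mulOp G,
    Lp.coeFn_smul (t ^ (-weightExp s)) (heat μ r (linZ hμ hs T G ⟨t, ht.le, by linarith⟩)),
    (isSymbol_heatSymb hμ hr).coe_mulOp (linZ hμ hs T G ⟨t, ht.le, by linarith⟩),
    (isSymbol_derivSymb hμ hs (⟨t, ht.le, by linarith⟩ : Icc (0 : ℝ) T)).coe_mulOp G]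
    with ξ h2 h3 h4 h5 h6
  rw [h2, Pi.smul_apply, linZ_apply, h3, h4, Pi.smul_apply, heat, h5, linZ_apply, h6, derivSymb,
    derivSymb, heatSymb_add, Complex.real_smul, Complex.real_smul]
  linear_combination (dSymb ξ * japan (-ord s) ξ * heatSymb μ r ξ * heatSymb μ t ξ * G ξ) *
    (h1 (t + r) (by linarith) - h1 t ht)

/-- The energy estimate for a Galerkin approximation: the nonlinearity is orthogonal to `∂ₓ u` in `L²`,
and the radial truncation only multiplies it by a scalar. -/
theorem norm_galerkin_le {G : L2} {R : ℝ} (hR : 0 < R) {n : ℝ} (hn : 0 ≤ n)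
    {w : C(Icc (0 : ℝ) T, L2)} (hreal : ∀ t, conjRefl (w t) = w t)
    (hw : ∀ t, w t =
      mulOp (cutSymb n) ((kerW hμ hs hT).truncMap (nlin s) (linZ hμ hs T G) hR w t))
    {t₀ t : Icc (0 : ℝ) T} (ht₀ : 0 < (t₀ : ℝ)) (ht : (t₀ : ℝ) ≤ t) :
    ‖(t : ℝ) ^ (-weightExp s) • besselOp (exc s) (w t)‖ ≤
      Real.exp (μ * (t - t₀)) * ‖(t₀ : ℝ) ^ (-weightExp s) • besselOp (exc s) (w t₀)‖ := by
  set K := kerW hμ hs hT with hK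
  set g : C(Icc (0 : ℝ) T, BCF) := curveBilin (nlin s) (retrCurve hR w) (retrCurve hR w) with hg
  set v : ℝ → L2 := fun τ =>
    τ ^ (-weightExp s) • besselOp (exc s) (w (projIcc 0 T hT.le τ)) with hv
  have hproj : ∀ {τ : ℝ} (h1 : 0 < τ) (h2 : τ ≤ T), projIcc 0 T hT.le τ = ⟨τ, h1.le, h2⟩ :=
    fun h1 h2 => projIcc_of_mem hT.le ⟨h1.le, h2⟩
  -- the Duhamel formula for the unweighted derivative
  have hform : ∀ {τ : ℝ} (h1 : 0 < τ) (h2 : τ ≤ T), v τ = cutBessel s n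
      (τ ^ (-weightExp s) • linZ hμ hs T G ⟨τ, h1.le, h2⟩ + K.conv g τ) := by
    intro τ h1 h2
    have h3 : K.truncMap (nlin s) (linZ hμ hs T G) hR w ⟨τ, h1.le, h2⟩ =
        linZ hμ hs T G ⟨τ, h1.le, h2⟩ + τ ^ weightExp s • K.conv g τ := by
      rw [← duhW_apply hμ hs hT g (t := ⟨τ, h1.le, h2⟩) ⟨h1, h2⟩]
      rfl
    simp only [hv]
    rw [hproj h1 h2, hw, h3, ← cutBessel_apply, ← map_smul, smul_add, smul_smul, ← Real.rpow_add h1,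
      neg_add_cancel, Real.rpow_zero, one_smul]
  have hvt : ∀ τ : Icc (0 : ℝ) T, v τ = (τ : ℝ) ^ (-weightExp s) • besselOp (exc s) (w τ) := by
    intro τ
    simp only [hv, projIcc_val]
  have hS0 : ∀ x : L2, Tendsto (fun r => heat μ r x) (𝓝[>] 0) (𝓝 x) := fun x => by
    have h := (continuousOn_heat hμ x 0 self_mem_Ici).mono_left
      (nhdsWithin_mono 0 (Ioi_subset_Ici_self : Ioi (0 : ℝ) ⊆ Ici 0))
    simpa only [heat_zero] using h
  rw [← hvt, ← hvt]
  refine norm_le_exp_mul_of_restart (S := heat μ) (μ := μ) (a := (t₀ : ℝ)) (b := T)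
    (fun r hr x => norm_heat_le hμ hr x) hS0 (v := v) ?_ ?_ t ⟨ht, t.2.2⟩
  · refine ContinuousOn.smul (f := fun τ : ℝ => τ ^ (-weightExp s)) ?_ ?_
    · exact fun τ hτ => (Real.continuousAt_rpow_const _ _
        (Or.inl (ht₀.trans_le hτ.1).ne')).continuousWithinAt
    · exact ((besselOp (exc s)).continuous.comp
        (w.continuous.comp continuous_projIcc)).continuousOn
  · intro τ hτ
    have hτ0 : 0 < τ := ht₀.trans_le hτ.1
    have hτI : τ ∈ Ioo 0 T := ⟨hτ0, hτ.2⟩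
    refine ⟨fun r => cutBessel s n (∫ x in τ..τ + r, K.rate g (τ + r) x), _, ?_,
      K.tendsto_average_rate (cutBessel s n) (fun r => (heat μ r).comp (bcfMul.flip (cutVec s n)))
        (fun r hr y => cutBessel_kerW_op hμ hs hT hn hr y) (M := Real.exp (μ * 1) * ‖cutVec s n‖)
        ?_ ?_ g hτI, ?_⟩
    · filter_upwards [Ioo_mem_nhdsGT (show (0 : ℝ) < T - τ by linarith [hτ.2])] with r hr
      have h1 : τ + r ≤ T := by linarith [hr.2]
      rw [hform (by linarith [hr.1] : 0 < τ + r) h1, hform hτ0 hτ.2.le,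
        K.conv_add (kerW_op_add hμ hs hT) g hτ0 hr.1.le h1, linZ_add hμ hs G hτ0 hr.1.le h1,
        heat_cutBessel hμ n hr.1.le, ← map_add]
      congr 1
      rw [map_add (heat μ r)]
      exact (add_assoc _ _ _).symm
    · filter_upwards [Ioo_mem_nhdsGT (show (0 : ℝ) < 1 by norm_num)] with r hr
      refine ContinuousLinearMap.opNorm_le_bound _ (by positivity) fun y => ?_
      refine (norm_heat_le hμ hr.1.le _).trans ?_
      have h1 := (bcfMul.flip (cutVec s n)).le_opNorm y
      have h2 := norm_bcfMul_flip_le (cutVec s n)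
      have h3 := hr.2.le
      calc Real.exp (μ * r) * ‖bcfMul.flip (cutVec s n) y‖
          ≤ Real.exp (μ * 1) * (‖bcfMul.flip (cutVec s n)‖ * ‖y‖) := by gcongr
        _ ≤ Real.exp (μ * 1) * (‖cutVec s n‖ * ‖y‖) := by gcongr
        _ = _ := by ring
    · intro y
      have h1 := hS0 (bcfMul y (cutVec s n))
      have h2 : ((heat μ 0).comp (bcfMul.flip (cutVec s n))) y = bcfMul y (cutVec s n) :=
        heat_zero μ _
      rw [h2]
      exact h1
    · set τ' : Icc (0 : ℝ) T := projIcc 0 T hT.le τ with hτ'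
      set k : ℝ := R / max R ‖w τ'‖ with hk
      -- both factors of the product are multiples of `v τ`
      have hkv : besselOp (exc s) (retr R (w τ')) = (k * τ ^ weightExp s) • v τ := by
        rw [retr, map_smul, hv]
        dsimp only
        rw [smul_smul, mul_assoc, ← Real.rpow_add hτ0, add_neg_cancel, Real.rpow_zero, mul_one]
      have hconv : ∀ ξ, g τ' ξ =
          (japan (exc s) ξ : ℂ) * ((k * τ ^ weightExp s) ^ 2 : ℝ) * convL2 (v τ) (v τ) ξ := by
        intro ξ
        change nlin s (retr R (w τ')) (retr R (w τ')) ξ = _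
        rw [prodBilin_apply, hkv]
        simp only [map_smul, smul_apply, BoundedContinuousFunction.smul_apply, Complex.real_smul]
        push_cast
        ring
      refine inner_eq_zero_of_eq_conv (n := n)
        (r := τ ^ (-K.c) * (1 / 2 * (k * τ ^ weightExp s) ^ 2)) ?_ ?_ ?_
      · rw [hform hτ0 hτ.2.le, cutBessel_apply]
        set F := τ ^ (-weightExp s) • linZ hμ hs T G ⟨τ, hτ0.le, hτ.2.le⟩ + K.conv g τ
        filter_upwards [(isSymbol_bessel s).coe_mulOp (mulOp (cutSymb n) F),
          (isSymbol_cutSymb n).coe_mulOp F] with ξ h1 h2 hξ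
        rw [besselOp, h1, h2, cutSymb_of_lt hξ, zero_mul, mul_zero]
      · simp only [hv]
        rw [map_smul, conjRefl_besselOp (exc_nonneg s), hreal]
      · change ∀ᵐ ξ, |ξ| ≤ n → (τ ^ (-K.c) • heat μ 0 (bcfMul (g τ') (cutVec s n)) : L2) ξ = _
        rw [heat_zero, bcfMul_apply]
        filter_upwards [Lp.coeFn_smul (τ ^ (-K.c)) (mulOp (g τ') (cutVec s n)),
          (isSymbol_bcf (g τ')).coe_mulOp (cutVec s n), coe_cutVec s hn] with ξ h1 h2 h3 hξ
        have h4 := congrArg (fun x : ℝ => (x : ℂ)) (japan_neg_mul (exc s) ξ)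
        push_cast at h4
        rw [h1, Pi.smul_apply, h2, h3, hconv, cutDerivSymb, cutSymb_of_le hξ, Complex.real_smul]
        push_cast
        linear_combination ((τ ^ (-K.c) : ℝ) * (k * (τ ^ weightExp s : ℝ)) ^ 2 *
          convL2 (v τ) (v τ) ξ * (1 / 2) * dSymb ξ : ℂ) * h4

/-- Global existence: the `L²` bound of `∂ₓ u` passes from the Galerkin approximations to the solution
of the truncated equation. -/
theorem exists_volterra_linZ {G : L2} (hG : conjRefl G = G) :
    ∃ z, (kerW hμ hs hT).volterra (nlin s) z = linZ hμ hs T G := by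
  refine (kerW hμ hs hT).exists_volterra_eq (nlin s) (linZ hμ hs T G)
    (by rw [kerW_e]; exact weightExp_nonneg s) (besselOp (exc s)) (norm_besselOp_le (exc_nonneg s))
    (by positivity) (norm_prodBilin_self_le (exc_nonneg s)) hμ.le ?_
  intro R hR z hz t₀ t ht₀ htt
  rw [kerW_e]
  obtain ⟨w, hw, huniq, hlim⟩ := (kerW hμ hs hT).exists_galerkin (nlin s) (linZ hμ hs T G) hR
    (P := fun n : ℕ => mulOp (cutSymb n))
    (fun n x => by simpa using (isSymbol_cutSymb n).norm_mulOp_le x) tendsto_cutSymb hz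
  have ht : 0 < (t : ℝ) := ht₀.trans_le htt
  have hreal : ∀ n t, conjRefl (w n t) = w n t := by
    intro n t
    have h : conjCurve (w n) = w n := huniq n _ fun t => by
      rw [conjCurve_apply, hw n t, conjRefl_mulOp (isSymbol_cutSymb n) (isSymbol_cutSymb n)
        (cutSymb_conj n), conjRefl_truncMap hμ hs hT (fun τ => conjRefl_linZ hμ hs hG τ)]
    rw [← conjCurve_apply, h]
  have hn : ∀ n : ℕ, ‖besselOp (exc s) (w n t)‖ * (t₀ : ℝ) ^ weightExp s ≤
      Real.exp (μ * (t - t₀)) * ‖besselOp (exc s) (w n t₀)‖ * (t : ℝ) ^ weightExp s := by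
    intro n
    have h := norm_galerkin_le hμ hs hT hR (Nat.cast_nonneg n) (hreal n) (hw n) ht₀ htt
    rw [norm_smul, norm_smul, Real.norm_eq_abs, Real.norm_eq_abs,
      abs_of_pos (Real.rpow_pos_of_pos ht _), abs_of_pos (Real.rpow_pos_of_pos ht₀ _),
      Real.rpow_neg ht.le, Real.rpow_neg ht₀.le] at h
    have h1 := Real.rpow_pos_of_pos ht (weightExp s)
    have h2 := Real.rpow_pos_of_pos ht₀ (weightExp s)
    field_simp at h
    linarith
  refine le_of_tendsto_of_tendsto' (b := atTop) ?_ ?_ hn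
  · exact (((besselOp (exc s)).continuous.tendsto _).comp (hlim t)).norm.mul_const _
  · exact ((((besselOp (exc s)).continuous.tendsto _).comp (hlim t₀)).norm.const_mul _).mul_const _

end Existence

/-! ### The time derivative of the mild solution -/

/-- A continuous function with a continuous right derivative is differentiable. -/
theorem hasDerivAt_of_right_deriv {E : Type*} [NormedAddCommGroup E] [NormedSpace ℝ E]
    [CompleteSpace E] {f Q : ℝ → E} {a b : ℝ} (hf : ContinuousOn f (Icc a b))
    (hQ : ContinuousOn Q (Icc a b)) (hd : ∀ x ∈ Ico a b, HasDerivWithinAt f (Q x) (Ici x) x)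
    {x : ℝ} (hx : x ∈ Ioo a b) : HasDerivAt f (Q x) x := by
  have hab : a ≤ b := hx.1.le.trans hx.2.le
  have hQi : IntervalIntegrable Q volume a b := by
    refine ContinuousOn.intervalIntegrable ?_
    rwa [uIcc_of_le hab]
  set g : ℝ → E := fun τ => f a + ∫ y in a..τ, Q y with hg
  have hint : ∀ y ∈ Icc a b, IntervalIntegrable Q volume a y := fun y hy =>
    hQi.mono_set (by rw [uIcc_of_le hab, uIcc_of_le hy.1]; exact Icc_subset_Icc_right hy.2)
  have hgc : ContinuousOn g (Icc a b) := by
    refine continuousOn_const.add ?_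
    have h := intervalIntegral.continuousOn_primitive_interval' hQi left_mem_uIcc
    rwa [uIcc_of_le hab] at h
  have hgd : ∀ y ∈ Ico a b, HasDerivWithinAt g (Q y) (Ici y) y := by
    intro y hy
    have hy' : y ∈ Icc a b := ⟨hy.1, hy.2.le⟩
    have hcont : ContinuousWithinAt Q (Ioi y) y :=
      ((hQ y hy').mono_of_mem_nhdsWithin (mem_of_superset (Icc_mem_nhdsGE hy.2)
        (Icc_subset_Icc_left hy.1))).mono Ioi_subset_Ici_self
    have hmeas : StronglyMeasurableAtFilter Q (𝓝[>] y) volume :=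
      ⟨Ioo y b, Ioo_mem_nhdsGT hy.2, (hQ.mono (fun z hz =>
        ⟨hy.1.trans hz.1.le, hz.2.le⟩)).aestronglyMeasurable measurableSet_Ioo⟩
    exact (intervalIntegral.integral_hasDerivWithinAt_right (hint y hy') hmeas hcont).const_add _
  have heq : ∀ y ∈ Icc a b, f y = g y :=
    eq_of_has_deriv_right_eq hd hgd hf hgc (by simp [hg])
  have hx' : x ∈ Icc a b := ⟨hx.1.le, hx.2.le⟩
  have hga : HasDerivAt g (Q x) x := by
    refine (intervalIntegral.integral_hasDerivAt_right (hint x hx') ?_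
      (hQ.continuousAt (Icc_mem_nhds hx.1 hx.2))).const_add _
    exact ⟨Ioo a b, Ioo_mem_nhds hx.1 hx.2,
      (hQ.mono Ioo_subset_Icc_self).aestronglyMeasurable measurableSet_Ioo⟩
  refine hga.congr_of_eventuallyEq ?_
  filter_upwards [Icc_mem_nhds hx.1 hx.2] with y hy
  exact heq y hy

/-- The pairing of a Schwartz function with `(1 + ξ²) ^ (-s / 2) F`. -/
def pairS (s : ℝ) (χ : 𝓢(ℝ, ℂ)) : L2 →L[ℝ] ℂ :=
  ((ContinuousLinearMap.mul ℝ ℂ).lpPairing volume 2 2 (χ.toLp 2)).comp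
    (mulOp fun ξ => japan (-s) ξ)

theorem pairS_apply {s : ℝ} (hs : 0 ≤ s) (χ : 𝓢(ℝ, ℂ)) (F : L2) :
    pairS s χ F = ∫ ξ, χ ξ * (japan (-s) ξ * F ξ) := by
  rw [pairS, ContinuousLinearMap.comp_apply, ContinuousLinearMap.lpPairing_eq_integral]
  refine integral_congr_ae ?_
  filter_upwards [χ.coeFn_toLp 2 volume,
    (isSymbol_japan (show -s ≤ 0 by linarith)).coe_mulOp F] with ξ h1 h2
  rw [h1, h2]
  rfl

theorem synth_apply_eq_pairS {s : ℝ} (hs : 0 ≤ s) (G : L2) (ψ : 𝓢(ℝ, ℂ)) :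
    synth s G ψ = pairS s (𝓕⁻ ψ) G := by rw [synth_apply, pairS_apply hs]

/-- The Schwartz function `(1 + ξ²) χ`; the additional factor compensates for symbols that grow
quadratically. -/
def raise (χ : 𝓢(ℝ, ℂ)) : 𝓢(ℝ, ℂ) := SchwartzMap.smulLeftCLM ℂ (fun ξ : ℝ => (japan 2 ξ : ℂ)) χ

theorem raise_apply (χ : 𝓢(ℝ, ℂ)) (ξ : ℝ) : raise χ ξ = japan 2 ξ * χ ξ := by
  rw [raise, SchwartzMap.smulLeftCLM_apply_apply (hasTemperateGrowth_japan 2), smul_eq_mul]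

theorem pairS_raise {s : ℝ} (hs : 0 ≤ s) (χ : 𝓢(ℝ, ℂ)) {m : ℝ → ℂ} {C : ℝ} (hm : IsSymbol m C)
    (F : L2) : pairS s (raise χ) (mulOp m F) =
      ∫ ξ, (m ξ * japan 2 ξ) * χ ξ * (japan (-s) ξ * F ξ) := by
  rw [pairS_apply hs]
  refine integral_congr_ae ?_
  filter_upwards [hm.coe_mulOp F] with ξ h
  rw [h, raise_apply]
  ring

theorem japan_two (ξ : ℝ) : japan 2 ξ = 1 + ξ ^ 2 := by simp [japan]

theorem japan_neg_two_mul (ξ : ℝ) : (japan (-2) ξ : ℂ) * japan 2 ξ = 1 := by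
  exact_mod_cast japan_neg_mul 2 ξ

/-- The symbol `-(2πξ)²` of the second derivative, normalized to be bounded. -/
def lapSymb (ξ : ℝ) : ℂ := -((2 * Real.pi * ξ) ^ 2 : ℝ) * japan (-2) ξ

/-- The symbol of `(1 - ∂ₓ²) ^ (-1/2)`, multiplied by `(1 + ξ²)⁻¹`. -/
def invSymb (ξ : ℝ) : ℂ := ((1 + (2 * Real.pi * ξ) ^ 2) ^ (-1 / 2 : ℝ) : ℝ) * japan (-2) ξ

theorem measurable_invSqrt :
    Measurable fun ξ : ℝ => (1 + (2 * Real.pi * ξ) ^ 2) ^ (-1 / 2 : ℝ) :=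
  (Continuous.rpow_const (by fun_prop) fun ξ => Or.inl (by positivity)).measurable

theorem isSymbol_lapSymb : IsSymbol lapSymb ((2 * Real.pi) ^ 2) := by
  refine ⟨by unfold lapSymb; fun_prop, fun ξ => ?_⟩
  rw [lapSymb, norm_mul, norm_neg, Complex.norm_real, Complex.norm_real, Real.norm_eq_abs,
    Real.norm_eq_abs, abs_of_pos (japan_pos _ _), abs_of_nonneg (sq_nonneg _), mul_pow, mul_assoc]
  refine mul_le_of_le_one_right (by positivity) ?_
  rw [← japan_neg_mul 2 ξ, mul_comm, japan_two]
  have := (japan_pos (-2) ξ).le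
  gcongr
  linarith

theorem isSymbol_invSymb : IsSymbol invSymb 1 := by
  refine ⟨by
    unfold invSymb
    have := measurable_invSqrt
    fun_prop, fun ξ => ?_⟩
  rw [invSymb, norm_mul, Complex.norm_real, Complex.norm_real, Real.norm_eq_abs,
    Real.norm_eq_abs, abs_of_pos (japan_pos _ _), abs_of_nonneg (by positivity)]
  refine mul_le_one₀ ?_ (japan_pos _ _).le (japan_le_one (by norm_num) ξ)
  exact Real.rpow_le_one_of_one_le_of_nonpos (one_le_one_add_sq _) (by norm_num)

theorem linSymb_mul (μ ξ : ℝ) :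
    (linSymb μ ξ : ℂ) * japan (-2) ξ = lapSymb ξ + μ * invSymb ξ := by
  rw [linSymb, lapSymb, invSymb]
  push_cast
  ring

section Generator

variable {μ s : ℝ}

/-- The symbol `p (1 + ξ²)⁻¹`, where `p` is the symbol of the linear part. -/
def genSymb (μ ξ : ℝ) : ℂ := lapSymb ξ + μ * invSymb ξ

theorem isSymbol_genSymb (hμ : 0 < μ) : IsSymbol (genSymb μ) ((2 * Real.pi) ^ 2 + μ) := by
  refine ⟨isSymbol_lapSymb.1.add (isSymbol_invSymb.1.const_mul _), fun ξ => ?_⟩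
  refine (norm_add_le _ _).trans (add_le_add (isSymbol_lapSymb.2 ξ) ?_)
  rw [norm_mul, Complex.norm_real, Real.norm_eq_abs, abs_of_pos hμ]
  exact mul_le_of_le_one_right hμ.le (isSymbol_invSymb.2 ξ)

theorem mulOp_genSymb (hμ : 0 < μ) (F : L2) :
    mulOp (genSymb μ) F = mulOp lapSymb F + μ • mulOp invSymb F := by
  ext1
  filter_upwards [(isSymbol_genSymb hμ).coe_mulOp F, isSymbol_lapSymb.coe_mulOp F,
    isSymbol_invSymb.coe_mulOp F, Lp.coeFn_add (mulOp lapSymb F) (μ • mulOp invSymb F),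
    Lp.coeFn_smul μ (mulOp invSymb F)] with ξ h1 h2 h3 h4 h5
  rw [h1, h4, Pi.add_apply, h2, h5, Pi.smul_apply, h3, genSymb, Complex.real_smul]
  ring

/-- The difference quotient of the semigroup, multiplied by `(1 + ξ²)⁻¹`. -/
def quotSymb (μ r ξ : ℝ) : ℂ := (r⁻¹ : ℝ) * (heatSymb μ r ξ - 1) * japan (-2) ξ

theorem abs_exp_sub_one_le {y m : ℝ} (hm : 0 ≤ m) (hy : y ≤ m) :
    |Real.exp y - 1| ≤ |y| * Real.exp m := by
  have h1 := Real.one_le_exp hm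
  rcases le_total 0 y with h | h
  · rw [abs_of_nonneg (by linarith [Real.one_le_exp h]), abs_of_nonneg h]
    have h2 := Real.add_one_le_exp (-y)
    have h3 : Real.exp y * Real.exp (-y) = 1 := by rw [← Real.exp_add]; simp
    have h4 : Real.exp y - 1 ≤ y * Real.exp y := by nlinarith [Real.exp_pos y]
    exact h4.trans (by gcongr)
  · rw [abs_of_nonpos (by linarith [Real.exp_le_one_iff.mpr h]), abs_of_nonpos h]
    nlinarith [Real.add_one_le_exp y]

theorem isSymbol_quotSymb (hμ : 0 < μ) {r : ℝ} (hr : r ∈ Ioo (0 : ℝ) 1) :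
    IsSymbol (quotSymb μ r) (((2 * Real.pi) ^ 2 + μ) * Real.exp μ) := by
  refine ⟨by unfold quotSymb; fun_prop, fun ξ => ?_⟩
  have h1 : ‖heatSymb μ r ξ - 1‖ ≤ r * |linSymb μ ξ| * Real.exp μ := by
    rw [heatSymb, ← Complex.ofReal_one, ← Complex.ofReal_sub, Complex.norm_real, Real.norm_eq_abs]
    have h2 : r * linSymb μ ξ ≤ μ := by
      have h3 := linSymb_le hμ ξ
      have h4 : linSymb μ ξ ≤ μ := by nlinarith [sq_nonneg (2 * Real.pi * ξ)]
      nlinarith [mul_le_mul_of_nonneg_left h4 hr.1.le, hr.2]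
    refine (abs_exp_sub_one_le hμ.le h2).trans (le_of_eq ?_)
    rw [abs_mul, abs_of_pos hr.1]
  have h5 : |linSymb μ ξ| * japan (-2) ξ ≤ (2 * Real.pi) ^ 2 + μ := by
    have h6 := (isSymbol_genSymb hμ).2 ξ
    rwa [genSymb, ← linSymb_mul, norm_mul, Complex.norm_real, Complex.norm_real, Real.norm_eq_abs,
      Real.norm_eq_abs, abs_of_pos (japan_pos _ _)] at h6
  rw [quotSymb, norm_mul, norm_mul, Complex.norm_real, Complex.norm_real, Real.norm_eq_abs,
    Real.norm_eq_abs, abs_of_pos (japan_pos _ _), abs_of_pos (inv_pos.mpr hr.1)]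
  have h7 := (japan_pos (-2) ξ).le
  have h8 := (inv_pos.mpr hr.1).le
  calc r⁻¹ * ‖heatSymb μ r ξ - 1‖ * japan (-2) ξ
      ≤ r⁻¹ * (r * |linSymb μ ξ| * Real.exp μ) * japan (-2) ξ := by gcongr
    _ = |linSymb μ ξ| * japan (-2) ξ * Real.exp μ := by
        have := hr.1.ne'
        field_simp
    _ ≤ _ := by gcongr

theorem tendsto_quotSymb (μ ξ : ℝ) :
    Tendsto (fun r => quotSymb μ r ξ) (𝓝[>] 0) (𝓝 (genSymb μ ξ)) := by
  have h1 : HasDerivAt (fun r : ℝ => Real.exp (r * linSymb μ ξ)) (linSymb μ ξ) 0 := by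
    have h := ((hasDerivAt_id (0 : ℝ)).mul_const (linSymb μ ξ)).exp
    simpa using h
  have h2 := h1.tendsto_slope_zero_right
  simp only [zero_add, zero_mul, Real.exp_zero, smul_eq_mul] at h2
  have h3 := ((Complex.continuous_ofReal.tendsto _).comp h2).mul_const (japan (-2) ξ : ℂ)
  rw [genSymb, ← linSymb_mul]
  refine h3.congr fun r => ?_
  rw [quotSymb, heatSymb, Function.comp_apply]
  push_cast
  ring

/-- The generator of the semigroup, tested against a Schwartz function. The symbols of the difference
quotients are bounded uniformly after division by `1 + ξ²`. -/
theorem tendsto_pairS_heat (hμ : 0 < μ) (hs : 0 ≤ s) (χ : 𝓢(ℝ, ℂ)) (F : L2) :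
    Tendsto (fun r => r⁻¹ • (pairS s χ (heat μ r F) - pairS s χ F)) (𝓝[>] 0)
      (𝓝 (pairS s (raise χ) (mulOp (genSymb μ) F))) := by
  have hC : (2 * Real.pi) ^ 2 + μ ≤ ((2 * Real.pi) ^ 2 + μ) * Real.exp μ :=
    le_mul_of_one_le_right (by positivity) (Real.one_le_exp hμ.le)
  have h1 := tendsto_mulOp (l := 𝓝[>] (0 : ℝ)) (m := quotSymb μ) (m₀ := genSymb μ)
    (C := ((2 * Real.pi) ^ 2 + μ) * Real.exp μ)
    (by filter_upwards [Ioo_mem_nhdsGT (show (0 : ℝ) < 1 by norm_num)] with r hr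
        exact isSymbol_quotSymb hμ hr)
    ⟨(isSymbol_genSymb hμ).1, fun ξ => ((isSymbol_genSymb hμ).2 ξ).trans hC⟩
    (Eventually.of_forall fun ξ => tendsto_quotSymb μ ξ) F
  refine (((pairS s (raise χ)).continuous.tendsto _).comp h1).congr' ?_
  filter_upwards [Ioo_mem_nhdsGT (show (0 : ℝ) < 1 by norm_num)] with r hr
  have hq := isSymbol_quotSymb hμ hr
  have hh := isSymbol_heatSymb hμ hr.1.le
  rw [Function.comp_apply, ← map_sub, ← map_smul, pairS_raise hs χ hq, pairS_apply hs]
  refine integral_congr_ae ?_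
  filter_upwards [Lp.coeFn_smul r⁻¹ (heat μ r F - F), Lp.coeFn_sub (heat μ r F) F,
    hh.coe_mulOp F] with ξ h2 h3 h4
  rw [h2, Pi.smul_apply, h3, Pi.sub_apply, heat, h4, quotSymb, Complex.real_smul]
  linear_combination (((r⁻¹ : ℝ) : ℂ) * (heatSymb μ r ξ - 1) * χ ξ * (japan (-s) ξ * F ξ)) *
    japan_neg_two_mul ξ

end Generator

theorem integrable_mul_bcf {m : ℝ → ℂ} (hm : Integrable m) (y : BCF) :
    Integrable fun ξ => m ξ * y ξ :=
  hm.mul_bdd (c := ‖y‖) y.continuous.aestronglyMeasurable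
    (Eventually.of_forall y.norm_coe_le_norm)

/-- The integral of a bounded continuous function against an integrable one. -/
def bcfPair (m : ℝ → ℂ) (hm : Integrable m) : BCF →L[ℝ] ℂ :=
  LinearMap.mkContinuous
    { toFun := fun y => ∫ ξ, m ξ * y ξ
      map_add' := fun y y' => by
        rw [← integral_add (integrable_mul_bcf hm y) (integrable_mul_bcf hm y')]
        simp [mul_add]
      map_smul' := fun r y => by
        rw [RingHom.id_apply, ← integral_smul]
        refine integral_congr_ae (Eventually.of_forall fun ξ => ?_)
        simp only [BoundedContinuousFunction.smul_apply, Complex.real_smul]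
        ring }
    (∫ ξ, ‖m ξ‖) fun y => by
      change ‖∫ ξ, m ξ * y ξ‖ ≤ (∫ ξ, ‖m ξ‖) * ‖y‖
      rw [← integral_mul_const]
      refine norm_integral_le_of_norm_le (hm.norm.mul_const _) (Eventually.of_forall fun ξ => ?_)
      rw [norm_mul]
      gcongr
      exact y.norm_coe_le_norm ξ

theorem bcfPair_apply {m : ℝ → ℂ} (hm : Integrable m) (y : BCF) :
    bcfPair m hm y = ∫ ξ, m ξ * y ξ := rfl

theorem norm_bcfPair_le {m : ℝ → ℂ} (hm : Integrable m) : ‖bcfPair m hm‖ ≤ ∫ ξ, ‖m ξ‖ :=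
  LinearMap.mkContinuous_norm_le _ (integral_nonneg fun _ => norm_nonneg _) _

/-! ### The mild solution solves the equation -/

section Solves

variable {μ s T : ℝ} (hμ : 0 < μ) (hs : 1 / 2 < s) (hT : 0 < T)

/-- The density of the functional `y ↦ ⟨kerU r y, χ⟩`; it makes sense down to `r = 0`, and negative
`r` are treated as `0`. -/
def fluxDensity (μ s : ℝ) (χ : 𝓢(ℝ, ℂ)) (r ξ : ℝ) : ℂ :=
  (1 / 2 : ℂ) * χ ξ * japan (-exc s) ξ * heatSymb μ (max r 0) ξ

theorem norm_fluxDensity_le (hμ : 0 < μ) (χ : 𝓢(ℝ, ℂ)) {r : ℝ} (hr : r ≤ 1) (ξ : ℝ) :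
    ‖fluxDensity μ s χ r ξ‖ ≤ Real.exp μ * ‖χ ξ‖ := by
  have h1 := (isSymbol_bessel s).2 ξ
  have h2 : ‖heatSymb μ (max r 0) ξ‖ ≤ Real.exp μ :=
    ((isSymbol_heatSymb hμ (le_max_right r 0)).2 ξ).trans
      (Real.exp_le_exp.mpr (mul_le_of_le_one_right hμ.le (max_le hr zero_le_one)))
  rw [fluxDensity, norm_mul, norm_mul, norm_mul]
  calc ‖(1 / 2 : ℂ)‖ * ‖χ ξ‖ * ‖(japan (-exc s) ξ : ℂ)‖ * ‖heatSymb μ (max r 0) ξ‖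
      ≤ 1 * ‖χ ξ‖ * 1 * Real.exp μ := by
        gcongr
        norm_num
    _ = _ := by ring

theorem integrable_fluxDensity (hμ : 0 < μ) (χ : 𝓢(ℝ, ℂ)) (r : ℝ) :
    Integrable (fluxDensity μ s χ r) := by
  have h := (isSymbol_heatSymb hμ (le_max_right r 0))
  have h1 : Integrable fun ξ => (1 / 2 : ℂ) * χ ξ * japan (-exc s) ξ :=
    (χ.integrable.const_mul _).mul_bdd (c := 1) (isSymbol_bessel s).1.aestronglyMeasurable
      (Eventually.of_forall (isSymbol_bessel s).2)
  exact h1.mul_bdd h.1.aestronglyMeasurable (Eventually.of_forall h.2)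

/-- The functional `y ↦ ⟨kerU r y, χ⟩`, extended to `r = 0`. -/
def flux (hμ : 0 < μ) (s : ℝ) (χ : 𝓢(ℝ, ℂ)) (r : ℝ) : BCF →L[ℝ] ℂ :=
  bcfPair _ (integrable_fluxDensity (s := s) hμ χ r)

theorem pairS_kerU_op (χ : 𝓢(ℝ, ℂ)) {r : ℝ} (hr : 0 < r) (y : BCF) :
    pairS s χ ((kerU hμ hs hT).op r y) = flux hμ s χ r y := by
  rw [pairS_apply (by linarith), flux, bcfPair_apply]
  refine integral_congr_ae ?_
  filter_upwards [coe_kerU_op hμ hs hT hr y] with ξ h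
  rw [h, fluxDensity, max_eq_left hr.le, show -exc s = -s + ord s by rw [exc]; ring, japan_add]
  push_cast
  ring

theorem norm_flux_le (χ : 𝓢(ℝ, ℂ)) {r : ℝ} (hr : r ≤ 1) :
    ‖flux hμ s χ r‖ ≤ ∫ ξ, Real.exp μ * ‖χ ξ‖ :=
  (norm_bcfPair_le _).trans (integral_mono (integrable_fluxDensity hμ χ r).norm
    (χ.integrable.norm.const_mul _) fun ξ => norm_fluxDensity_le hμ χ hr ξ)

theorem tendsto_flux (χ : 𝓢(ℝ, ℂ)) (y : BCF) :
    Tendsto (fun r => flux hμ s χ r y) (𝓝[>] 0) (𝓝 (flux hμ s χ 0 y)) := by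
  simp only [flux, bcfPair_apply]
  refine tendsto_integral_filter_of_dominated_convergence
    (fun ξ => Real.exp μ * ‖χ ξ‖ * ‖y‖) (Eventually.of_forall fun r =>
      (integrable_mul_bcf (integrable_fluxDensity hμ χ r) y).aestronglyMeasurable) ?_
    ((χ.integrable.norm.const_mul _).mul_const _) (Eventually.of_forall fun ξ => ?_)
  · filter_upwards [Ioo_mem_nhdsGT (show (0 : ℝ) < 1 by norm_num)] with r hr
    refine Eventually.of_forall fun ξ => ?_
    rw [norm_mul]
    gcongr
    · exact norm_fluxDensity_le hμ χ hr.2.le ξ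
    · exact y.norm_coe_le_norm ξ
  · refine Tendsto.mul_const _ (Tendsto.const_mul _ ?_)
    have h : Continuous fun r : ℝ => heatSymb μ (max r 0) ξ :=
      (continuous_heatSymb μ ξ).comp (continuous_id.max continuous_const)
    exact (h.tendsto 0).mono_left nhdsWithin_le_nhds

/-- The functional at `r = 0` is the pairing with the square of the derivative. -/
theorem flux_zero_nlin (ψ : 𝓢(ℝ, ℂ)) {t : ℝ} (ht : 0 < t) (z : L2) :
    t ^ (-(1 - ord s)) • flux hμ s (𝓕⁻ ψ) 0 (nlin s z z) =
      (1 / 2 : ℂ) * ∫ x, ψ x * (derivL2 s t z x) ^ 2 := by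
  have h1 : flux hμ s (𝓕⁻ ψ) 0 (nlin s z z) =
      (1 / 2 : ℂ) * ∫ x, ψ x * ((𝓕⁻ (besselOp (exc s) z) : L2) x) ^ 2 := by
    have h2 := integral_mul_convL2 (𝓕⁻ ψ) (besselOp (exc s) z) (besselOp (exc s) z)
    rw [FourierTransform.fourier_fourierInv_eq] at h2
    simp only [sq]
    rw [← h2, ← integral_const_mul, flux, bcfPair_apply]
    refine integral_congr_ae (Eventually.of_forall fun ξ => ?_)
    have h3 : (japan (-exc s) ξ : ℂ) * japan (exc s) ξ = 1 := by
      exact_mod_cast japan_neg_mul (exc s) ξ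
    simp only [nlin, prodBilin_apply, fluxDensity, max_self, heatSymb, zero_mul, Real.exp_zero,
      Complex.ofReal_one, mul_one]
    linear_combination ((1 / 2 : ℂ) * (𝓕⁻ ψ) ξ *
      convL2 (besselOp (exc s) z) (besselOp (exc s) z) ξ) * h3
  rw [h1, Complex.real_smul, mul_left_comm, ← integral_const_mul]
  congr 1
  refine integral_congr_ae ?_
  have h4 : derivL2 s t z = t ^ (-weightExp s) • (𝓕⁻ (besselOp (exc s) z) : L2) := by
    exact map_smul ((fourierInvL2 : L2 →L[ℝ] L2)) _ _
  filter_upwards [Lp.coeFn_smul (t ^ (-weightExp s)) (𝓕⁻ (besselOp (exc s) z) : L2)] with x h5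
  rw [h4, h5, Pi.smul_apply, Complex.real_smul, mul_pow, ← Complex.ofReal_pow,
    ← Real.rpow_natCast, ← Real.rpow_mul ht.le, weightExp_eq,
    show -((1 - ord s) / 2) * ((2 : ℕ) : ℝ) = -(1 - ord s) by push_cast; ring]
  ring

/-- The Fourier side curve `(1 + ξ²) ^ (s / 2) û` of a mild solution with nonlinearity `g`. -/
def mildCurve (G : L2) (g : C(Icc (0 : ℝ) T, BCF)) : C(Icc (0 : ℝ) T, L2) :=
  linG hμ T G + (kerU hμ hs hT).duh g

theorem mildCurve_eq (G : L2) (g : C(Icc (0 : ℝ) T, BCF)) {t : ℝ} (ht : t ∈ Ioc 0 T) :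
    mildCurve hμ hs hT G g ⟨t, ht.1.le, ht.2⟩ = heat μ t G + (kerU hμ hs hT).conv g t := by
  rw [mildCurve, ContinuousMap.add_apply, linG_apply,
    duhU_apply hμ hs hT g (t := ⟨t, ht.1.le, ht.2⟩) ht]

/-- A mild solution can be restarted at a positive time. -/
theorem mildCurve_add (G : L2) (g : C(Icc (0 : ℝ) T, BCF)) {t r : ℝ} (ht : 0 < t) (hr : 0 ≤ r)
    (htr : t + r ≤ T) :
    mildCurve hμ hs hT G g (projIcc 0 T hT.le (t + r)) =
      heat μ r (mildCurve hμ hs hT G g (projIcc 0 T hT.le t)) +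
        ∫ τ in t..t + r, (kerU hμ hs hT).rate g (t + r) τ := by
  rw [projIcc_of_mem hT.le ⟨by linarith, htr⟩, projIcc_of_mem hT.le ⟨ht.le, by linarith⟩,
    mildCurve_eq hμ hs hT G g ⟨by linarith, htr⟩, mildCurve_eq hμ hs hT G g ⟨ht, by linarith⟩,
    (kerU hμ hs hT).conv_add (kerU_op_add hμ hs hT) g ht hr htr, map_add, ← add_assoc,
    heat_add hμ ht.le hr]

/-- Tested against a Schwartz function, a mild solution is differentiable in time. The restarted
Duhamel formula gives the right derivative, which is continuous. -/
theorem hasDerivAt_pairS_mildCurve (χ : 𝓢(ℝ, ℂ)) (G : L2) (g : C(Icc (0 : ℝ) T, BCF)) {t : ℝ}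
    (ht : t ∈ Ioo 0 T) :
    HasDerivAt (fun τ => pairS s χ (mildCurve hμ hs hT G g (projIcc 0 T hT.le τ)))
      (pairS s (raise χ) (mulOp (genSymb μ) (mildCurve hμ hs hT G g (projIcc 0 T hT.le t))) +
        t ^ (-(1 - ord s)) • flux hμ s χ 0 (g (projIcc 0 T hT.le t))) t := by
  set U : ℝ → L2 := fun τ => mildCurve hμ hs hT G g (projIcc 0 T hT.le τ) with hU
  have hUc : Continuous U := (mildCurve hμ hs hT G g).continuous.comp continuous_projIcc
  have hsub : ∀ x ∈ Icc (t / 2) ((t + T) / 2), x ∈ Ioo 0 T := fun x hx =>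
    ⟨by linarith [hx.1, ht.1], by linarith [hx.2, ht.2]⟩
  refine hasDerivAt_of_right_deriv (a := t / 2) (b := (t + T) / 2)
    (f := fun τ => pairS s χ (U τ))
    (Q := fun τ => pairS s (raise χ) (mulOp (genSymb μ) (U τ)) +
      τ ^ (-(1 - ord s)) • flux hμ s χ 0 (g (projIcc 0 T hT.le τ)))
    ((pairS s χ).continuous.comp hUc).continuousOn ?_ ?_
    ⟨by linarith [ht.1], by linarith [ht.2]⟩
  · refine ContinuousOn.add (Continuous.continuousOn (by fun_prop)) (ContinuousOn.smul (f := fun τ : ℝ =>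
      τ ^ (-(1 - ord s))) (g := fun τ => flux hμ s χ 0 (g (projIcc 0 T hT.le τ))) ?_
      (((flux hμ s χ 0).continuous.comp (g.continuous.comp continuous_projIcc)).continuousOn))
    exact fun x hx =>
      (Real.continuousAt_rpow_const _ _ (Or.inl (hsub x hx).1.ne')).continuousWithinAt
  · intro x hx
    have hx' := hsub x ⟨hx.1, hx.2.le⟩
    rw [← hasDerivWithinAt_Ioi_iff_Ici, hasDerivWithinAt_iff_tendsto_slope' self_notMem_Ioi,
      show 𝓝[>] x = map (x + ·) (𝓝[>] 0) by rw [Filter.map_add_left_nhdsGT, add_zero],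
      tendsto_map'_iff]
    have h1 := tendsto_pairS_heat hμ (by linarith : (0 : ℝ) ≤ s) χ (U x)
    have h2 := (kerU hμ hs hT).tendsto_average_rate (pairS s χ) (flux hμ s χ)
      (fun r hr y => pairS_kerU_op hμ hs hT χ hr y)
      (M := ∫ ξ, Real.exp μ * ‖χ ξ‖) (by
        filter_upwards [Ioo_mem_nhdsGT (show (0 : ℝ) < 1 by norm_num)] with r hr
        exact norm_flux_le hμ χ hr.2.le) (tendsto_flux hμ χ) g hx'
    refine (h1.add h2).congr' ?_
    filter_upwards [Ioo_mem_nhdsGT (show (0 : ℝ) < T - x by linarith [hx'.2])] with r hr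
    have h3 : U (x + r) = _ := mildCurve_add hμ hs hT G g hx'.1 hr.1.le (by linarith [hr.2])
    rw [Function.comp_apply, slope_def_module, h3, map_add, ← smul_add, add_sub_cancel_left]
    congr 1
    change _ = pairS s χ (heat μ r (U x)) + _ - pairS s χ (U x)
    ring

/-- The generator, tested on the Fourier side, is the linear part of the equation. -/
theorem pairS_raise_genSymb (hμ : 0 < μ) (hs0 : 0 ≤ s) (ψ : 𝓢(ℝ, ℂ)) (F : L2) :
    pairS s (raise (𝓕⁻ ψ)) (mulOp (genSymb μ) F) =
      dx (dx (synth s F)) ψ + (μ : ℂ) * invSqrtOneSubLaplacian (synth s F) ψ := by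
  rw [mulOp_genSymb hμ, map_add, map_smul, pairS_raise hs0 _ isSymbol_lapSymb,
    pairS_raise hs0 _ isSymbol_invSymb, dx_dx_synth_apply, invSqrtOneSubLaplacian_synth_apply,
    Complex.real_smul]
  congr 2
  · funext ξ
    rw [lapSymb]
    linear_combination (-((2 * Real.pi * ξ) ^ 2 : ℝ) * (𝓕⁻ ψ) ξ * (japan (-s) ξ * F ξ)) *
      japan_neg_two_mul ξ
  · refine congrArg _ (funext fun ξ => ?_)
    rw [invSymb]
    linear_combination (((1 + (2 * Real.pi * ξ) ^ 2) ^ (-1 / 2 : ℝ) : ℝ) * (𝓕⁻ ψ) ξ *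
      (japan (-s) ξ * F ξ)) * japan_neg_two_mul ξ

/-- The curve of distributions attached to a mild solution solves the equation. -/
theorem solvesAt_mild {G : L2} {z : C(Icc (0 : ℝ) T, L2)} {f : ℝ → Distr}
    (hf : ∀ τ ∈ Icc 0 T, f τ =
      synth s (mildCurve hμ hs hT G (curveBilin (nlin s) z z) (projIcc 0 T hT.le τ)))
    {t : ℝ} (ht : t ∈ Ioo 0 T)
    (hdx : dx (f t) = (derivL2 s t (z (projIcc 0 T hT.le t)) : L2)) : SolvesAt μ f t := by
  refine ⟨_, hdx, fun ψ => ?_⟩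
  have h1 := hasDerivAt_pairS_mildCurve hμ hs hT (𝓕⁻ ψ) G (curveBilin (nlin s) z z) ht
  rw [pairS_raise_genSymb hμ (by linarith), curveBilin_apply, flux_zero_nlin hμ ψ ht.1,
    ← hf t ⟨ht.1.le, ht.2.le⟩] at h1
  refine h1.congr_of_eventuallyEq ?_
  filter_upwards [Icc_mem_nhds ht.1 ht.2] with τ hτ
  rw [hf τ hτ, synth_apply_eq_pairS (by linarith)]

end Solves

/-! ### Uniqueness: the backward heat flow of a test function -/

theorem contDiff_linSymb (μ : ℝ) : ContDiff ℝ ∞ (linSymb μ) := by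
  unfold linSymb
  refine ContDiff.add (by fun_prop) (contDiff_const.mul (ContDiff.rpow_const_of_ne (by fun_prop)
    fun ξ => ?_))
  positivity

theorem contDiff_heatSymb (μ r : ℝ) : ContDiff ℝ ∞ (heatSymb μ r) :=
  Complex.ofRealCLM.contDiff.comp (contDiff_const.mul (contDiff_linSymb μ)).exp

section HeatTest

variable {h : ℝ → ℂ}

/-- The test function `h e^{rp}`, for a smooth compactly supported `h`; here `r` may have any sign. -/
def heatTest (hc : HasCompactSupport h) (hd : ContDiff ℝ ∞ h) (μ r : ℝ) : 𝓢(ℝ, ℂ) :=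
  HasCompactSupport.toSchwartzMap (f := fun ξ => h ξ * heatSymb μ r ξ) hc.mul_right
    (hd.mul (contDiff_heatSymb μ r))

theorem heatTest_apply (hc : HasCompactSupport h) (hd : ContDiff ℝ ∞ h) (μ r ξ : ℝ) :
    heatTest hc hd μ r ξ = h ξ * heatSymb μ r ξ := rfl

theorem hasCompactSupport_linSymb_mul (hc : HasCompactSupport h) (μ : ℝ) :
    HasCompactSupport fun ξ => (linSymb μ ξ : ℂ) * h ξ := hc.mul_left

theorem contDiff_linSymb_mul (hd : ContDiff ℝ ∞ h) (μ : ℝ) :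
    ContDiff ℝ ∞ fun ξ => (linSymb μ ξ : ℂ) * h ξ :=
  (Complex.ofRealCLM.contDiff.comp (contDiff_linSymb μ)).mul hd

/-- The time derivative of `heatTest` in `L²`. Since `h` has compact support, the symbol `p` may be cut
off, and the difference quotients are given by bounded symbols that converge pointwise. -/
theorem hasDerivAt_heatTest (hc : HasCompactSupport h) (hd : ContDiff ℝ ∞ h) (μ r : ℝ) :
    HasDerivAt (fun r => (heatTest hc hd μ r).toLp 2 volume)
      ((heatTest (hasCompactSupport_linSymb_mul hc μ) (contDiff_linSymb_mul hd μ) μ r).toLp 2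
        volume) r := by
  obtain ⟨n, hn⟩ : ∃ n : ℝ, ∀ ξ, n < |ξ| → h ξ = 0 := by
    obtain ⟨n, hn⟩ := hc.isCompact.isBounded.subset_closedBall 0
    refine ⟨n, fun ξ hξ => image_eq_zero_of_notMem_tsupport fun h' => ?_⟩
    have := hn h'
    rw [mem_closedBall_zero_iff, Real.norm_eq_abs] at this
    linarith
  obtain ⟨P, hP⟩ := (isCompact_Icc (a := -n) (b := n)).exists_bound_of_continuousOn
    (contDiff_linSymb μ).continuous.continuousOn
  have hP0 : 0 ≤ |P| := abs_nonneg P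
  have hP' : ∀ ξ, |ξ| ≤ n → |linSymb μ ξ| ≤ |P| := fun ξ hξ =>
    (hP ξ (abs_le.mp hξ)).trans (le_abs_self P)
  -- the symbols of the difference quotients, cut off to the support of `h`
  set C : ℝ := Real.exp ((|r| + 1) * |P|) * (|P| * Real.exp |P|) with hC
  have hC1 : |P| * Real.exp ((|r| + 1) * |P|) ≤ C := by
    rw [hC, mul_comm |P|]
    gcongr
    exact le_mul_of_one_le_right hP0 (Real.one_le_exp hP0)
  have hexp : ∀ ξ, |ξ| ≤ n → Real.exp (r * linSymb μ ξ) ≤ Real.exp ((|r| + 1) * |P|) := by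
    intro ξ hξ
    refine Real.exp_le_exp.mpr ((le_abs_self _).trans ?_)
    rw [abs_mul]
    have := hP' ξ hξ
    gcongr
    linarith
  have hslope : ∀ᶠ r' in 𝓝[≠] r, IsSymbol (fun ξ => cutSymb n ξ * ((r' - r)⁻¹ : ℝ) *
      (heatSymb μ r' ξ - heatSymb μ r ξ)) C := by
    have h1 : ∀ᶠ r' in 𝓝[≠] r, |r' - r| < 1 := by
      refine nhdsWithin_le_nhds (Metric.ball_mem_nhds r one_pos |> mem_of_superset <| ?_)
      intro x hx
      rwa [Metric.mem_ball, Real.dist_eq] at hx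
    filter_upwards [h1, self_mem_nhdsWithin] with r' h1 h2
    have h3 : 0 < |r' - r| := abs_pos.mpr (sub_ne_zero.mpr h2)
    refine ⟨?_, fun ξ => ?_⟩
    · have := (isSymbol_cutSymb n).1
      fun_prop
    · rcases le_or_gt |ξ| n with hξ | hξ
      · have h4 : heatSymb μ r' ξ - heatSymb μ r ξ = ((Real.exp (r * linSymb μ ξ) *
            (Real.exp ((r' - r) * linSymb μ ξ) - 1) : ℝ) : ℂ) := by
          rw [heatSymb, heatSymb, mul_sub, ← Real.exp_add, ← Complex.ofReal_sub]
          congr 3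
          · ring_nf
          · ring
        have h5 : |(r' - r) * linSymb μ ξ| ≤ |r' - r| * |P| := by
          rw [abs_mul]
          exact mul_le_mul_of_nonneg_left (hP' ξ hξ) h3.le
        have h6 : (r' - r) * linSymb μ ξ ≤ |P| :=
          (le_abs_self _).trans (h5.trans (mul_le_of_le_one_left hP0 h1.le))
        rw [cutSymb_of_le hξ, one_mul, h4, norm_mul, Complex.norm_real, Complex.norm_real,
          Real.norm_eq_abs, Real.norm_eq_abs, abs_inv, abs_mul, Real.abs_exp]
        calc |r' - r|⁻¹ * (Real.exp (r * linSymb μ ξ) *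
              |Real.exp ((r' - r) * linSymb μ ξ) - 1|)
            ≤ |r' - r|⁻¹ * (Real.exp ((|r| + 1) * |P|) * (|r' - r| * |P| * Real.exp |P|)) := by
              refine mul_le_mul_of_nonneg_left (mul_le_mul (hexp ξ hξ) ?_ (abs_nonneg _)
                (Real.exp_pos _).le) (inv_nonneg.mpr h3.le)
              exact (abs_exp_sub_one_le hP0 h6).trans
                (mul_le_mul_of_nonneg_right h5 (Real.exp_pos _).le)
          _ = C := by
              rw [hC]
              field_simp
      · rw [cutSymb_of_lt hξ, zero_mul, zero_mul, norm_zero]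
        positivity
  have hlimit : IsSymbol (fun ξ => cutSymb n ξ * linSymb μ ξ * heatSymb μ r ξ) C := by
    refine ⟨?_, fun ξ => ?_⟩
    · have := (isSymbol_cutSymb n).1
      have := (contDiff_linSymb μ).continuous.measurable
      fun_prop
    · rcases le_or_gt |ξ| n with hξ | hξ
      · rw [cutSymb_of_le hξ, one_mul, norm_mul, norm_heatSymb, Complex.norm_real,
          Real.norm_eq_abs]
        exact (mul_le_mul (hP' ξ hξ) (hexp ξ hξ) (Real.exp_pos _).le hP0).trans hC1
      · rw [cutSymb_of_lt hξ, zero_mul, zero_mul, norm_zero]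
        positivity
  have hlim : Tendsto (fun r' => mulOp (fun ξ => cutSymb n ξ * ((r' - r)⁻¹ : ℝ) *
      (heatSymb μ r' ξ - heatSymb μ r ξ)) ((heatTest hc hd μ 0).toLp 2 volume)) (𝓝[≠] r)
      (𝓝 (mulOp (fun ξ => cutSymb n ξ * linSymb μ ξ * heatSymb μ r ξ)
        ((heatTest hc hd μ 0).toLp 2 volume))) := by
    refine tendsto_mulOp hslope hlimit (Eventually.of_forall fun ξ => ?_) _
    have h1 : HasDerivAt (fun r : ℝ => heatSymb μ r ξ) (linSymb μ ξ * heatSymb μ r ξ) r := by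
      have h2 := (((hasDerivAt_id r).mul_const (linSymb μ ξ)).exp).ofReal_comp
      refine h2.congr_deriv ?_
      simp [heatSymb, mul_comm]
    have h3 := (hasDerivAt_iff_tendsto_slope.mp h1).const_mul (cutSymb n ξ)
    rw [← mul_assoc] at h3
    refine h3.congr fun r' => ?_
    rw [slope_def_module, Complex.real_smul, mul_assoc]
  have hcut : ∀ ξ, cutSymb n ξ * h ξ = h ξ := fun ξ => by
    rcases le_or_gt |ξ| n with hξ | hξ
    · rw [cutSymb_of_le hξ, one_mul]
    · rw [hn ξ hξ, mul_zero]
  rw [hasDerivAt_iff_tendsto_slope]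
  have h0 : ∀ ξ, heatSymb μ 0 ξ = 1 := fun ξ => by simp [heatSymb]
  convert hlim.congr' ?_ using 2
  · ext1
    filter_upwards [hlimit.coe_mulOp ((heatTest hc hd μ 0).toLp 2 volume),
      (heatTest hc hd μ 0).coeFn_toLp 2 volume,
      (heatTest (hasCompactSupport_linSymb_mul hc μ) (contDiff_linSymb_mul hd μ) μ r).coeFn_toLp 2
        volume] with ξ h1 h2 h3
    rw [h1, h2, h3, heatTest_apply, heatTest_apply, h0]
    linear_combination (-(linSymb μ ξ * heatSymb μ r ξ)) * hcut ξ
  · filter_upwards [hslope] with r' hr'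
    ext1
    filter_upwards [hr'.coe_mulOp ((heatTest hc hd μ 0).toLp 2 volume),
      (heatTest hc hd μ 0).coeFn_toLp 2 volume, (heatTest hc hd μ r').coeFn_toLp 2 volume,
      (heatTest hc hd μ r).coeFn_toLp 2 volume,
      Lp.coeFn_smul (r' - r)⁻¹ ((heatTest hc hd μ r').toLp 2 volume -
        (heatTest hc hd μ r).toLp 2 volume),
      Lp.coeFn_sub ((heatTest hc hd μ r').toLp 2 volume) ((heatTest hc hd μ r).toLp 2 volume)]
      with ξ h1 h2 h3 h4 h5 h6
    rw [slope_def_module, h1, h2, h5, Pi.smul_apply, h6, Pi.sub_apply, h3, h4, heatTest_apply,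
      heatTest_apply, heatTest_apply, h0, Complex.real_smul]
    linear_combination (((r' - r)⁻¹ : ℝ) * (heatSymb μ r' ξ - heatSymb μ r ξ)) * hcut ξ

end HeatTest

/-- The product rule for a bilinear pairing in which the second factor is differentiable only
after pairing with the value of the first. -/
theorem hasDerivAt_bilin {E F G : Type*} [NormedAddCommGroup E] [NormedSpace ℝ E]
    [NormedAddCommGroup F] [NormedSpace ℝ F] [NormedAddCommGroup G] [NormedSpace ℝ G]
    (B : E →L[ℝ] F →L[ℝ] G) {A : ℝ → E} {A' : E} {f : ℝ → F} {w : G} {t : ℝ}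
    (hA : HasDerivAt A A' t) (hf : ContinuousAt f t) (hw : HasDerivAt (fun τ => B (A t) (f τ)) w t) :
    HasDerivAt (fun τ => B (A τ) (f τ)) (B A' (f t) + w) t := by
  rw [hasDerivAt_iff_tendsto_slope] at hA hw ⊢
  have h1 := ((B.isBoundedBilinearMap.continuous.tendsto (A', f t)).comp
    (hA.prodMk_nhds (hf.tendsto.mono_left nhdsWithin_le_nhds))).add hw
  refine h1.congr fun τ => ?_
  simp only [Function.comp_apply, slope_def_module, map_smul, map_sub,
    smul_apply, sub_apply]
  rw [← smul_add, sub_add_sub_cancel]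

/-- The pairing `pairS` as a bilinear map on `L²`. -/
def pairB (s : ℝ) : L2 →L[ℝ] L2 →L[ℝ] ℂ :=
  ((ContinuousLinearMap.mul ℝ ℂ).lpPairing volume 2 2).bilinearComp (ContinuousLinearMap.id ℝ L2)
    (mulOp fun ξ => japan (-s) ξ)

theorem pairB_toLp (s : ℝ) (χ : 𝓢(ℝ, ℂ)) (F : L2) :
    pairB s (χ.toLp 2 volume) F = pairS s χ F := by
  rw [pairB, pairS, ContinuousLinearMap.bilinearComp_apply, ContinuousLinearMap.comp_apply,
    ContinuousLinearMap.id_apply]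

/-- Applying the generator to the tested function amounts to multiplying the test function by `p`. -/
theorem pairS_raise_heatTest {μ s : ℝ} {h : ℝ → ℂ} (hμ : 0 < μ) (hs : 0 ≤ s)
    (hc : HasCompactSupport h) (hd : ContDiff ℝ ∞ h) (r : ℝ) (F : L2) :
    pairS s (raise (heatTest hc hd μ r)) (mulOp (genSymb μ) F) =
      pairS s (heatTest (hasCompactSupport_linSymb_mul hc μ) (contDiff_linSymb_mul hd μ) μ r) F := by
  rw [pairS_raise hs _ (isSymbol_genSymb hμ), pairS_apply hs]
  refine integral_congr_ae (Eventually.of_forall fun ξ => ?_)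
  simp only [heatTest_apply]
  rw [genSymb, ← linSymb_mul]
  linear_combination (linSymb μ ξ * h ξ * heatSymb μ r ξ * (japan (-s) ξ * F ξ)) *
    japan_neg_two_mul ξ

/-- The backward heat flow of a test function cancels the linear part of the equation: for the
difference of two solutions, only the difference of the nonlinearities remains. -/
theorem hasDerivAt_pairS_heatTest {μ s : ℝ} {h : ℝ → ℂ} (hμ : 0 < μ) (hs : 0 ≤ s)
    (hc : HasCompactSupport h) (hd : ContDiff ℝ ∞ h) {f₁ f₂ : ℝ → Sob s} {t : ℝ} (t₀ : ℝ)
    (hf₁ : ContinuousAt f₁ t) (hf₂ : ContinuousAt f₂ t)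
    (h₁ : SolvesAt μ (fun τ => (f₁ τ).val) t) (h₂ : SolvesAt μ (fun τ => (f₂ τ).val) t) :
    ∃ w₁ w₂ : L2, dx (f₁ t).val = w₁ ∧ dx (f₂ t).val = w₂ ∧
      HasDerivAt (fun τ => pairS s (heatTest hc hd μ (t₀ - τ)) ((f₁ τ).hat - (f₂ τ).hat))
        ((1 / 2 : ℂ) * ∫ ξ, heatTest hc hd μ (t₀ - t) ξ *
          (convL2 (𝓕 w₁) (𝓕 w₁) - convL2 (𝓕 w₂) (𝓕 w₂)) ξ) t := by
  obtain ⟨w₁, hw₁, h₁⟩ := h₁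
  obtain ⟨w₂, hw₂, h₂⟩ := h₂
  refine ⟨w₁, w₂, hw₁, hw₂, ?_⟩
  set χ := heatTest hc hd μ (t₀ - t) with hχ
  have hA : HasDerivAt (fun τ => (heatTest hc hd μ (t₀ - τ)).toLp 2 volume)
      (-(heatTest (hasCompactSupport_linSymb_mul hc μ) (contDiff_linSymb_mul hd μ) μ
        (t₀ - t)).toLp 2 volume) t := by
    have h3 := (hasDerivAt_heatTest hc hd μ (t₀ - t)).scomp t ((hasDerivAt_id t).const_sub t₀)
    rw [neg_one_smul] at h3
    exact h3
  have hE : ContinuousAt (fun τ => (f₁ τ).hat - (f₂ τ).hat) t :=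
    ((Sob.hatL s).continuous.continuousAt.comp hf₁).sub
      ((Sob.hatL s).continuous.continuousAt.comp hf₂)
  have key : ∀ (f : Sob s) (w : L2),
      dx (dx f.val) (𝓕 χ) + (μ : ℂ) * invSqrtOneSubLaplacian f.val (𝓕 χ) +
        (1 / 2 : ℂ) * ∫ x, 𝓕 χ x * (w x) ^ 2 =
      pairS s (heatTest (hasCompactSupport_linSymb_mul hc μ) (contDiff_linSymb_mul hd μ) μ
        (t₀ - t)) f.hat + (1 / 2 : ℂ) * ∫ ξ, χ ξ * convL2 (𝓕 w) (𝓕 w) ξ := by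
    intro f w
    rw [integral_mul_convL2, FourierTransform.fourierInv_fourier_eq, ← pairS_raise_heatTest hμ hs,
      ← f.synth_hat, ← pairS_raise_genSymb hμ hs, FourierTransform.fourierInv_fourier_eq]
    simp only [sq]
    rfl
  have hpair : ∀ f : Sob s, f.val (𝓕 χ) = pairS s χ f.hat := fun f => by
    conv_lhs => rw [← f.synth_hat]
    rw [synth_apply_eq_pairS hs, FourierTransform.fourierInv_fourier_eq]
  have hw := ((h₁ (𝓕 χ)).sub (h₂ (𝓕 χ))).congr_of_eventuallyEq
    (f₁ := fun τ => pairB s (χ.toLp 2 volume) ((f₁ τ).hat - (f₂ τ).hat))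
    (Eventually.of_forall fun τ => by
      dsimp only
      rw [pairB_toLp, map_sub, Pi.sub_apply, hpair, hpair])
  refine (hasDerivAt_bilin (pairB s) hA hE hw).congr_deriv ?_
  have hi : ∀ f : L2, Integrable fun ξ => χ ξ * convL2 f f ξ :=
    fun f => integrable_mul_bcf χ.integrable _
  have hsub : ∫ ξ, χ ξ * (convL2 (𝓕 w₁) (𝓕 w₁) - convL2 (𝓕 w₂) (𝓕 w₂)) ξ =
      (∫ ξ, χ ξ * convL2 (𝓕 w₁) (𝓕 w₁) ξ) - ∫ ξ, χ ξ * convL2 (𝓕 w₂) (𝓕 w₂) ξ := by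
    rw [← integral_sub (hi _) (hi _)]
    simp only [BoundedContinuousFunction.sub_apply, mul_sub]
  rw [key, key, hsub, map_neg, neg_apply, pairB_toLp, map_sub]
  ring

/-! ### Uniqueness: the estimate of the difference of two solutions -/

/-- The factorization `f² - g² = (f - g) f + g (f - g)`. -/
theorem norm_convL2_sub_le (f g : L2) :
    ‖convL2 f f - convL2 g g‖ ≤ ‖f - g‖ * (‖f‖ + ‖g‖) := by
  have hle : ∀ f g : L2, ‖convL2 f g‖ ≤ ‖f‖ * ‖g‖ := fun f g =>
    (BoundedContinuousFunction.norm_le (by positivity)).mpr fun ξ =>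
      (norm_convL2_apply_le f g ξ).trans (integral_norm_conv_le f g ξ)
  have h : convL2 f f - convL2 g g = convL2 (f - g) f + convL2 g (f - g) := by
    simp only [map_sub, sub_apply]
    abel
  rw [h]
  refine (norm_add_le _ _).trans ((add_le_add (hle _ _) (hle _ _)).trans (le_of_eq (by ring)))

/-- An `L²` function is bounded by `c` if its integrals against smooth compactly supported
functions are. -/
theorem norm_le_of_forall_test {F : L2} {c : ℝ} (hc0 : 0 ≤ c)
    (h : ∀ (η : ℝ → ℂ) (g : L2), g =ᵐ[volume] η → HasCompactSupport η → ContDiff ℝ ∞ η →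
      ‖∫ ξ, η ξ * F ξ‖ ≤ ‖g‖ * c) : ‖F‖ ≤ c := by
  have hclosed : IsClosed {g : L2 | ‖inner ℂ g F‖ ≤ ‖g‖ * c} :=
    isClosed_le (by fun_prop) (by fun_prop)
  have hall : ∀ g : L2, ‖inner ℂ g F‖ ≤ ‖g‖ * c := by
    intro g
    have hd := Lp.dense_hasCompactSupport_contDiff (E := ℝ) (F := ℂ) (μ := volume) (p := 2)
      (by norm_num)
    refine hclosed.closure_subset_iff.mpr ?_ (hd g)
    rintro g ⟨η, hη, hc, hs⟩
    have hη' : (star g : L2) =ᵐ[volume] fun ξ => (starRingEnd ℂ) (η ξ) := by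
      filter_upwards [Lp.coeFn_star g, hη] with ξ h1 h2
      rw [h1, Pi.star_apply, h2]
      rfl
    have h1 := h (fun ξ => (starRingEnd ℂ) (η ξ)) (star g) hη' (hc.comp_left (map_zero _))
      (Complex.conjCLE.contDiff.comp hs)
    have h3 : ‖(star g : L2)‖ = ‖g‖ := by
      rw [Lp.norm_def, Lp.norm_def]
      congr 1
      refine eLpNorm_congr_norm_ae ?_
      filter_upwards [Lp.coeFn_star g] with ξ h4
      rw [h4, Pi.star_apply, norm_star]
    rw [h3] at h1
    refine le_trans (le_of_eq ?_) h1
    rw [L2.inner_def]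
    congr 1
    refine integral_congr_ae ?_
    filter_upwards [hη] with ξ h2
    rw [RCLike.inner_apply, h2, mul_comm]
  by_contra hlt
  push Not at hlt
  have h1 := hall F
  rw [inner_self_eq_norm_sq_to_K] at h1
  simp only [norm_pow, Complex.coe_algebraMap, Complex.norm_real, norm_norm] at h1
  nlinarith

section Test

variable {η : ℝ → ℂ}

theorem hasCompactSupport_dSymb_mul (hc : HasCompactSupport η) :
    HasCompactSupport fun ξ => dSymb ξ * η ξ := hc.mul_left

theorem contDiff_dSymb_mul (hd : ContDiff ℝ ∞ η) : ContDiff ℝ ∞ fun ξ => dSymb ξ * η ξ := by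
  refine ContDiff.mul ?_ hd
  unfold dSymb
  exact contDiff_const.mul Complex.ofRealCLM.contDiff

/-- The smoothing bound behind uniqueness: one derivative costs `r ^ (-3/4)`. -/
theorem norm_integral_heatTest_le {μ T : ℝ} (hμ : 0 < μ) (hc : HasCompactSupport η)
    (hd : ContDiff ℝ ∞ η) {g : L2} (hg : g =ᵐ[volume] η) {r : ℝ} (hr : r ∈ Ioc 0 T) (y : BCF) :
    ‖∫ ξ, heatTest (hasCompactSupport_dSymb_mul hc) (contDiff_dSymb_mul hd) μ r ξ * y ξ‖ ≤
      2 * Real.pi * ‖g‖ * kvecConst μ T 1 * r ^ (-(3 / 4) : ℝ) * ‖y‖ := by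
  have h1 : ‖∫ ξ, heatTest (hasCompactSupport_dSymb_mul hc) (contDiff_dSymb_mul hd) μ r ξ * y ξ‖ ≤
      ∫ ξ, 2 * Real.pi * ‖y‖ * (‖g ξ‖ * ‖kvec μ 1 r ξ‖) := by
    refine norm_integral_le_of_norm_le (Integrable.const_mul ?_ _) ?_
    · simpa only [norm_mul] using (integrable_mul_l2 g (kvec μ 1 r)).norm
    · filter_upwards [hg, coe_kvec hμ zero_le_one le_rfl hr.1] with ξ h1 h2
      have h3 : |ξ| ≤ japan 1 ξ := abs_le_japan_one ξ
      rw [h1, h2, heatTest_apply, norm_mul, norm_mul, norm_mul, norm_mul, norm_dSymb,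
        Complex.norm_real, Real.norm_eq_abs, abs_of_pos (japan_pos 1 ξ)]
      calc 2 * Real.pi * |ξ| * ‖η ξ‖ * ‖heatSymb μ r ξ‖ * ‖y ξ‖
          ≤ 2 * Real.pi * japan 1 ξ * ‖η ξ‖ * ‖heatSymb μ r ξ‖ * ‖y‖ := by
            have := Real.pi_pos
            have := japan_pos 1 ξ
            gcongr
            exact y.norm_coe_le_norm ξ
        _ = _ := by ring
  refine h1.trans ?_
  rw [integral_const_mul]
  have h2 : ∫ ξ, ‖g ξ‖ * ‖kvec μ 1 r ξ‖ ≤ ‖g‖ * (kvecConst μ T 1 * r ^ (-(3 / 4) : ℝ)) := by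
    refine (integral_norm_mul_le g _).trans (mul_le_mul_of_nonneg_left ?_ (norm_nonneg _))
    refine (norm_kvec_le hμ zero_le_one le_rfl hr).trans (le_of_eq ?_)
    norm_num
  have := Real.pi_pos
  calc _ ≤ 2 * Real.pi * ‖y‖ * (‖g‖ * (kvecConst μ T 1 * r ^ (-(3 / 4) : ℝ))) := by gcongr
    _ = _ := by ring

end Test

/-- The scalar kernel `C r ^ (-3/4)`, with the time weights of the space `X_T^s`. -/
def scalarKernel {s T : ℝ} (hs : 1 / 2 < s) (hT : 0 < T) {C : ℝ} (hC : 0 ≤ C) :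
    DuhamelKernel T ℝ ℝ where
  op r := (C * r ^ (-(3 / 4) : ℝ)) • ContinuousLinearMap.id ℝ ℝ
  bd := C
  b := 3 / 4
  c := 1 - ord s
  e := weightExp s
  T_pos := hT
  bd_nonneg := hC
  b_nonneg := by norm_num
  b_lt := by norm_num
  c_lt := by linarith [half_lt_ord hs]
  gain_pos := by rw [weightExp_eq]; linarith [half_lt_ord hs]
  continuousOn_op := ContinuousOn.smul (f := fun r : ℝ => C * r ^ (-(3 / 4) : ℝ))
    (continuousOn_const.mul fun r hr =>
      (Real.continuousAt_rpow_const _ _ (Or.inl (ne_of_gt hr))).continuousWithinAt)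
    continuousOn_const
  norm_op_le r hr := by
    rw [norm_smul, Real.norm_eq_abs, abs_of_nonneg (mul_nonneg hC (Real.rpow_nonneg hr.1.le _)),
      ContinuousLinearMap.norm_id, mul_one]

theorem scalarKernel_rate {s T : ℝ} (hs : 1 / 2 < s) (hT : 0 < T) {C : ℝ} (hC : 0 ≤ C)
    (g : C(Icc (0 : ℝ) T, ℝ)) (t τ : ℝ) : (scalarKernel hs hT hC).rate g t τ =
      τ ^ (-(1 - ord s)) * (C * (t - τ) ^ (-(3 / 4) : ℝ) * g (projIcc 0 T hT.le τ)) := rfl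

section Difference

variable {μ s T : ℝ} (hμ : 0 < μ) (hs : 1 / 2 < s) (hT : 0 < T)

/-- The Fourier transform of the derivative of the difference of two elements of `H^s`. -/
theorem dx_hat_sub (hs0 : 0 ≤ s) {f g : Sob s} {w₁ w₂ : L2} (h₁ : dx f.val = w₁)
    (h₂ : dx g.val = w₂) : ∀ᵐ ξ, dSymb ξ * (japan (-s) ξ * (f.hat - g.hat : L2) ξ) =
      (𝓕 w₁ - 𝓕 w₂ : L2) ξ := by
  rw [← f.synth_hat, dx_synth_eq_iff hs0] at h₁
  rw [← g.synth_hat, dx_synth_eq_iff hs0] at h₂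
  filter_upwards [h₁, h₂, Lp.coeFn_sub f.hat g.hat, Lp.coeFn_sub (𝓕 w₁ : L2) (𝓕 w₂)]
    with ξ h1 h2 h3 h4
  rw [h3, h4, Pi.sub_apply, Pi.sub_apply, ← h1, ← h2]
  ring

/-- The curves `u`, extended to all real times. -/
def XSpace.ext (hT : 0 < T) (u : XSpace s T) (τ : ℝ) : Sob s := IccExtend hT.le u.curve τ

theorem XSpace.ext_apply (hT : 0 < T) (u : XSpace s T) (t : Icc (0 : ℝ) T) :
    u.ext hT t = u.curve t := IccExtend_val _ _ _

theorem XSpace.continuous_ext (hT : 0 < T) (u : XSpace s T) : Continuous (u.ext hT) :=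
  u.curve.continuous.Icc_extend'

/-- The time-weighted norm of the derivative of the difference of two curves. -/
def gap (u v : XSpace s T) (t : Icc (0 : ℝ) T) : ℝ :=
  weighted s t ((u - v).curve t).val

theorem XSpace.weighted_le (u : XSpace s T) (t : Icc (0 : ℝ) T) :
    weighted s t (u.curve t).val ≤ ‖u‖ :=
  (le_add_of_nonneg_left (norm_nonneg _)).trans (u.le_norm t)

theorem norm_le_of_weighted_le {t M : ℝ} (ht : 0 < t) {f : Distr} {w : L2} (hf : dx f = w)
    (hM : weighted s t f ≤ M) : ‖w‖ ≤ t ^ (-weightExp s) * M := by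
  rw [weighted, if_pos ht, hf, l2Norm_coe] at hM
  calc ‖w‖ = t ^ (-weightExp s) * (t ^ weightExp s * ‖w‖) := by
        rw [← mul_assoc, ← Real.rpow_add ht, neg_add_cancel, Real.rpow_zero, one_mul]
    _ ≤ _ := by gcongr

/-- The constant in the estimate of the difference of two solutions with norms adding up to `M`. -/
def gapConst (μ T M : ℝ) : ℝ := Real.pi * kvecConst μ T 1 * M

theorem gapConst_nonneg {M : ℝ} (hM : 0 ≤ M) : 0 ≤ gapConst μ T M := by
  have := kvecConst_nonneg μ T 1
  have := Real.pi_pos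
  unfold gapConst
  positivity

theorem dx_sub_eq {f g : Distr} {w₁ w₂ : L2} (h₁ : dx f = w₁) (h₂ : dx g = w₂) :
    dx (f - g) = ((w₁ - w₂ : L2) : Distr) := by
  rw [sub_eq_add_neg, ← neg_one_smul ℝ g, dx_add, dx_smul, h₁, h₂, ← coe_smul, ← coe_add,
    neg_one_smul, ← sub_eq_add_neg]

/-- The Duhamel estimate for the difference of two solutions with the same initial value. It is proved
for the curves themselves, by duality, so that no mild formulation of the equation is needed. -/
theorem gap_le (hμ : 0 < μ) {φ : Sob s} {u v : XSpace s T} (hu : IsSolutionOn μ hT φ u)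
    (hv : IsSolutionOn μ hT φ v) {g : C(Icc (0 : ℝ) T, ℝ)} (hg : ∀ t, gap u v t ≤ g t)
    (t₀ : Icc (0 : ℝ) T) : gap u v t₀ ≤
      (scalarKernel hs hT (gapConst_nonneg (μ := μ) (T := T)
        (add_nonneg (norm_nonneg u) (norm_nonneg v)))).duh g t₀ := by
  have hs0 : 0 ≤ s := by linarith
  set M := ‖u‖ + ‖v‖ with hM
  have hM0 : 0 ≤ M := add_nonneg (norm_nonneg u) (norm_nonneg v)
  set K := scalarKernel hs hT (gapConst_nonneg (μ := μ) (T := T) hM0) with hK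
  have hgap0 : ∀ t, 0 ≤ gap u v t := fun t => weighted_nonneg _ _ _
  have hg0 : ∀ t, 0 ≤ g t := fun t => (hgap0 t).trans (hg t)
  rcases eq_or_lt_of_le t₀.2.1 with h0 | h0
  · rw [DuhamelKernel.duh_apply, ← h0, DuhamelKernel.duhFun_zero_time, gap, weighted, ← h0,
      if_neg (lt_irrefl _)]
  have ht₀ : (t₀ : ℝ) ∈ Ioc 0 T := ⟨h0, t₀.2.2⟩
  rw [DuhamelKernel.duh_apply, DuhamelKernel.duhFun_eq_conv _ _ ht₀]
  obtain ⟨w₁, hw₁⟩ := u.memL2 t₀ h0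
  obtain ⟨w₂, hw₂⟩ := v.memL2 t₀ h0
  have hdw : dx ((u - v).curve t₀).val = ((w₁ - w₂ : L2) : Distr) := dx_sub_eq hw₁ hw₂
  rw [gap, weighted, if_pos h0, hdw, l2Norm_coe, smul_eq_mul]
  refine mul_le_mul_of_nonneg_left ?_ (Real.rpow_nonneg h0.le _)
  have hnorm : ‖w₁ - w₂‖ = ‖(𝓕 w₁ - 𝓕 w₂ : L2)‖ := by
    rw [← Lp.norm_fourier_eq]
    exact congrArg norm (map_sub fourierL2 w₁ w₂)
  rw [hnorm]
  have hrate0 : ∀ τ ∈ Icc 0 (t₀ : ℝ), 0 ≤ K.rate g t₀ τ := fun τ hτ => by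
    rw [hK, scalarKernel_rate]
    have h1 := gapConst_nonneg (μ := μ) (T := T) hM0
    have h2 := hg0 (projIcc 0 T hT.le τ)
    have h3 := Real.rpow_nonneg hτ.1 (-(1 - ord s))
    have h4 : 0 ≤ (t₀ - τ) ^ (-(3 / 4) : ℝ) := Real.rpow_nonneg (by linarith [hτ.2]) _
    positivity
  refine norm_le_of_forall_test ?_ fun η gη hgη hηc hηd => ?_
  · exact intervalIntegral.integral_nonneg h0.le hrate0
  set E : ℝ → L2 := fun τ => (u.ext hT τ).hat - (v.ext hT τ).hat with hE
  have hEc : Continuous E :=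
    ((Sob.hatL s).continuous.comp (u.continuous_ext hT)).sub
      ((Sob.hatL s).continuous.comp (v.continuous_ext hT))
  -- the difference tested against the backward heat flow of `∂ₓ η`: it vanishes at `τ = 0`, and at
  -- `τ = t₀` it is the pairing of `η` with the difference of the derivatives
  set Θ : ℝ → ℂ := fun τ => pairS s (heatTest (hasCompactSupport_dSymb_mul hηc)
    (contDiff_dSymb_mul hηd) μ (t₀ - τ)) (E τ) with hΘ
  have hΘc : Continuous Θ := by
    have h1 : Continuous fun r => (heatTest (hasCompactSupport_dSymb_mul hηc)
        (contDiff_dSymb_mul hηd) μ r).toLp 2 volume :=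
      continuous_iff_continuousAt.mpr fun r => (hasDerivAt_heatTest _ _ μ r).continuousAt
    have h2 : Continuous fun τ => (heatTest (hasCompactSupport_dSymb_mul hηc)
        (contDiff_dSymb_mul hηd) μ (t₀ - τ)).toLp 2 volume := h1.comp (by fun_prop)
    exact ((pairB s).continuous.comp h2).clm_apply hEc
  have hΘ0 : Θ 0 = 0 := by
    have h1 : u.ext hT 0 = v.ext hT 0 := by
      have h2 := u.ext_apply hT ⟨0, left_mem_Icc.mpr hT.le⟩
      have h3 := v.ext_apply hT ⟨0, left_mem_Icc.mpr hT.le⟩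
      exact (h2.trans hu.1).trans (h3.trans hv.1).symm
    simp only [hΘ, hE, h1, sub_self, map_zero]
  have hΘt : Θ t₀ = ∫ ξ, η ξ * (𝓕 w₁ - 𝓕 w₂ : L2) ξ := by
    simp only [hΘ, hE, sub_self]
    rw [pairS_apply hs0, XSpace.ext_apply, XSpace.ext_apply]
    refine integral_congr_ae ?_
    filter_upwards [dx_hat_sub hs0 hw₁ hw₂] with ξ h1
    rw [← h1, heatTest_apply]
    simp only [heatSymb, zero_mul, Real.exp_zero, Complex.ofReal_one]
    ring
  have hd : ∀ τ ∈ Ioo 0 (t₀ : ℝ), ∃ d, HasDerivAt Θ d τ ∧ ‖d‖ ≤ ‖gη‖ * K.rate g t₀ τ := by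
    intro τ hτ
    have hτT : τ ∈ Ioo 0 T := ⟨hτ.1, hτ.2.trans_le t₀.2.2⟩
    have hτI : τ ∈ Icc 0 T := ⟨hτ.1.le, hτT.2.le⟩
    obtain ⟨x₁, x₂, hx₁, hx₂, hder⟩ := hasDerivAt_pairS_heatTest hμ hs0
      (hasCompactSupport_dSymb_mul hηc) (contDiff_dSymb_mul hηd) t₀
      (u.continuous_ext hT).continuousAt (v.continuous_ext hT).continuousAt
      (hu.2 τ hτT) (hv.2 τ hτT)
    refine ⟨_, hder, ?_⟩
    have e1 : u.ext hT τ = u.curve ⟨τ, hτI⟩ := u.ext_apply hT ⟨τ, hτI⟩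
    have e2 : v.ext hT τ = v.curve ⟨τ, hτI⟩ := v.ext_apply hT ⟨τ, hτI⟩
    rw [e1] at hx₁
    rw [e2] at hx₂
    have n1 := norm_le_of_weighted_le hτ.1 hx₁ (u.weighted_le ⟨τ, hτI⟩)
    have n2 := norm_le_of_weighted_le hτ.1 hx₂ (v.weighted_le ⟨τ, hτI⟩)
    have n3 := norm_le_of_weighted_le hτ.1 (f := ((u - v).curve ⟨τ, hτI⟩).val)
      (dx_sub_eq hx₁ hx₂) (hg ⟨τ, hτI⟩)
    have hfs : (𝓕 x₁ - 𝓕 x₂ : L2) = 𝓕 (x₁ - x₂ : L2) := (map_sub fourierL2 x₁ x₂).symm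
    have hy := norm_convL2_sub_le (𝓕 x₁) (𝓕 x₂)
    rw [hfs, Lp.norm_fourier_eq, Lp.norm_fourier_eq, Lp.norm_fourier_eq] at hy
    have hint := norm_integral_heatTest_le (T := T) hμ hηc hηd hgη (r := t₀ - τ)
      ⟨by linarith [hτ.2], by linarith [hτ.1, t₀.2.2]⟩
      (convL2 (𝓕 x₁) (𝓕 x₁) - convL2 (𝓕 x₂) (𝓕 x₂))
    have hk := kvecConst_nonneg μ T 1
    have hπ := Real.pi_pos
    have hr : 0 ≤ (t₀ - τ) ^ (-(3 / 4) : ℝ) := Real.rpow_nonneg (by linarith [hτ.2]) _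
    have hw := Real.rpow_nonneg hτ.1.le (-weightExp s)
    have hexp : τ ^ (-(1 - ord s)) = τ ^ (-weightExp s) * τ ^ (-weightExp s) := by
      rw [← Real.rpow_add hτ.1, weightExp_eq]
      ring_nf
    rw [norm_mul, hK, scalarKernel_rate, projIcc_of_mem hT.le hτI, hexp, gapConst]
    have hy' : ‖convL2 (𝓕 x₁) (𝓕 x₁) - convL2 (𝓕 x₂) (𝓕 x₂)‖ ≤
        (τ ^ (-weightExp s) * g ⟨τ, hτI⟩) * (τ ^ (-weightExp s) * M) := by
      refine hy.trans (mul_le_mul n3 ?_ (by positivity) (mul_nonneg hw (hg0 _)))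
      rw [hM, mul_add]
      exact add_le_add n1 n2
    calc ‖(1 / 2 : ℂ)‖ * _ ≤ 1 / 2 * (2 * Real.pi * ‖gη‖ * kvecConst μ T 1 *
          (t₀ - τ) ^ (-(3 / 4) : ℝ) *
          ((τ ^ (-weightExp s) * g ⟨τ, hτI⟩) * (τ ^ (-weightExp s) * M))) := by
          refine mul_le_mul (by norm_num) (hint.trans ?_) (norm_nonneg _) (by norm_num)
          exact mul_le_mul_of_nonneg_left hy' (by positivity)
      _ = _ := by ring
  have hfin := norm_sub_le_integral_of_norm_deriv_le_of_le h0.le hΘc.continuousOn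
    (fun τ hτ => (hd τ hτ).choose_spec.1.differentiableAt.differentiableWithinAt)
    (B := fun τ => ‖gη‖ * K.rate g t₀ τ) (Eventually.of_forall fun τ hτ => by
      obtain ⟨d, h1, h2⟩ := hd τ hτ
      rwa [h1.deriv]) ((K.intervalIntegrable_rate g ht₀).const_mul _)
  rwa [hΘ0, sub_zero, hΘt, intervalIntegral.integral_const_mul] at hfin

/-- Solutions in `X_T^s` are unique. -/
theorem eq_of_isSolutionOn (hμ : 0 < μ) (hs : 1 / 2 < s) {φ : Sob s} {u v : XSpace s T}
    (hu : IsSolutionOn μ hT φ u) (hv : IsSolutionOn μ hT φ v) : u = v := by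
  have hs0 : 0 ≤ s := by linarith
  obtain ⟨lam, hlam, hw⟩ := (scalarKernel hs hT (gapConst_nonneg (μ := μ) (T := T)
    (add_nonneg (norm_nonneg u) (norm_nonneg v)))).exists_weight (κ := 1 / 2) (by norm_num)
  -- each application of the Duhamel estimate halves the weighted bound of the gap
  have hgap : ∀ (k : ℕ) (t : Icc (0 : ℝ) T),
      gap u v t ≤ ‖u - v‖ * (1 / 2) ^ k * Real.exp (lam * t) := by
    intro k
    induction k with
    | zero =>
      intro t
      rw [pow_zero, mul_one]
      exact ((u - v).weighted_le t).trans (le_mul_of_one_le_right (norm_nonneg _)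
        (Real.one_le_exp (mul_nonneg hlam.le t.2.1)))
    | succ k ih =>
      intro t
      set g : C(Icc (0 : ℝ) T, ℝ) :=
        ⟨fun t => ‖u - v‖ * (1 / 2) ^ k * Real.exp (lam * t), by fun_prop⟩ with hg
      refine (gap_le hs hT hμ hu hv (g := g) ih t).trans ((le_abs_self _).trans ?_)
      refine (hw g (‖u - v‖ * (1 / 2) ^ k) (by positivity) (fun τ => le_of_eq ?_) t).trans
        (le_of_eq (by ring))
      exact Real.norm_of_nonneg (mul_nonneg (mul_nonneg (norm_nonneg _) (by positivity))
        (Real.exp_pos _).le)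
  have hgap0 : ∀ t, gap u v t ≤ 0 := fun t => by
    have h1 : Tendsto (fun k : ℕ => ‖u - v‖ * (1 / 2) ^ k * Real.exp (lam * t)) atTop (𝓝 0) := by
      have h2 := ((tendsto_pow_atTop_nhds_zero_of_lt_one (r := (1 / 2 : ℝ)) (by norm_num)
        (by norm_num)).const_mul ‖u - v‖).mul_const (Real.exp (lam * t))
      simpa using h2
    exact ge_of_tendsto' h1 fun k => hgap k t
  refine Subtype.ext (ContinuousMap.ext fun t => ?_)
  change u.curve t = v.curve t
  rcases eq_or_lt_of_le t.2.1 with h0 | h0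
  · have ht : t = ⟨0, left_mem_Icc.mpr hT.le⟩ := Subtype.ext h0.symm
    rw [ht, hu.1, hv.1]
  obtain ⟨w₁, hw₁⟩ := u.memL2 t h0
  obtain ⟨w₂, hw₂⟩ := v.memL2 t h0
  have h1 : ‖w₁ - w₂‖ ≤ 0 := by
    have h2 := norm_le_of_weighted_le h0 (f := ((u - v).curve t).val) (dx_sub_eq hw₁ hw₂) (hgap0 t)
    rwa [mul_zero] at h2
  rw [sub_eq_zero.mp (norm_le_zero_iff.mp h1)] at hw₁
  -- equal derivatives determine the Fourier transforms away from `ξ = 0`, hence almost everywhere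
  have h2 : (u.curve t).hat - (v.curve t).hat = 0 := by
    ext1
    filter_upwards [dx_hat_sub hs0 hw₁ hw₂, Lp.coeFn_zero ℂ 2 (volume : Measure ℝ),
      compl_mem_ae_iff.mpr (measure_singleton (0 : ℝ))] with ξ h3 h4 h5
    rw [sub_self, h4, Pi.zero_apply] at h3
    rw [h4, Pi.zero_apply]
    have h6 : dSymb ξ ≠ 0 := by
      rw [← norm_ne_zero_iff, norm_dSymb]
      have := abs_pos.mpr (show ξ ≠ 0 from h5)
      positivity
    have h7 : (japan (-s) ξ : ℂ) ≠ 0 := Complex.ofReal_ne_zero.mpr (japan_pos _ _).ne'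
    exact (mul_eq_zero.mp ((mul_eq_zero.mp h3).resolve_left h6)).resolve_left h7
  refine Sob.ext ?_
  rw [← Sob.synth_hat, ← Sob.synth_hat, sub_eq_zero.mp h2]

end Difference

/-! ### The solution map -/

theorem SolvesAt.congr {μ t : ℝ} {f f' : ℝ → Distr} (h : SolvesAt μ f t) (hff : f' =ᶠ[𝓝 t] f) :
    SolvesAt μ f' t := by
  obtain ⟨w, hw, hd⟩ := h
  have ht : f' t = f t := hff.self_of_nhds
  refine ⟨w, by rw [ht, hw], fun ψ => ?_⟩
  rw [ht]
  exact (hd ψ).congr_of_eventuallyEq (hff.fun_comp fun g : Distr => g ψ)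

section SolutionMap

variable {μ s T : ℝ} (hμ : 0 < μ) (hs : 1 / 2 < s) (hT : 0 < T)

/-- The curve `t ^ a (1 + ξ²) ^ (σ / 2)` times the Fourier transform of `∂ₓ u(t)`, for the solution
`u` with initial value `φ`. -/
def derivCurve (φ : Sob s) : C(Icc (0 : ℝ) T, L2) :=
  (exists_volterra_linZ hμ hs hT φ.conjRefl_hat).choose

theorem volterra_derivCurve (φ : Sob s) :
    (kerW hμ hs hT).volterra (nlin s) (derivCurve hμ hs hT φ) = linZ hμ hs T φ.hat :=
  (exists_volterra_linZ hμ hs hT φ.conjRefl_hat).choose_spec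

theorem conjRefl_derivCurve (φ : Sob s) (t : Icc (0 : ℝ) T) :
    conjRefl (derivCurve hμ hs hT φ t) = derivCurve hμ hs hT φ t :=
  conjRefl_of_volterra hμ hs hT (fun t => conjRefl_linZ hμ hs φ.conjRefl_hat t)
    (volterra_derivCurve hμ hs hT φ) t

theorem contDiff_derivCurve : ContDiff ℝ ∞ (derivCurve hμ hs hT) :=
  (kerW hμ hs hT).contDiff_of_volterra_eq (nlin s) ((linZ hμ hs T).comp (Sob.hatL s))
    (volterra_derivCurve hμ hs hT)

/-- The nonlinearity along the solution. -/
def nlinCurve (φ : Sob s) : C(Icc (0 : ℝ) T, BCF) :=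
  curveBilin (nlin s) (derivCurve hμ hs hT φ) (derivCurve hμ hs hT φ)

/-- The solution with initial value `φ`, as an element of `X_T^s`. -/
def solX (φ : Sob s) : XSpace s T :=
  mkX (by linarith) (linPair hμ hs T φ.hat + duhPair hμ hs hT (nlinCurve hμ hs hT φ))

/-- The solution is a quadratic expression in `derivCurve`, which is smooth. -/
theorem contDiff_solX : ContDiff ℝ ∞ (solX hμ hs hT) := by
  have hz := contDiff_derivCurve hμ hs hT
  have hg : ContDiff ℝ ∞ (nlinCurve hμ hs hT) :=
    (ContDiff.comp (g := curveBilin (T := T) (nlin s)) (ContinuousLinearMap.contDiff _)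
      hz).clm_apply hz
  have hs0 : 0 ≤ s := by linarith
  set A : Sob s →L[ℝ] XSpace s T := ((mkX hs0).comp (linPair hμ hs T)).comp (Sob.hatL s) with hA
  set B : C(Icc (0 : ℝ) T, BCF) →L[ℝ] XSpace s T := (mkX hs0).comp (duhPair hμ hs hT) with hB
  have h : solX hμ hs hT = fun φ => A φ + B (nlinCurve hμ hs hT φ) := by
    funext φ
    rw [solX, map_add]
    rfl
  rw [h]
  exact A.contDiff.add (B.contDiff.comp hg)

theorem solX_curve (φ : Sob s) (t : Icc (0 : ℝ) T) : (solX hμ hs hT φ).curve t =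
    Sob.ofHat s (mildCurve hμ hs hT φ.hat (nlinCurve hμ hs hT φ) t) := rfl

theorem conjRefl_mildCurve (φ : Sob s) (t : Icc (0 : ℝ) T) :
    conjRefl (mildCurve hμ hs hT φ.hat (nlinCurve hμ hs hT φ) t) =
      mildCurve hμ hs hT φ.hat (nlinCurve hμ hs hT φ) t := by
  rw [mildCurve, ContinuousMap.add_apply, map_add, conjRefl_linG hμ φ.conjRefl_hat,
    conjRefl_duhU hμ hs hT (g' := nlinCurve hμ hs hT φ)]
  intro τ
  rw [nlinCurve, curveBilin_apply, nlin, bcfConjRefl_prodBilin, conjRefl_derivCurve]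

theorem solX_val (φ : Sob s) (t : Icc (0 : ℝ) T) : ((solX hμ hs hT φ).curve t).val =
    synth s (mildCurve hμ hs hT φ.hat (nlinCurve hμ hs hT φ) t) := by
  rw [solX_curve, Sob.val_ofHat, realProj_eq_self (conjRefl_mildCurve hμ hs hT φ t)]

theorem dx_solX (φ : Sob s) (t : Icc (0 : ℝ) T) (ht : 0 < (t : ℝ)) :
    dx ((solX hμ hs hT φ).curve t).val = (derivL2 s t (derivCurve hμ hs hT φ t) : L2) := by
  have h1 := dx_ofHat (by linarith : 0 ≤ s)
    (linPair hμ hs T φ.hat + duhPair hμ hs hT (nlinCurve hμ hs hT φ)).2 t ht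
  have h2 : (linPair hμ hs T φ.hat + duhPair hμ hs hT (nlinCurve hμ hs hT φ)).1.2 =
      derivCurve hμ hs hT φ := by
    change linZ hμ hs T φ.hat + (kerW hμ hs hT).duh (nlinCurve hμ hs hT φ) = _
    rw [← volterra_derivCurve hμ hs hT φ, DuhamelKernel.volterra, nlinCurve, sub_add_cancel]
  rw [h2, realProj_eq_self (conjRefl_derivCurve hμ hs hT φ t)] at h1
  exact h1

theorem isSolutionOn_solX (φ : Sob s) : IsSolutionOn μ hT φ (solX hμ hs hT φ) := by
  refine ⟨?_, fun t ht => ?_⟩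
  · rw [solX_curve, mildCurve, ContinuousMap.add_apply, linG_apply, DuhamelKernel.duh_apply,
      DuhamelKernel.duhFun_zero_time, add_zero, heat_zero, Sob.ofHat_hat]
  · refine solvesAt_mild hμ hs hT (G := φ.hat) (z := derivCurve hμ hs hT φ) (fun τ hτ => ?_) ht ?_
    · exact solX_val hμ hs hT φ _
    · have ht' : t ∈ Icc 0 T := ⟨ht.1.le, ht.2.le⟩
      rw [IccExtend_of_mem _ _ ht', projIcc_of_mem hT.le ht']
      exact dx_solX hμ hs hT φ ⟨t, ht'⟩ ht.1

/-- Restriction of a curve to a shorter time interval. -/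
def XSpace.restrict {T' : ℝ} (h : T ≤ T') (u : XSpace s T') : XSpace s T :=
  ⟨u.curve.comp ⟨inclusion (Icc_subset_Icc_right h), continuous_inclusion _⟩,
    fun t ht => u.memL2 (inclusion (Icc_subset_Icc_right h) t) ht, ‖u‖, by
      rintro _ ⟨t, rfl⟩
      exact u.weighted_le (inclusion (Icc_subset_Icc_right h) t)⟩

theorem XSpace.restrict_curve {T' : ℝ} (h : T ≤ T') (u : XSpace s T') (t : Icc (0 : ℝ) T) :
    (u.restrict h).curve t = u.curve ⟨t, t.2.1, t.2.2.trans h⟩ := rfl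

theorem XSpace.ext_of_mem (u : XSpace s T) {t : ℝ} (ht : t ∈ Icc 0 T) :
    u.ext hT t = u.curve ⟨t, ht⟩ := u.ext_apply hT ⟨t, ht⟩

theorem isSolutionOn_restrict {T' : ℝ} (hT' : 0 < T') (h : T ≤ T') {φ : Sob s} {u : XSpace s T'}
    (hu : IsSolutionOn μ hT' φ u) : IsSolutionOn μ hT φ (u.restrict h) := by
  refine ⟨hu.1, fun t ht => (hu.2 t ⟨ht.1, ht.2.trans_le h⟩).congr ?_⟩
  filter_upwards [Icc_mem_nhds ht.1 ht.2] with τ hτ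
  change ((u.restrict h).ext hT τ).val = (u.ext hT' τ).val
  rw [XSpace.ext_of_mem hT _ hτ, XSpace.ext_of_mem hT' _ ⟨hτ.1, hτ.2.trans h⟩,
    XSpace.restrict_curve]

/-- The solutions on different time intervals are compatible. -/
theorem solX_ext_eq {T' : ℝ} (hT' : 0 < T') (h : T ≤ T') (φ : Sob s) {t : ℝ}
    (ht : t ∈ Icc 0 T) : (solX hμ hs hT φ).ext hT t = (solX hμ hs hT' φ).ext hT' t := by
  have h1 := eq_of_isSolutionOn hT hμ hs (isSolutionOn_solX hμ hs hT φ)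
    (isSolutionOn_restrict hT hT' h (isSolutionOn_solX hμ hs hT' φ))
  rw [h1, XSpace.ext_of_mem hT _ ht, XSpace.ext_of_mem hT' _ ⟨ht.1, ht.2.trans h⟩,
    XSpace.restrict_curve]

/-- The global solution with initial value `φ`; at time `t` it is read off from the solution on
`[0, |t| + 1]`. -/
def globalSol (φ : Sob s) (t : ℝ) : Sob s :=
  (solX hμ hs (show 0 < |t| + 1 by positivity) φ).ext (by positivity) t

theorem globalSol_eq (φ : Sob s) {t : ℝ} (ht : t ∈ Icc 0 T) :
    globalSol hμ hs φ t = (solX hμ hs hT φ).ext hT t := by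
  have hpos : 0 < |t| + 1 := by positivity
  have hmem : t ∈ Icc 0 (|t| + 1) := ⟨ht.1, by linarith [le_abs_self t]⟩
  rw [globalSol]
  rcases le_total (|t| + 1) T with h | h
  · exact solX_ext_eq hμ hs hpos hT h φ hmem
  · exact (solX_ext_eq hμ hs hT hpos h φ ht).symm

theorem isGlobalSolution_globalSol (φ : Sob s) : IsGlobalSolution μ φ (globalSol hμ hs φ) := by
  refine ⟨fun t ht => ?_, ?_, fun t ht => ?_⟩
  · have hpos : 0 < t + 1 := by linarith [mem_Ici.mp ht]
    refine ((solX hμ hs hpos φ).continuous_ext hpos).continuousWithinAt.congr_of_eventuallyEq ?_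
      (globalSol_eq hμ hs hpos φ ⟨ht, by linarith⟩)
    filter_upwards [self_mem_nhdsWithin, nhdsWithin_le_nhds (Iio_mem_nhds (lt_add_one t))]
      with τ h1 h2
    exact globalSol_eq hμ hs hpos φ ⟨h1, h2.le⟩
  · rw [globalSol_eq hμ hs one_pos φ (left_mem_Icc.mpr zero_le_one),
      XSpace.ext_of_mem one_pos _ (left_mem_Icc.mpr zero_le_one)]
    exact (isSolutionOn_solX hμ hs one_pos φ).1
  · have hpos : 0 < t + 1 := by linarith
    refine ((isSolutionOn_solX hμ hs hpos φ).2 t ⟨ht, lt_add_one t⟩).congr ?_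
    filter_upwards [Icc_mem_nhds ht (lt_add_one t)] with τ hτ
    exact congrArg Sob.val (globalSol_eq hμ hs hpos φ hτ)

end SolutionMap

end KS

end

theorem theorem1p2 (μ s : ℝ) (hμ : 0 < μ) (hs : 1 / 2 < s) :
    ∃ S : KS.Sob s → ℝ → KS.Sob s,
      (∀ φ : KS.Sob s, KS.IsGlobalSolution μ φ (S φ)) ∧
      ∀ (T : ℝ) (hT : 0 < T), ∃ R : KS.Sob s → KS.XSpace s T,
        (∀ (φ : KS.Sob s) (t : Set.Icc (0 : ℝ) T), (R φ).curve t = S φ t) ∧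
        (∀ (φ : KS.Sob s) (v : KS.XSpace s T), KS.IsSolutionOn μ hT φ v → v = R φ) ∧
        ContDiff ℝ ∞ R := by
  refine ⟨KS.globalSol hμ hs, KS.isGlobalSolution_globalSol hμ hs, fun T hT =>
    ⟨KS.solX hμ hs hT, fun φ t => ?_, fun φ v hv =>
      KS.eq_of_isSolutionOn hT hμ hs hv (KS.isSolutionOn_solX hμ hs hT φ),
      KS.contDiff_solX hμ hs hT⟩⟩
  rw [KS.globalSol_eq hμ hs hT φ t.2, KS.XSpace.ext_apply]
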